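/- Let $d\ge 1$, let $H=-\Delta+|x|^2$ on $\mathbb R^d$, and let $\langle x\rangle=\sqrt{1+|x|^2}$. Let $(h_\alpha)_{\alpha\in\mathbb N^d}$ be the orthonormal basis of $L^2(\mathbb R^d)$ of Hermite functions, so that $Hh_\alpha=\lambda_\alpha h_\alpha$ with $\lambda_\alpha=2(\alpha_1+\dots+\alpha_d)+d$. For $u=\sum_\alpha c_\alpha h_\alpha\in L^2(\mathbb R^d)$ and $s,t\in\mathbb R$ put $e^{itH}u=\sum_\alpha e^{it\lambda_\alpha}c_\alpha h_\alpha$ and $\sqrt H^{\,s}u=\sum_\alpha \lambda_\alpha^{s/2}c_\alpha h_\alpha$ (convergent in $\mathcal S'(\mathbb R^d)$). For $s>-d/2$ let $\sqrt{-\Delta}^{\,s}u\in\mathcal S'(\mathbb R^d)$ be the tempered distribution whose Fourier transform is $|\xi|^s\widehat u(\xi)$, where $\widehat u(\xi)=\int e^{-ix\cdot\xi}u(x)\,dx$. For $\sigma\ge 0$ let $\mathcal H^\sigma(\mathbb R^d)$ be the space of $u\in L^2(\mathbb R^d)$ with $\|u\|_{\mathcal H^\sigma}^2=\|H^{\sigma/2}u\|_{L^2}^2=\sum_\alpha\lambda_\alpha^{\sigma}|c_\alpha|^2<\infty$.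 Theorem (local smoothing for $e^{itH}$). Let $0<\epsilon<\frac12$. There is a constant $C>0$, depending only on $d$ and $\epsilon$, such that for all $u_0\in L^2(\mathbb R^d)$, $$\Big\|\frac{1}{\langle x\rangle^{1/2-\epsilon}}\sqrt H^{\,1/2-2\epsilon}e^{itH}u_0\Big\|_{L^2([-\pi,\pi]\times\mathbb R^d)}\le C\|u_0\|_{L^2(\mathbb R^d)},$$ and for all $u_0\in\mathcal H^{\frac{d-1}2}(\mathbb R^d)$, $$\Big\|\frac{1}{\langle x\rangle^{1/2-\epsilon}}\sqrt{-\Delta}^{\,d/2-2\epsilon}e^{itH}u_0\Big\|_{L^2([-\pi,\pi]\times\mathbb R^d)}\le C\|u_0\|_{\mathcal H^{\frac{d-1}2}(\mathbb R^d)}.$$ In each estimate the left-hand side includes the assertion that, for almost every $t\in[-\pi,\pi]$, the tempered distribution $\sqrt H^{\,1/2-2\epsilon}e^{itH}u_0$, respectively $\sqrt{-\Delta}^{\,d/2-2\epsilon}e^{itH}u_0$, is a function of $x$, given by $G(t,\cdot)$ for a measurable $G$ on $[-\pi,\pi]\times\mathbb R^d$. -/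

import Mathlib

open MeasureTheory SchwartzMap FourierTransform
open scoped ENNReal

namespace HarmonicSmoothing

/-- The Euclidean space `ℝ^d`. -/
abbrev Space (d : ℕ) : Type := EuclideanSpace ℝ (Fin d)

/-- The Hilbert space `L²(ℝ^d; ℂ)`. -/
abbrev L2 (d : ℕ) : Type := Lp ℂ 2 (volume : Measure (Space d))

/-- The differential expression `H f = -Δ f + |x|² f`. -/
noncomputable def harmonicOscillator {d : ℕ} (f : Space d → ℝ) (x : Space d) : ℝ :=
  -Laplacian.laplacian f x + ‖x‖ ^ 2 * f x

/-- The `L²`-normalised Hermite function on the line,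
`(k! √π)^{-1/2} He_k(√2 y) exp(-y²/2)`, where `He_k` is the probabilists' Hermite polynomial
(equivalently `(2^k k! √π)^{-1/2} H_k(y) exp(-y²/2)` with the physicists' polynomial `H_k`). -/
noncomputable def hermiteLine (k : ℕ) (y : ℝ) : ℝ :=
  (Real.sqrt (k.factorial * Real.sqrt Real.pi))⁻¹ *
    Polynomial.aeval (Real.sqrt 2 * y) (Polynomial.hermite k) * Real.exp (-(y ^ 2 / 2))

/-- The Hermite functions on `ℝ^d`: the tensor products `h_α(x) = ∏ j, h_{α j}(x_j)`. They are an
orthonormal basis of `L²(ℝ^d)` and `H h_α = λ_α h_α`. -/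
noncomputable def hermiteFun {d : ℕ} (α : Fin d → ℕ) (x : Space d) : ℝ :=
  ∏ j, hermiteLine (α j) (x j)

/-- The eigenvalue `λ_α = 2 (α_1 + ⋯ + α_d) + d` of `H` on `h_α`. -/
def eigenvalue {d : ℕ} (α : Fin d → ℕ) : ℝ := 2 * ∑ j, (α j : ℝ) + d

lemma hermite_ode (n : ℕ) : (Polynomial.hermite n).derivative.derivative =
    Polynomial.X * (Polynomial.hermite n).derivative - (n : Polynomial ℤ) * Polynomial.hermite n := by
  induction n with
  | zero => simp
  | succ n ih =>
    have h1 : (Polynomial.hermite (n + 1)).derivative =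
        ((n : Polynomial ℤ) + 1) * Polynomial.hermite n := by
      rw [Polynomial.hermite_succ, Polynomial.derivative_sub, Polynomial.derivative_mul, ih,
        Polynomial.derivative_X]
      ring
    rw [h1, Polynomial.hermite_succ, Polynomial.derivative_mul]
    simp
    ring

/-- Auxiliary: the first derivative of `hermiteLine k`. -/
noncomputable def hermiteLineDeriv (k : ℕ) (y : ℝ) : ℝ :=
  (Real.sqrt (k.factorial * Real.sqrt Real.pi))⁻¹ *
    (Real.sqrt 2 * Polynomial.aeval (Real.sqrt 2 * y) (Polynomial.hermite k).derivative -
      y * Polynomial.aeval (Real.sqrt 2 * y) (Polynomial.hermite k)) * Real.exp (-(y ^ 2 / 2))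

lemma hasDerivAt_aux (p : Polynomial ℤ) (y : ℝ) :
    HasDerivAt (fun y : ℝ => Polynomial.aeval (Real.sqrt 2 * y) p)
      (Real.sqrt 2 * Polynomial.aeval (Real.sqrt 2 * y) p.derivative) y := by
  have h := (Polynomial.hasDerivAt_aeval p (Real.sqrt 2 * y)).comp y
    ((hasDerivAt_id y).const_mul (Real.sqrt 2))
  simpa [mul_comm, Function.comp_def] using h

lemma hasDerivAt_gauss (y : ℝ) :
    HasDerivAt (fun y : ℝ => Real.exp (-(y ^ 2 / 2))) (-y * Real.exp (-(y ^ 2 / 2))) y := by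
  have h : HasDerivAt (fun y : ℝ => -(y ^ 2 / 2)) (-(2 * y / 2)) y := by
    have h0 := ((hasDerivAt_pow 2 y).div_const 2).neg
    exact h0.congr_deriv (by simp)
  exact h.exp.congr_deriv (by ring)

lemma hasDerivAt_hermiteLine (k : ℕ) (y : ℝ) :
    HasDerivAt (hermiteLine k) (hermiteLineDeriv k y) y := by
  have h := ((hasDerivAt_aux (Polynomial.hermite k) y).const_mul
    (Real.sqrt (k.factorial * Real.sqrt Real.pi))⁻¹).mul (hasDerivAt_gauss y)
  refine HasDerivAt.congr_deriv (f := hermiteLine k) h ?_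
  unfold hermiteLineDeriv
  ring

lemma hasDerivAt_hermiteLineDeriv (k : ℕ) (y : ℝ) :
    HasDerivAt (hermiteLineDeriv k) ((y ^ 2 - (2 * k + 1)) * hermiteLine k y) y := by
  have h := ((((hasDerivAt_aux (Polynomial.hermite k).derivative y).const_mul (Real.sqrt 2)).sub
    ((hasDerivAt_id y).mul (hasDerivAt_aux (Polynomial.hermite k) y))).const_mul
    (Real.sqrt (k.factorial * Real.sqrt Real.pi))⁻¹).mul (hasDerivAt_gauss y)
  refine HasDerivAt.congr_deriv (f := hermiteLineDeriv k) h ?_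
  rw [hermite_ode]
  unfold hermiteLine
  have h2 : Real.sqrt 2 * Real.sqrt 2 = 2 := Real.mul_self_sqrt (by norm_num)
  simp
  linear_combination ((√√Real.pi)⁻¹ * (√k.factorial)⁻¹ * Real.exp (-(y ^ 2 / 2)) *
    (√2 * y * Polynomial.aeval (√2 * y) (Polynomial.hermite k).derivative -
      k * Polynomial.aeval (√2 * y) (Polynomial.hermite k))) * h2

lemma contDiff_hermiteLine (k : ℕ) : ContDiff ℝ 2 (hermiteLine k) := by
  unfold hermiteLine
  have : ContDiff ℝ 2 fun y : ℝ => Polynomial.aeval (Real.sqrt 2 * y) (Polynomial.hermite k) :=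
    (Polynomial.contDiff_aeval _ _).comp (by fun_prop)
  fun_prop

lemma second_deriv_line {d : ℕ} {f : Space d → ℝ} (hf : ContDiff ℝ 2 f) (x v : Space d)
    {g g' : ℝ → ℝ} {g'' : ℝ} (hg : ∀ t : ℝ, f (x + t • v) = g t) (hg' : ∀ t, HasDerivAt g (g' t) t)
    (hg'' : HasDerivAt g' g'' 0) : iteratedFDeriv ℝ 2 f x ![v, v] = g'' := by
  have hline : ∀ t : ℝ, HasDerivAt (fun t : ℝ => x + t • v) v t := fun t => by
    simpa using ((hasDerivAt_id t).smul_const v).const_add x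
  have h1 : ∀ t : ℝ, fderiv ℝ f (x + t • v) v = g' t := fun t => by
    have := ((hf.differentiable (by norm_num)) (x + t • v)).hasFDerivAt.comp_hasDerivAt t (hline t)
    refine this.unique ?_
    exact (hg' t).congr_of_eventuallyEq (Filter.Eventually.of_forall hg)
  have hd : Differentiable ℝ (fderiv ℝ f) :=
    (hf.fderiv_right (m := 1) (by norm_num)).differentiable (by norm_num)
  have h2 : HasDerivAt (fun t : ℝ => fderiv ℝ f (x + t • v))
      (fderiv ℝ (fderiv ℝ f) (x + (0 : ℝ) • v) v) 0 :=
    (hd (x + (0 : ℝ) • v)).hasFDerivAt.comp_hasDerivAt 0 (hline 0)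
  have h3 : HasDerivAt (fun t : ℝ => fderiv ℝ f (x + t • v) v)
      (fderiv ℝ (fderiv ℝ f) (x + (0 : ℝ) • v) v v) 0 := by
    have := ((ContinuousLinearMap.apply ℝ ℝ v).hasFDerivAt).comp_hasDerivAt 0 h2
    exact this
  rw [zero_smul, add_zero] at h3
  rw [iteratedFDeriv_two_apply]
  exact h3.unique (hg''.congr_of_eventuallyEq (Filter.Eventually.of_forall h1))

/-- The Hermite functions are eigenfunctions of the harmonic oscillator: `H h_α = λ_α h_α`. -/
lemma harmonicOscillator_hermiteFun {d : ℕ} (α : Fin d → ℕ) (x : Space d) :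
    harmonicOscillator (hermiteFun α) x = eigenvalue α * hermiteFun α x := by
  have hf : ContDiff ℝ 2 (hermiteFun α) := by
    unfold hermiteFun
    exact contDiff_prod fun j _ => (contDiff_hermiteLine _).comp (by fun_prop)
  unfold harmonicOscillator
  rw [InnerProductSpace.laplacian_eq_iteratedFDeriv_orthonormalBasis _
    (EuclideanSpace.basisFun (Fin d) ℝ)]
  have key : ∀ i, iteratedFDeriv ℝ 2 (hermiteFun α) x
      ![EuclideanSpace.basisFun (Fin d) ℝ i, EuclideanSpace.basisFun (Fin d) ℝ i] =
      (x i ^ 2 - (2 * α i + 1)) * hermiteFun α x := fun i => by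
    have hs : ∀ t : ℝ, HasDerivAt (fun t : ℝ => x i + t) 1 t := fun t => by
      simpa using (hasDerivAt_id t).const_add (x i)
    refine second_deriv_line hf x _
      (g := fun t => hermiteLine (α i) (x i + t) * ∏ j ∈ Finset.univ.erase i, hermiteLine (α j) (x j))
      (g' := fun t =>
        hermiteLineDeriv (α i) (x i + t) * ∏ j ∈ Finset.univ.erase i, hermiteLine (α j) (x j))
      (fun t => ?_) (fun t => ?_) ?_
    · unfold hermiteFun
      rw [← Finset.mul_prod_erase _ _ (Finset.mem_univ i)]
      congr 1
      · simp
      · refine Finset.prod_congr rfl fun j hj => ?_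
        simp [Finset.ne_of_mem_erase hj]
    · simpa using ((hasDerivAt_hermiteLine (α i) (x i + t)).comp t (hs t)).mul_const _
    · have h := ((hasDerivAt_hermiteLineDeriv (α i) (x i + 0)).comp 0 (hs 0)).mul_const
        (∏ j ∈ Finset.univ.erase i, hermiteLine (α j) (x j))
      refine h.congr_deriv ?_
      unfold hermiteFun
      rw [← Finset.mul_prod_erase _ _ (Finset.mem_univ i)]
      simp
      ring
  simp only [key]
  rw [← Finset.sum_mul, EuclideanSpace.real_norm_sq_eq, Finset.sum_sub_distrib,
    Finset.sum_add_distrib, ← Finset.mul_sum]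
  simp [eigenvalue]
  ring

/-- The Hermite coefficient `∫ h_α f` (`h_α` is real, so this is both the `L²` inner product of `h_α`
with `f` and the bilinear pairing of `f` with `h_α`). -/
noncomputable def hermiteCoeff {d : ℕ} (f : Space d → ℂ) (α : Fin d → ℕ) : ℂ :=
  ∫ x, (hermiteFun α x : ℂ) * f x

lemma poly_mul_exp_bounded (p : Polynomial ℝ) :
    ∃ C : ℝ, ∀ y : ℝ, |p.eval y| * Real.exp (-(y ^ 2 / 4)) ≤ C := by
  induction p using Polynomial.induction_on' with
  | add p q hp hq =>
    obtain ⟨A, hA⟩ := hp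
    obtain ⟨B, hB⟩ := hq
    refine ⟨A + B, fun y => ?_⟩
    have h1 := abs_add_le (p.eval y) (q.eval y)
    have h2 := Real.exp_pos (-(y ^ 2 / 4))
    rw [Polynomial.eval_add]
    nlinarith [hA y, hB y]
  | monomial n a =>
    refine ⟨|a| * (1 + 4 ^ n * n.factorial), fun y => ?_⟩
    have h0 := Real.exp_pos (-(y ^ 2 / 4))
    have h1 : Real.exp (-(y ^ 2 / 4)) ≤ 1 := Real.exp_le_one_iff.2 (by nlinarith [sq_nonneg y])
    have hy : 0 ≤ y ^ 2 / 4 := by positivity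
    have h2 := Real.pow_div_factorial_le_exp (y ^ 2 / 4) hy n
    have h3 : Real.exp (y ^ 2 / 4) * Real.exp (-(y ^ 2 / 4)) = 1 := by
      rw [← Real.exp_add]; simp
    have h4 : (y ^ 2) ^ n ≤ 4 ^ n * n.factorial * Real.exp (y ^ 2 / 4) := by
      rw [div_pow, div_div, div_le_iff₀ (by positivity)] at h2
      linarith
    have h5 : |y| ^ n ≤ 1 + (y ^ 2) ^ n := by
      have : (y ^ 2) ^ n = (|y| ^ n) ^ 2 := by rw [← sq_abs, ← pow_mul, ← pow_mul, mul_comm]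
      nlinarith [sq_nonneg (|y| ^ n - 1), sq_nonneg (|y| ^ n)]
    have h6 : (y ^ 2) ^ n * Real.exp (-(y ^ 2 / 4)) ≤ 4 ^ n * n.factorial := by
      have := mul_le_mul_of_nonneg_right h4 h0.le
      rwa [mul_assoc _ (Real.exp (y ^ 2 / 4)), h3, mul_one] at this
    have h7 : |y| ^ n * Real.exp (-(y ^ 2 / 4)) ≤ 1 + 4 ^ n * n.factorial := by
      have := mul_le_mul_of_nonneg_right h5 h0.le
      linarith
    rw [Polynomial.eval_monomial, abs_mul, abs_pow, mul_assoc]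
    exact mul_le_mul_of_nonneg_left h7 (abs_nonneg a)

lemma hermiteLine_bound (k : ℕ) :
    ∃ C : ℝ, ∀ y : ℝ, |hermiteLine k y| ≤ C * Real.exp (-(y ^ 2 / 4)) := by
  obtain ⟨C, hC⟩ := poly_mul_exp_bounded
    (Polynomial.C (Real.sqrt (k.factorial * Real.sqrt Real.pi))⁻¹ *
      ((Polynomial.hermite k).map (Int.castRingHom ℝ)).comp
        (Polynomial.C (Real.sqrt 2) * Polynomial.X))
  refine ⟨C, fun y => ?_⟩
  have h := hC y
  have e : hermiteLine k y = (Polynomial.C (Real.sqrt (k.factorial * Real.sqrt Real.pi))⁻¹ *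
      ((Polynomial.hermite k).map (Int.castRingHom ℝ)).comp
        (Polynomial.C (Real.sqrt 2) * Polynomial.X)).eval y *
      Real.exp (-(y ^ 2 / 4)) * Real.exp (-(y ^ 2 / 4)) := by
    rw [mul_assoc, ← Real.exp_add]
    simp [hermiteLine, Polynomial.aeval_def, Polynomial.eval_map]
    left
    ring
  rw [e, abs_mul, abs_mul, Real.abs_exp]
  exact mul_le_mul_of_nonneg_right h (Real.exp_pos _).le

lemma continuous_hermiteLine (k : ℕ) : Continuous (hermiteLine k) := by
  unfold hermiteLine
  have : Continuous fun y : ℝ => Polynomial.aeval (Real.sqrt 2 * y) (Polynomial.hermite k) :=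
    (Polynomial.continuous_aeval _).comp (by fun_prop)
  fun_prop

lemma continuous_hermiteFun {d : ℕ} (α : Fin d → ℕ) : Continuous (hermiteFun α) := by
  unfold hermiteFun
  exact continuous_finsetProd _ fun j _ => (continuous_hermiteLine _).comp (by fun_prop)

lemma memLp_hermiteFun {d : ℕ} (α : Fin d → ℕ) :
    MemLp (fun x => (hermiteFun α x : ℂ)) 2 (volume : Measure (Space d)) := by
  have hc : Continuous fun x => (hermiteFun α x : ℂ) :=
    Complex.continuous_ofReal.comp (continuous_hermiteFun α)
  rw [memLp_two_iff_integrable_sq_norm hc.aestronglyMeasurable]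
  choose C hC using fun j => hermiteLine_bound (α j)
  have hg : Integrable (fun x : Space d => (∏ j, C j) ^ 2 * Real.exp (-(1 / 2) * ‖x‖ ^ 2)) := by
    have := (GaussianFourier.integrable_cexp_neg_mul_sq_norm_add (V := Space d)
      (b := ((1 / 2 : ℝ) : ℂ)) (by rw [Complex.ofReal_re]; norm_num) 0 0).norm
    refine (this.congr (Filter.Eventually.of_forall fun x => ?_)).const_mul _
    simp only [Complex.norm_exp]
    congr 1
    norm_cast
    simp
  refine hg.mono' (hc.norm.pow 2).aestronglyMeasurable (Filter.Eventually.of_forall fun x => ?_)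
  have h1 : |hermiteFun α x| ≤ (∏ j, C j) * Real.exp (-(‖x‖ ^ 2 / 4)) := by
    unfold hermiteFun
    rw [Finset.abs_prod]
    refine (Finset.prod_le_prod (fun _ _ => abs_nonneg _) fun j _ => hC j (x j)).trans_eq ?_
    rw [Finset.prod_mul_distrib, ← Real.exp_sum, EuclideanSpace.real_norm_sq_eq,
      Finset.sum_neg_distrib, Finset.sum_div]
  have h2 : Real.exp (-(1 / 2) * ‖x‖ ^ 2) = Real.exp (-(‖x‖ ^ 2 / 4)) ^ 2 := by
    rw [← Real.exp_nat_mul]; congr 1; push_cast; ring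
  rw [h2, ← mul_pow]
  simpa using pow_le_pow_left₀ (abs_nonneg _) h1 2

/-- The Hermite function `h_α` as an element of `L²(ℝ^d)`. -/
noncomputable def hermiteL2 {d : ℕ} (α : Fin d → ℕ) : L2 d := (memLp_hermiteFun α).toLp _

/-- The unitary group `e^{itH}` on `L²(ℝ^d)`: `e^{itH} u = ∑_α e^{itλ_α} c_α(u) h_α`, the sum being
convergent in `L²(ℝ^d)`. -/
noncomputable def schrodingerGroup {d : ℕ} (t : ℝ) (u : L2 d) : L2 d :=
  ∑' α : Fin d → ℕ,
    (Complex.exp (Complex.I * t * eigenvalue α) * hermiteCoeff u α) • hermiteL2 α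

/-- The operator `√H ^ s` (`s` any real number) on `L²(ℝ^d)`, with values in the tempered
distributions: `⟨√H ^ s u, φ⟩ = ∑_α λ_α^{s/2} c_α(u) c_α(φ)`; the series converges absolutely, since
the Hermite coefficients of the Schwartz function `φ` decay rapidly. -/
noncomputable def sqrtHPow {d : ℕ} (s : ℝ) (u : L2 d) (φ : 𝓢(Space d, ℂ)) : ℂ :=
  ∑' α : Fin d → ℕ, ((eigenvalue α ^ (s / 2) : ℝ) : ℂ) * hermiteCoeff u α * hermiteCoeff φ α

/-- The operator `√(-Δ) ^ s` on `L²(ℝ^d)`, with values in the tempered distributions, for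
`s > -d/2`: it is the Fourier multiplier with symbol `|2πξ|^s`, for the Fourier transform
`∫ e^{-2πi x·ξ} f(x) dx`. Thus `⟨√(-Δ) ^ s u, φ⟩ = ∫ |2πξ|^s (𝓕 u)(ξ) (𝓕⁻¹ φ)(ξ) dξ`, and the
integral converges absolutely because `𝓕 u` and `|2πξ|^s 𝓕⁻¹ φ` are in `L²`. -/
noncomputable def sqrtNegLaplacianPow {d : ℕ} (s : ℝ) (u : L2 d) (φ : 𝓢(Space d, ℂ)) : ℂ :=
  ∫ ξ, (((2 * Real.pi * ‖ξ‖) ^ s : ℝ) : ℂ) * (𝓕 u : L2 d) ξ * (𝓕⁻ φ : 𝓢(Space d, ℂ)) ξ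

/-- The function `g` represents the distribution `T`: `⟨T, φ⟩ = ∫ g φ` for all Schwartz `φ`. -/
def Represents {d : ℕ} (g : Space d → ℂ) (T : 𝓢(Space d, ℂ) → ℂ) : Prop :=
  ∀ φ : 𝓢(Space d, ℂ), Integrable (fun x => g x * φ x) ∧ T φ = ∫ x, g x * φ x

/-- Lebesgue measure on `[-π, π] × ℝ^d`. -/
noncomputable def spacetime (d : ℕ) : Measure (ℝ × Space d) :=
  (volume.restrict (Set.Icc (-Real.pi) Real.pi)).prod volume

/-- The Japanese bracket `⟨x⟩ = √(1 + |x|²)`. -/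
noncomputable def bracket {d : ℕ} (x : Space d) : ℝ := Real.sqrt (1 + ‖x‖ ^ 2)

/-- The norm `‖⟨x⟩^{-a} T‖_{L²([-π,π] × ℝ^d)}` of a family `T = (T t)` of tempered distributions on
`ℝ^d`. If there is a measurable function `G` on `[-π,π] × ℝ^d` such that `G(t, ·)` represents `T t`
for almost every `t`, then `G` is unique up to null sets and the norm is that of `⟨x⟩^{-a} G`
(possibly `∞`); if there is no such function the norm is `∞`. -/
noncomputable def weightedNorm {d : ℕ} (a : ℝ) (T : ℝ → 𝓢(Space d, ℂ) → ℂ) : ℝ≥0∞ :=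
  ⨅ (G : ℝ × Space d → ℂ) (_ : AEStronglyMeasurable G (spacetime d))
    (_ : ∀ᵐ t ∂(volume.restrict (Set.Icc (-Real.pi) Real.pi)),
      Represents (fun x => G (t, x)) (T t)),
    eLpNorm (fun p => ((bracket p.2 ^ (-a) : ℝ) : ℂ) * G p) 2 (spacetime d)

/-- Membership of `u ∈ L²(ℝ^d)` in the harmonic Sobolev space `𝓗^σ(ℝ^d)`, `σ ≥ 0`:
`∑_α λ_α^σ |c_α(u)|² < ∞`, where `λ_α` is the eigenvalue of `H`. -/
def MemHarmonicSobolev {d : ℕ} (σ : ℝ) (u : L2 d) : Prop :=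
  Summable fun α : Fin d → ℕ => eigenvalue α ^ σ * ‖hermiteCoeff u α‖ ^ 2

/-- The norm `‖u‖_{𝓗^σ} = ‖H^{σ/2} u‖_{L²} = (∑_α λ_α^σ |c_α(u)|²)^{1/2}`. -/
noncomputable def harmonicSobolevNorm {d : ℕ} (σ : ℝ) (u : L2 d) : ℝ :=
  Real.sqrt (∑' α : Fin d → ℕ, eigenvalue α ^ σ * ‖hermiteCoeff u α‖ ^ 2)

end HarmonicSmoothing

/-!
The flow `e^{itH}` multiplies the component of `u` in the eigenspace `|α| = n` by `e^{it(2n+d)}`.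
These phases are orthogonal on `[-π, π]`, so the space-time norm of any family
`∑_α e^{itλ_α} c_α F_α` is the `ℓ²`-sum over `n` of the norms of its level pieces
`∑_{|α| = n} c_α F_α` (`weightedNorm_le_of_level_estimate`). Both estimates thus reduce to bounds on
a single eigenspace, for `f = ∑_{|α| = n} c_α h_α`, `λ = 2n + d` and `β = 1/2 - ε`.

For `√H` the bound is `‖⟨x⟩^{-β} f‖² ≲ λ^{-β} ‖f‖²` (`lintegral_bracket_mul_levelSum_le`). On the line
it holds because `|h_k| ≲ λ^{-1/4}` in the classically allowed region, which follows from the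
monotonicity of the energy `h'² + (λ - y²) h²` (`hermiteLine_sq_le`). On `ℝ^d` the multi-indices are
sorted according to their largest entry `α j`; since multiplication by a function of `x_j` is
diagonal in the basis `(h_α)` of the eigenspace, the bound follows from the one on the line with
`k = α j` (`lintegral_norm_rpow_mul_level_sum_le`).

For `√(-Δ)^s`, `s = d/2 - 2ε`, the bound is `‖⟨x⟩^{-β} √(-Δ)^s f‖² ≲ λ^{(d-1)/2} ‖f‖²`
(`lintegral_bracket_mul_fracHermite_le`). The weight `⟨x⟩^{-β}` is the Fourier transform of a
probability measure `ν` all of whose moments are finite (`exists_measure_fourier_eq_bracket`, by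
subordination to Gaussians), so that multiplication by it is convolution with `ν` on the Fourier
side. The commutator of this convolution with `|2πξ|^s` gains a derivative, and costs only
`λ^{max(s-1, 0)} ≤ λ^{(d-1)/2}`. In the main term `|2πξ|^s (ν ∗ 𝓕 f)` the frequencies with
`|2πξ|² ≤ λ^{1+ε/s}` contribute `λ^{s+ε} ‖⟨x⟩^{-β} f‖² ≲ λ^{s+ε-β} ‖f‖² = λ^{(d-1)/2} ‖f‖²`, and the
others are negligible by the moment bounds `‖|D|^K f‖² ≲ λ^K ‖f‖²`, which hold since Hermite
functions are eigenfunctions of the Fourier transform. If `s ≤ 0` the weight can be dropped.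
-/

namespace HarmonicSmoothing

/-! ### Hermite functions on the line -/

/-- The raising relation `(y - d/dy) h_k = √(2(k+1)) h_{k+1}`. -/
lemma hermiteLineDeriv_eq_raise (k : ℕ) (y : ℝ) :
    hermiteLineDeriv k y = y * hermiteLine k y - √(2 * (k + 1)) * hermiteLine (k + 1) y := by
  have hk : (0 : ℝ) < k + 1 := by positivity
  have hs : √((k : ℝ) + 1) ≠ 0 := (Real.sqrt_pos.2 hk).ne'
  have h2 : √2 * √2 = (2 : ℝ) := Real.mul_self_sqrt (by norm_num)
  have hN : √(((k + 1).factorial : ℝ) * √Real.pi) = √((k : ℝ) + 1) * √(k.factorial * √Real.pi) := by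
    rw [Nat.factorial_succ, ← Real.sqrt_mul hk.le]; push_cast; ring_nf
  unfold hermiteLineDeriv hermiteLine
  rw [hN, Polynomial.hermite_succ, Real.sqrt_mul (by norm_num : (0 : ℝ) ≤ 2), mul_inv]
  simp only [map_sub, map_mul, Polynomial.aeval_X]
  field_simp
  linear_combination (y * Polynomial.aeval (√2 * y) (Polynomial.hermite k)) * h2

/-- The lowering relation `(y + d/dy) h_{k+1} = √(2(k+1)) h_k`. -/
lemma hermiteLineDeriv_succ (k : ℕ) (y : ℝ) :
    hermiteLineDeriv (k + 1) y = √(2 * (k + 1)) * hermiteLine k y - y * hermiteLine (k + 1) y := by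
  have hk : (0 : ℝ) < k + 1 := by positivity
  have hs : √((k : ℝ) + 1) ≠ 0 := (Real.sqrt_pos.2 hk).ne'
  have h2 : √((k : ℝ) + 1) * √((k : ℝ) + 1) = k + 1 := Real.mul_self_sqrt hk.le
  have hN : √(((k + 1).factorial : ℝ) * √Real.pi) = √((k : ℝ) + 1) * √(k.factorial * √Real.pi) := by
    rw [Nat.factorial_succ, ← Real.sqrt_mul hk.le]; push_cast; ring_nf
  have hd : (Polynomial.hermite (k + 1)).derivative =
      ((k : Polynomial ℤ) + 1) * Polynomial.hermite k := by
    rw [Polynomial.hermite_succ, Polynomial.derivative_sub, Polynomial.derivative_mul, hermite_ode,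
      Polynomial.derivative_X]
    ring
  unfold hermiteLineDeriv hermiteLine
  rw [hN, hd, Real.sqrt_mul (by norm_num : (0 : ℝ) ≤ 2), mul_inv]
  simp only [map_mul, map_add, map_natCast, map_one]
  field_simp
  linear_combination (-√2 * Polynomial.aeval (√2 * y) (Polynomial.hermite k)) * h2

lemma hermiteLineDeriv_zero (y : ℝ) : hermiteLineDeriv 0 y = -(y * hermiteLine 0 y) := by
  simp [hermiteLineDeriv, hermiteLine]
  ring

lemma mul_hermiteLine_zero (y : ℝ) : y * hermiteLine 0 y = √(1 / 2) * hermiteLine 1 y := by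
  have h := hermiteLineDeriv_eq_raise 0 y
  rw [hermiteLineDeriv_zero] at h
  have e : √(2 * ((0 : ℕ) + 1 : ℝ)) = 2 * √(1 / 2) := by
    rw [show (2 * ((0 : ℕ) + 1 : ℝ)) = 2 ^ 2 * (1 / 2) by norm_num,
      Real.sqrt_mul (by norm_num), Real.sqrt_sq (by norm_num)]
  rw [e] at h
  simp only [zero_add] at h
  linarith

lemma mul_hermiteLine_succ (k : ℕ) (y : ℝ) :
    y * hermiteLine (k + 1) y =
      √((k + 1) / 2) * hermiteLine k y + √((k + 2) / 2) * hermiteLine (k + 2) y := by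
  have h1 := hermiteLineDeriv_eq_raise (k + 1) y
  rw [hermiteLineDeriv_succ] at h1
  have e : ∀ a : ℝ, √(2 * a) = 2 * √(a / 2) := fun a => by
    rw [show 2 * a = 2 ^ 2 * (a / 2) by ring,
      Real.sqrt_mul (by norm_num), Real.sqrt_sq (by norm_num)]
  rw [e, e] at h1
  push_cast at h1
  rw [show (k : ℝ) + 1 + 1 = k + 2 by ring] at h1
  linarith

lemma integrable_pow_mul_gauss (n : ℕ) {b : ℝ} (hb : 0 < b) :
    Integrable fun y : ℝ => |y| ^ n * Real.exp (-b * y ^ 2) := by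
  have h := (integrable_rpow_mul_exp_neg_mul_sq hb (s := (n : ℝ))
    (by have := n.cast_nonneg (α := ℝ); linarith)).norm
  refine h.congr (Filter.Eventually.of_forall fun y => ?_)
  simp only [Real.rpow_natCast, norm_mul, norm_pow, Real.norm_eq_abs, Real.abs_exp]

lemma integrable_of_gauss_bound {f : ℝ → ℝ} (hf : Continuous f) (n : ℕ) {b C : ℝ} (hb : 0 < b)
    (h : ∀ y, |f y| ≤ C * (|y| ^ n * Real.exp (-b * y ^ 2))) : Integrable f :=
  ((integrable_pow_mul_gauss n hb).const_mul C).mono' hf.aestronglyMeasurable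
    (Filter.Eventually.of_forall h)

lemma integrable_pow_mul_hermiteLine (n k : ℕ) :
    Integrable fun y : ℝ => y ^ n * hermiteLine k y := by
  obtain ⟨C, hC⟩ := hermiteLine_bound k
  refine integrable_of_gauss_bound ((continuous_pow n).mul (continuous_hermiteLine k)) n
    (b := 1 / 4) (C := C) (by norm_num) fun y => ?_
  rw [abs_mul, abs_pow, show -(1 / 4) * y ^ 2 = -(y ^ 2 / 4) by ring]
  have := mul_le_mul_of_nonneg_left (hC y) (by positivity : 0 ≤ |y| ^ n)
  linarith

lemma integrable_hermiteLine (k : ℕ) : Integrable (hermiteLine k) := by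
  simpa using integrable_pow_mul_hermiteLine 0 k

lemma integrable_pow_mul_hermiteLine_mul (n k l : ℕ) :
    Integrable fun y : ℝ => y ^ n * (hermiteLine k y * hermiteLine l y) := by
  obtain ⟨C, hC⟩ := hermiteLine_bound k
  obtain ⟨D, hD⟩ := hermiteLine_bound l
  refine integrable_of_gauss_bound
    ((continuous_pow n).mul ((continuous_hermiteLine k).mul (continuous_hermiteLine l))) n
    (b := 1 / 2) (C := C * D) (by norm_num) fun y => ?_
  have e : Real.exp (-(1 / 2) * y ^ 2) = Real.exp (-(y ^ 2 / 4)) * Real.exp (-(y ^ 2 / 4)) := by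
    rw [← Real.exp_add]; ring_nf
  rw [abs_mul, abs_mul, abs_pow, e]
  have := mul_le_mul_of_nonneg_left (mul_le_mul (hC y) (hD y) (abs_nonneg _)
    ((abs_nonneg _).trans (hC y))) (by positivity : 0 ≤ |y| ^ n)
  linarith

lemma integrable_hermiteLine_mul (k l : ℕ) :
    Integrable fun y : ℝ => hermiteLine k y * hermiteLine l y := by
  simpa using integrable_pow_mul_hermiteLine_mul 0 k l

lemma integrable_hermiteLineDeriv (k : ℕ) : Integrable (hermiteLineDeriv k) := by
  have e : hermiteLineDeriv k = fun y => y ^ 1 * hermiteLine k y -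
      √(2 * (k + 1)) * hermiteLine (k + 1) y := by
    ext y; rw [hermiteLineDeriv_eq_raise, pow_one]
  rw [e]
  exact (integrable_pow_mul_hermiteLine 1 k).sub ((integrable_hermiteLine _).const_mul _)

lemma integrable_hermiteLineDeriv_mul (k l : ℕ) :
    Integrable fun y : ℝ => hermiteLineDeriv k y * hermiteLine l y := by
  have e : (fun y : ℝ => hermiteLineDeriv k y * hermiteLine l y) =
      fun y => y ^ 1 * (hermiteLine k y * hermiteLine l y) -
      √(2 * (k + 1)) * (hermiteLine (k + 1) y * hermiteLine l y) := by
    ext y; rw [hermiteLineDeriv_eq_raise]; ring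
  rw [e]
  exact (integrable_pow_mul_hermiteLine_mul 1 k l).sub ((integrable_hermiteLine_mul _ _).const_mul _)

/-- Integration by parts for Hermite functions. -/
lemma integral_hermiteLine_mul_deriv (k l : ℕ) :
    ∫ y, hermiteLine k y * hermiteLineDeriv l y = -∫ y, hermiteLineDeriv k y * hermiteLine l y := by
  refine integral_mul_deriv_eq_deriv_mul_of_integrable (fun y _ => hasDerivAt_hermiteLine k y)
    (fun y _ => hasDerivAt_hermiteLine l y) ?_ (integrable_hermiteLineDeriv_mul k l)
    (integrable_hermiteLine_mul k l)
  simpa [Pi.mul_def, mul_comm] using integrable_hermiteLineDeriv_mul l k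

/-- The raising operator is adjoint to the lowering operator. -/
lemma sqrt_mul_integral_hermiteLine_succ (k l : ℕ) :
    √(2 * (k + 1)) * ∫ y, hermiteLine (k + 1) y * hermiteLine (l + 1) y =
      √(2 * (l + 1)) * ∫ y, hermiteLine k y * hermiteLine l y := by
  have h1 : ∀ y, √(2 * (k + 1)) * (hermiteLine (k + 1) y * hermiteLine (l + 1) y) =
      y ^ 1 * (hermiteLine k y * hermiteLine (l + 1) y) -
        hermiteLineDeriv k y * hermiteLine (l + 1) y := fun y => by
    rw [hermiteLineDeriv_eq_raise]; ring
  have h2 : ∀ y, √(2 * (l + 1)) * (hermiteLine k y * hermiteLine l y) =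
      y ^ 1 * (hermiteLine k y * hermiteLine (l + 1) y) +
        hermiteLine k y * hermiteLineDeriv (l + 1) y := fun y => by
    rw [hermiteLineDeriv_succ]; ring
  have hi : Integrable fun y => hermiteLine k y * hermiteLineDeriv (l + 1) y := by
    simpa [mul_comm] using integrable_hermiteLineDeriv_mul (l + 1) k
  rw [← integral_const_mul, ← integral_const_mul]
  simp_rw [h1, h2]
  rw [integral_sub (integrable_pow_mul_hermiteLine_mul 1 k (l + 1))
    (integrable_hermiteLineDeriv_mul k (l + 1)),
    integral_add (integrable_pow_mul_hermiteLine_mul 1 k (l + 1)) hi,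
    integral_hermiteLine_mul_deriv]
  ring

lemma integral_hermiteLine_zero_sq : ∫ y, hermiteLine 0 y * hermiteLine 0 y = 1 := by
  have h : ∀ y, hermiteLine 0 y * hermiteLine 0 y = (√Real.pi)⁻¹ * Real.exp (-1 * y ^ 2) := by
    intro y
    have hp : √(√Real.pi) * √(√Real.pi) = √Real.pi := Real.mul_self_sqrt (Real.sqrt_nonneg _)
    have e : Real.exp (-1 * y ^ 2) = Real.exp (-(y ^ 2 / 2)) * Real.exp (-(y ^ 2 / 2)) := by
      rw [← Real.exp_add]; ring_nf
    rw [e, ← hp]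
    simp only [hermiteLine, Nat.factorial_zero, Nat.cast_one, one_mul, Polynomial.hermite_zero,
      map_one, mul_one, mul_inv]
    ring
  simp_rw [h]
  rw [integral_const_mul, integral_gaussian, div_one,
    inv_mul_cancel₀ (Real.sqrt_pos.2 Real.pi_pos).ne']

lemma integral_hermiteLine_zero_succ (k : ℕ) :
    ∫ y, hermiteLine 0 y * hermiteLine (k + 1) y = 0 := by
  have h0 : (0 : ℝ) < √(2 * (k + 1)) := Real.sqrt_pos.2 (by positivity)
  have h1 : ∀ y, √(2 * (k + 1)) * (hermiteLine 0 y * hermiteLine (k + 1) y) =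
      -(hermiteLine 0 y * hermiteLineDeriv k y) - hermiteLineDeriv 0 y * hermiteLine k y :=
    fun y => by rw [hermiteLineDeriv_eq_raise, hermiteLineDeriv_zero]; ring
  have hi : Integrable fun y => hermiteLine 0 y * hermiteLineDeriv k y := by
    simpa [mul_comm] using integrable_hermiteLineDeriv_mul k 0
  have h2 : √(2 * (k + 1)) * ∫ y, hermiteLine 0 y * hermiteLine (k + 1) y = 0 := by
    rw [← integral_const_mul]
    simp_rw [h1]
    rw [integral_sub (f := fun y => -(hermiteLine 0 y * hermiteLineDeriv k y)) hi.neg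
      (integrable_hermiteLineDeriv_mul 0 k), integral_neg, integral_hermiteLine_mul_deriv]
    ring
  exact (mul_eq_zero.1 h2).resolve_left h0.ne'

/-- The Hermite functions are orthonormal; the raising and lowering relations reduce `(k+1, l+1)` to
`(k, l)`. -/
lemma integral_hermiteLine_mul (k l : ℕ) :
    ∫ y, hermiteLine k y * hermiteLine l y = if k = l then 1 else 0 := by
  induction k generalizing l with
  | zero =>
    cases l with
    | zero => simpa using integral_hermiteLine_zero_sq
    | succ l => simpa using integral_hermiteLine_zero_succ l
  | succ k ih =>
    cases l with
    | zero => simpa [mul_comm] using integral_hermiteLine_zero_succ k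
    | succ l =>
      have h0 : (0 : ℝ) < √(2 * (k + 1)) := Real.sqrt_pos.2 (by positivity)
      have h := sqrt_mul_integral_hermiteLine_succ k l
      rw [ih l] at h
      by_cases e : k = l
      · subst e
        rw [if_pos rfl]
        rw [if_pos rfl, mul_one] at h
        exact mul_left_cancel₀ h0.ne' (h.trans (mul_one _).symm)
      · simp only [e, if_false, mul_zero, mul_eq_zero, h0.ne', false_or] at h
        simpa [e] using h

lemma integral_hermiteLine_sq (k : ℕ) : ∫ y, hermiteLine k y ^ 2 = 1 := by
  simpa [sq] using integral_hermiteLine_mul k k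

lemma integrable_hermiteLine_sq (k : ℕ) : Integrable fun y => hermiteLine k y ^ 2 := by
  simpa [sq] using integrable_hermiteLine_mul k k

lemma integrable_pow_mul_hermiteLine_sq (n k : ℕ) :
    Integrable fun y => y ^ n * hermiteLine k y ^ 2 := by
  simpa [sq] using integrable_pow_mul_hermiteLine_mul n k k

/-! ### Pointwise and weighted bounds for Hermite functions on the line -/

/-- The energy `h'² + (λ - y²) h²`, `λ = 2k + 1`, of the Hermite function `h = h_k`. -/
noncomputable def hermiteEnergy (k : ℕ) (y : ℝ) : ℝ :=
  hermiteLineDeriv k y ^ 2 + (2 * k + 1 - y ^ 2) * hermiteLine k y ^ 2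

lemma hasDerivAt_hermiteEnergy (k : ℕ) (y : ℝ) :
    HasDerivAt (hermiteEnergy k) (-(2 * y * hermiteLine k y ^ 2)) y := by
  have h1 := (hasDerivAt_hermiteLineDeriv k y).pow 2
  have h2 := (((hasDerivAt_pow 2 y).const_sub (2 * (k : ℝ) + 1))).mul
    ((hasDerivAt_hermiteLine k y).pow 2)
  refine HasDerivAt.congr_deriv (f := hermiteEnergy k) (h1.add h2) ?_
  simp
  ring

/-- The energy has derivative `-2 y h²`, so it is largest at the origin. -/
lemma hermiteEnergy_le_zero (k : ℕ) (y : ℝ) : hermiteEnergy k y ≤ hermiteEnergy k 0 := by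
  have hd : Differentiable ℝ (hermiteEnergy k) := fun y =>
    (hasDerivAt_hermiteEnergy k y).differentiableAt
  rcases le_total 0 y with hy | hy
  · refine antitoneOn_of_deriv_nonpos (convex_Ici 0) hd.continuous.continuousOn
      hd.differentiableOn (fun x hx => ?_) Set.self_mem_Ici hy hy
    rw [interior_Ici, Set.mem_Ioi] at hx
    rw [(hasDerivAt_hermiteEnergy k x).deriv]
    have := mul_nonneg hx.le (sq_nonneg (hermiteLine k x))
    linarith
  · refine monotoneOn_of_deriv_nonneg (convex_Iic 0) hd.continuous.continuousOn
      hd.differentiableOn (fun x hx => ?_) hy Set.self_mem_Iic hy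
    rw [interior_Iic, Set.mem_Iio] at hx
    rw [(hasDerivAt_hermiteEnergy k x).deriv]
    have := mul_nonneg (neg_nonneg.2 hx.le) (sq_nonneg (hermiteLine k x))
    linarith

lemma hermiteEnergy_zero_le_add {k : ℕ} {y L : ℝ} (hy : 0 ≤ y) (hL : y ≤ L) :
    hermiteEnergy k 0 ≤ hermiteEnergy k y + 2 * L := by
  have hc : Continuous fun z => -(2 * z * hermiteLine k z ^ 2) := by
    have := continuous_hermiteLine k
    fun_prop
  have h := intervalIntegral.integral_eq_sub_of_hasDerivAt (a := 0) (b := y)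
    (fun z _ => hasDerivAt_hermiteEnergy k z) (hc.intervalIntegrable _ _)
  rw [intervalIntegral.integral_of_le hy, integral_neg] at h
  have h2 : ∫ z in Set.Ioc 0 y, 2 * z * hermiteLine k z ^ 2 ≤
      ∫ z in Set.Ioc 0 y, 2 * L * hermiteLine k z ^ 2 := by
    refine setIntegral_mono_on ?_ ((integrable_hermiteLine_sq k).const_mul _).integrableOn
      measurableSet_Ioc fun z hz => ?_
    · refine Integrable.integrableOn (((integrable_pow_mul_hermiteLine_sq 1 k).const_mul 2).congr ?_)
      exact Filter.Eventually.of_forall fun z => by simp only [pow_one]; ring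
    · exact mul_le_mul_of_nonneg_right (by linarith [hz.2]) (sq_nonneg _)
  have h3 : ∫ z in Set.Ioc 0 y, 2 * L * hermiteLine k z ^ 2 ≤ ∫ z, 2 * L * hermiteLine k z ^ 2 :=
    setIntegral_le_integral ((integrable_hermiteLine_sq k).const_mul _)
      (Filter.Eventually.of_forall fun z => mul_nonneg (by linarith) (sq_nonneg _))
  have h4 : ∫ z, 2 * L * hermiteLine k z ^ 2 = 2 * L := by
    rw [integral_const_mul, integral_hermiteLine_sq, mul_one]
  linarith

lemma integrable_hermiteLineDeriv_sq (k : ℕ) : Integrable fun y => hermiteLineDeriv k y ^ 2 := by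
  have e : (fun y : ℝ => hermiteLineDeriv k y ^ 2) =
      fun y => y ^ 2 * (hermiteLine k y * hermiteLine k y) -
      2 * √(2 * (k + 1)) * (y ^ 1 * (hermiteLine k y * hermiteLine (k + 1) y)) +
      (2 * (k + 1)) * (hermiteLine (k + 1) y * hermiteLine (k + 1) y) := by
    ext y
    have h2 : √(2 * ((k : ℝ) + 1)) * √(2 * (k + 1)) = 2 * (k + 1) :=
      Real.mul_self_sqrt (by positivity)
    rw [hermiteLineDeriv_eq_raise]
    linear_combination hermiteLine (k + 1) y ^ 2 * h2
  rw [e]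
  exact ((integrable_pow_mul_hermiteLine_mul 2 k k).sub
    ((integrable_pow_mul_hermiteLine_mul 1 k (k + 1)).const_mul _)).add
    ((integrable_hermiteLine_mul _ _).const_mul _)

/-- Pairing the equation `-h'' + y² h = λ h` with `h` bounds `‖h'‖²` by `λ`. -/
lemma integral_hermiteLineDeriv_sq_le (k : ℕ) : ∫ y, hermiteLineDeriv k y ^ 2 ≤ 2 * k + 1 := by
  have hi : Integrable fun y => (2 * (k : ℝ) + 1) * hermiteLine k y ^ 2 :=
    (integrable_hermiteLine_sq k).const_mul _
  have hi2 : Integrable fun y => hermiteLine k y * ((y ^ 2 - (2 * k + 1)) * hermiteLine k y) := by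
    refine ((integrable_pow_mul_hermiteLine_sq 2 k).sub hi).congr
      (Filter.Eventually.of_forall fun y => ?_)
    simp only [Pi.sub_apply]
    ring
  have h : ∫ y, hermiteLine k y * ((y ^ 2 - (2 * k + 1)) * hermiteLine k y) =
      -∫ y, hermiteLineDeriv k y * hermiteLineDeriv k y := by
    refine integral_mul_deriv_eq_deriv_mul_of_integrable (fun y _ => hasDerivAt_hermiteLine k y)
      (fun y _ => hasDerivAt_hermiteLineDeriv k y) hi2 ?_ ?_
    · simpa [Pi.mul_def, sq] using integrable_hermiteLineDeriv_sq k
    · simpa [Pi.mul_def, mul_comm] using integrable_hermiteLineDeriv_mul k k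
  simp_rw [← sq] at h
  have h3 : -∫ y, hermiteLine k y * ((y ^ 2 - (2 * k + 1)) * hermiteLine k y) ≤
      ∫ y, (2 * (k : ℝ) + 1) * hermiteLine k y ^ 2 := by
    rw [← integral_neg]
    refine integral_mono hi2.neg hi fun y => ?_
    have := mul_nonneg (sq_nonneg y) (sq_nonneg (hermiteLine k y))
    simp only
    nlinarith
  rw [integral_const_mul, integral_hermiteLine_sq] at h3
  linarith

/-- The energy at the origin is at most `4 √λ`: it exceeds the energy on `[0, √λ]` by at most
`2 √λ`, and the average of the energy over this interval is at most `2 √λ`. -/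
lemma hermiteEnergy_zero_le (k : ℕ) : hermiteEnergy k 0 ≤ 4 * √(2 * k + 1) := by
  have hlam : (0 : ℝ) < 2 * k + 1 := by positivity
  set L := √(2 * (k : ℝ) + 1) with hL
  have hL0 : 0 < L := Real.sqrt_pos.2 hlam
  have hL2 : L * L = 2 * k + 1 := Real.mul_self_sqrt hlam.le
  have hi : Integrable fun y => hermiteLineDeriv k y ^ 2 + (2 * k + 1) * hermiteLine k y ^ 2 :=
    (integrable_hermiteLineDeriv_sq k).add ((integrable_hermiteLine_sq k).const_mul _)
  have h1 : ∫ _ in Set.Ioc 0 L, (hermiteEnergy k 0 - 2 * L) ≤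
      ∫ y in Set.Ioc 0 L, (hermiteLineDeriv k y ^ 2 + (2 * k + 1) * hermiteLine k y ^ 2) := by
    refine setIntegral_mono_on (by simp) hi.integrableOn measurableSet_Ioc fun y hy => ?_
    have h := hermiteEnergy_zero_le_add (k := k) hy.1.le hy.2
    have h' : hermiteEnergy k y ≤
        hermiteLineDeriv k y ^ 2 + (2 * k + 1) * hermiteLine k y ^ 2 := by
      have := mul_nonneg (sq_nonneg y) (sq_nonneg (hermiteLine k y))
      unfold hermiteEnergy
      linarith
    linarith
  have h2 : ∫ y in Set.Ioc 0 L, (hermiteLineDeriv k y ^ 2 + (2 * k + 1) * hermiteLine k y ^ 2) ≤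
      ∫ y, (hermiteLineDeriv k y ^ 2 + (2 * k + 1) * hermiteLine k y ^ 2) :=
    setIntegral_le_integral hi (Filter.Eventually.of_forall fun y => by positivity)
  rw [integral_add (integrable_hermiteLineDeriv_sq k)
    ((integrable_hermiteLine_sq k).const_mul _), integral_const_mul,
    integral_hermiteLine_sq] at h2
  have h3 := integral_hermiteLineDeriv_sq_le k
  have h4 : ∫ _ in Set.Ioc 0 L, (hermiteEnergy k 0 - 2 * L) = L * (hermiteEnergy k 0 - 2 * L) := by
    simp [hL0.le]
  have h5 : L * hermiteEnergy k 0 ≤ L * (4 * L) := by nlinarith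
  exact le_of_mul_le_mul_left h5 hL0

/-- In the classically allowed region `y² ≤ λ / 2` one has `h_k(y)² ≤ 8 / √λ`. -/
lemma hermiteLine_sq_le {k : ℕ} {y : ℝ} (hy : y ^ 2 ≤ (2 * k + 1) / 2) :
    hermiteLine k y ^ 2 ≤ 8 / √(2 * k + 1) := by
  have hlam : (0 : ℝ) < 2 * k + 1 := by positivity
  have hL0 : 0 < √(2 * (k : ℝ) + 1) := Real.sqrt_pos.2 hlam
  have hL2 : √(2 * (k : ℝ) + 1) * √(2 * (k : ℝ) + 1) = 2 * k + 1 := Real.mul_self_sqrt hlam.le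
  have h := (hermiteEnergy_le_zero k y).trans (hermiteEnergy_zero_le k)
  have h1 : (2 * (k : ℝ) + 1) / 2 * hermiteLine k y ^ 2 ≤ hermiteEnergy k y := by
    have := mul_le_mul_of_nonneg_right hy (sq_nonneg (hermiteLine k y))
    have := sq_nonneg (hermiteLineDeriv k y)
    unfold hermiteEnergy
    linarith
  rw [le_div_iff₀ hL0]
  have h2 : √(2 * (k : ℝ) + 1) * (hermiteLine k y ^ 2 * √(2 * (k : ℝ) + 1)) ≤
      √(2 * (k : ℝ) + 1) * 8 := by
    calc _ = (2 * (k : ℝ) + 1) * hermiteLine k y ^ 2 := by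
            linear_combination hermiteLine k y ^ 2 * hL2
      _ ≤ _ := by linarith
  exact le_of_mul_le_mul_left h2 hL0

lemma integrable_norm_rpow_mul_gauss {E : Type*} [NormedAddCommGroup E] [InnerProductSpace ℝ E]
    [FiniteDimensional ℝ E] [MeasurableSpace E] [BorelSpace E] [Nontrivial E] {p b : ℝ}
    (hp : -(Module.finrank ℝ E : ℝ) < p) (hb : 0 < b) :
    Integrable fun x : E => ‖x‖ ^ p * Real.exp (-b * ‖x‖ ^ 2) := by
  rw [integrable_fun_norm_addHaar volume (f := fun r : ℝ => r ^ p * Real.exp (-b * r ^ 2))]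
  have hd : 1 ≤ Module.finrank ℝ E := Module.finrank_pos
  have h := integrableOn_rpow_mul_exp_neg_mul_sq hb
    (s := ((Module.finrank ℝ E - 1 : ℕ) : ℝ) + p) (by push_cast [Nat.cast_sub hd]; linarith)
  refine h.congr_fun (fun r hr => ?_) measurableSet_Ioi
  simp only [smul_eq_mul]
  rw [Real.rpow_add hr, Real.rpow_natCast, mul_assoc]

lemma integrable_abs_rpow_mul_hermiteLine_mul {p : ℝ} (hp : -1 < p) (k l : ℕ) :
    Integrable fun y : ℝ => |y| ^ p * (hermiteLine k y * hermiteLine l y) := by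
  obtain ⟨C, hC⟩ := hermiteLine_bound k
  obtain ⟨D, hD⟩ := hermiteLine_bound l
  have h := (integrable_norm_rpow_mul_gauss (E := ℝ) (p := p) (b := 1 / 2) (by simpa using hp)
    (by norm_num)).const_mul (C * D)
  refine h.mono' ?_ (Filter.Eventually.of_forall fun y => ?_)
  · exact ((measurable_norm.pow_const p).mul ((continuous_hermiteLine k).mul
      (continuous_hermiteLine l)).measurable).aestronglyMeasurable
  · have e : Real.exp (-(1 / 2) * |y| ^ 2) = Real.exp (-(y ^ 2 / 4)) * Real.exp (-(y ^ 2 / 4)) := by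
      rw [← Real.exp_add, sq_abs]; ring_nf
    rw [Real.norm_eq_abs, Real.norm_eq_abs, abs_mul, abs_mul, e,
      abs_of_nonneg (Real.rpow_nonneg (abs_nonneg y) p)]
    have := mul_le_mul_of_nonneg_left (mul_le_mul (hC y) (hD y) (abs_nonneg _)
      ((abs_nonneg _).trans (hC y))) (Real.rpow_nonneg (abs_nonneg y) p)
    linarith

lemma integral_indicator_abs_rpow {p R : ℝ} (hp : -1 < p) (hR : 0 < R) :
    Integrable (fun y : ℝ => (Set.Iic R).indicator (fun r => r ^ p) |y|) ∧
    ∫ y : ℝ, (Set.Iic R).indicator (fun r => r ^ p) |y| = 2 * (R ^ (p + 1) / (p + 1)) := by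
  constructor
  · have h := (integrable_fun_norm_addHaar (E := ℝ) volume
      (f := (Set.Iic R).indicator (fun r : ℝ => r ^ p))).2
    refine h ?_
    simp only [Module.finrank_self, Nat.sub_self, pow_zero, one_smul]
    rw [integrableOn_indicator_iff measurableSet_Iic, Set.Iic_inter_Ioi,
      ← intervalIntegrable_iff_integrableOn_Ioc_of_le hR.le]
    exact intervalIntegral.intervalIntegrable_rpow' hp
  · rw [integral_comp_abs (f := (Set.Iic R).indicator (fun r => r ^ p)),
      setIntegral_indicator measurableSet_Iic, Set.Ioi_inter_Iic,
      ← intervalIntegral.integral_of_le hR.le, integral_rpow (Or.inl hp),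
      Real.zero_rpow (by linarith), sub_zero]

/-- The weighted bound `∫ |y|^p h_k² ≲ λ^{p/2}`, `-1 < p ≤ 0`: the Hermite function has size
`λ^{-1/4}` for `y² ≤ λ / 2`, and the weight is at most `(λ/2)^{p/2}` elsewhere. -/
lemma integral_abs_rpow_mul_hermiteLine_sq_le {p : ℝ} (hp : -1 < p) (hp0 : p ≤ 0) :
    ∃ C : ℝ, 0 < C ∧ ∀ k : ℕ,
      ∫ y, |y| ^ p * hermiteLine k y ^ 2 ≤ C * (2 * k + 1 : ℝ) ^ (p / 2) := by
  have hp1 : 0 < p + 1 := by linarith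
  refine ⟨(16 / (p + 1) + 1) * 2, by positivity, fun k => ?_⟩
  have hlam : (0 : ℝ) < 2 * k + 1 := by positivity
  set lam : ℝ := 2 * k + 1 with hlamdef
  set R := √(lam / 2) with hRdef
  have hR : 0 < R := Real.sqrt_pos.2 (by positivity)
  have hR2 : R ^ 2 = lam / 2 := Real.sq_sqrt (by positivity)
  obtain ⟨hi, he⟩ := integral_indicator_abs_rpow hp hR
  have hRp : R ^ p ≤ 2 * lam ^ (p / 2) := by
    rw [hRdef, Real.sqrt_eq_rpow, ← Real.rpow_mul (by positivity),
      show 1 / 2 * p = p / 2 by ring, Real.div_rpow hlam.le (by norm_num), div_eq_mul_inv,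
      ← Real.rpow_neg (by norm_num), mul_comm]
    refine mul_le_mul_of_nonneg_right ?_ (by positivity)
    calc (2 : ℝ) ^ (-(p / 2)) ≤ 2 ^ (1 : ℝ) :=
          Real.rpow_le_rpow_of_exponent_le (by norm_num) (by linarith)
      _ = 2 := by norm_num
  have hRl : R ≤ √lam := Real.sqrt_le_sqrt (by linarith)
  have hsl : 0 < √lam := Real.sqrt_pos.2 hlam
  have hint : Integrable fun y : ℝ => |y| ^ p * hermiteLine k y ^ 2 := by
    simpa [sq] using integrable_abs_rpow_mul_hermiteLine_mul hp k k
  have hbound : ∫ y, |y| ^ p * hermiteLine k y ^ 2 ≤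
      ∫ y : ℝ, ((8 / √lam) * (Set.Iic R).indicator (fun r => r ^ p) |y| +
        R ^ p * hermiteLine k y ^ 2) := by
    refine integral_mono hint ((hi.const_mul _).add ((integrable_hermiteLine_sq k).const_mul _))
      fun y => ?_
    have hyp : 0 ≤ |y| ^ p := Real.rpow_nonneg (abs_nonneg y) p
    by_cases hy : |y| ≤ R
    · rw [Set.indicator_of_mem (Set.mem_Iic.2 hy)]
      have h1 : y ^ 2 ≤ lam / 2 := by
        rw [← hR2, ← sq_abs]
        exact pow_le_pow_left₀ (abs_nonneg y) hy 2
      have h2 := mul_le_mul_of_nonneg_left (hermiteLine_sq_le h1) hyp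
      have h3 : 0 ≤ R ^ p * hermiteLine k y ^ 2 := by positivity
      linarith
    · rw [Set.indicator_of_notMem (by simpa using hy)]
      push Not at hy
      have := Real.rpow_le_rpow_of_nonpos hR hy.le hp0
      have := mul_le_mul_of_nonneg_right this (sq_nonneg (hermiteLine k y))
      linarith
  rw [integral_add (hi.const_mul _) ((integrable_hermiteLine_sq k).const_mul _),
    integral_const_mul, integral_const_mul, he, integral_hermiteLine_sq,
    Real.rpow_add hR, Real.rpow_one] at hbound
  have hRp0 : 0 < R ^ p := Real.rpow_pos_of_pos hR p
  have h4 : 8 / √lam * (2 * (R ^ p * R / (p + 1))) ≤ 16 / (p + 1) * R ^ p := by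
    have : 8 / √lam * (2 * (R ^ p * R / (p + 1))) = 16 / (p + 1) * R ^ p * (R / √lam) := by
      field_simp; ring
    rw [this]
    exact mul_le_of_le_one_right (by positivity) ((div_le_one hsl).2 hRl)
  have h5 : (0 : ℝ) ≤ 16 / (p + 1) + 1 := by positivity
  nlinarith [mul_le_mul_of_nonneg_left hRp h5]

/-- A pointwise consequence of the three-term recurrence, which reduces the moments of `h_k` of order
`2K + 2` to those of order `2K` of its neighbours. -/
lemma sq_mul_hermiteLine_sq_le (k : ℕ) (y : ℝ) :
    (y * hermiteLine k y) ^ 2 ≤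
      k * hermiteLine (k - 1) y ^ 2 + (k + 1) * hermiteLine (k + 1) y ^ 2 := by
  cases k with
  | zero =>
    rw [mul_hermiteLine_zero, mul_pow, Real.sq_sqrt (by norm_num)]
    have := sq_nonneg (hermiteLine 1 y)
    simp only [Nat.cast_zero, zero_mul, zero_add]
    linarith
  | succ k =>
    rw [mul_hermiteLine_succ]
    have h1 : √(((k : ℝ) + 1) / 2) ^ 2 = (k + 1) / 2 := Real.sq_sqrt (by positivity)
    have h2 : √(((k : ℝ) + 2) / 2) ^ 2 = (k + 2) / 2 := Real.sq_sqrt (by positivity)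
    refine (add_sq_le (a := √(((k : ℝ) + 1) / 2) * hermiteLine k y)).trans ?_
    rw [mul_pow, mul_pow, h1, h2]
    push_cast
    apply le_of_eq
    ring_nf

/-- The moments of a Hermite function: `∫ y^{2K} h_k² ≲ λ^K`. -/
lemma integral_pow_mul_hermiteLine_sq_le (K : ℕ) :
    ∃ C : ℝ, 0 < C ∧ ∀ k : ℕ,
      ∫ y, y ^ (2 * K) * hermiteLine k y ^ 2 ≤ C * (2 * k + 1 : ℝ) ^ K := by
  induction K with
  | zero => exact ⟨1, one_pos, fun k => by simp [integral_hermiteLine_sq]⟩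
  | succ K ih =>
    obtain ⟨C, hC0, hC⟩ := ih
    refine ⟨C * (1 + 3 ^ K), by positivity, fun k => ?_⟩
    have hi := fun l => integrable_pow_mul_hermiteLine_sq (2 * K) l
    have h1 : ∫ y, y ^ (2 * (K + 1)) * hermiteLine k y ^ 2 ≤
        ∫ y, (k * (y ^ (2 * K) * hermiteLine (k - 1) y ^ 2) +
          (k + 1) * (y ^ (2 * K) * hermiteLine (k + 1) y ^ 2)) := by
      refine integral_mono (integrable_pow_mul_hermiteLine_sq _ k)
        (((hi _).const_mul _).add ((hi _).const_mul _)) fun y => ?_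
      have h := mul_le_mul_of_nonneg_left (sq_mul_hermiteLine_sq_le k y)
        (by rw [pow_mul]; positivity : 0 ≤ y ^ (2 * K))
      calc y ^ (2 * (K + 1)) * hermiteLine k y ^ 2 = y ^ (2 * K) * (y * hermiteLine k y) ^ 2 := by
            ring
        _ ≤ _ := h
        _ = _ := by ring
    rw [integral_add ((hi _).const_mul _) ((hi _).const_mul _), integral_const_mul,
      integral_const_mul] at h1
    have hlam : (0 : ℝ) < 2 * k + 1 := by positivity
    have h2 : (k : ℝ) * ∫ y, y ^ (2 * K) * hermiteLine (k - 1) y ^ 2 ≤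
        (k : ℝ) * (C * (2 * k + 1) ^ K) := by
      cases k with
      | zero => simp
      | succ k =>
        refine mul_le_mul_of_nonneg_left ((hC k).trans ?_) (Nat.cast_nonneg _)
        refine mul_le_mul_of_nonneg_left (pow_le_pow_left₀ (by positivity) ?_ K) hC0.le
        push_cast; linarith
    have h3 : ((k : ℝ) + 1) * ∫ y, y ^ (2 * K) * hermiteLine (k + 1) y ^ 2 ≤
        (k + 1) * (C * (3 ^ K * (2 * k + 1) ^ K)) := by
      refine mul_le_mul_of_nonneg_left ((hC (k + 1)).trans ?_) (by positivity)
      rw [← mul_pow]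
      refine mul_le_mul_of_nonneg_left (pow_le_pow_left₀ (by positivity) ?_ K) hC0.le
      push_cast; linarith [k.cast_nonneg (α := ℝ)]
    have h4 : 0 ≤ C * (2 * (k : ℝ) + 1) ^ K := by positivity
    have h5 : 0 ≤ C * (3 ^ K * (2 * (k : ℝ) + 1) ^ K) := by positivity
    have hk := k.cast_nonneg (α := ℝ)
    calc _ ≤ _ := h1
      _ ≤ (k : ℝ) * (C * (2 * k + 1) ^ K) + (k + 1) * (C * (3 ^ K * (2 * k + 1) ^ K)) :=
        add_le_add h2 h3
      _ ≤ (2 * k + 1) * (C * (2 * k + 1) ^ K) + (2 * k + 1) * (C * (3 ^ K * (2 * k + 1) ^ K)) := by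
        nlinarith
      _ = _ := by ring

/-- Hermite functions are eigenfunctions of the Fourier transform, up to the dilation by `2π` that
comes with the normalisation `∫ e^{-2πi yξ} f(y) dy`: it exchanges `y` and `d/dy`, hence commutes with
the raising operator up to the factor `-i`. -/
lemma fourier_hermiteLine (k : ℕ) (ξ : ℝ) :
    𝓕 (fun y : ℝ => (hermiteLine k y : ℂ)) ξ =
      √(2 * Real.pi) * (-Complex.I) ^ k * hermiteLine k (2 * Real.pi * ξ) := by
  induction k generalizing ξ with
  | zero =>
    have hb : 0 < (((2 * Real.pi)⁻¹ : ℝ) : ℂ).re := by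
      rw [Complex.ofReal_re]; positivity
    have hpi : (Real.pi : ℂ) ≠ 0 := Complex.ofReal_ne_zero.2 Real.pi_ne_zero
    have h := congrFun (fourier_gaussian_pi hb) ξ
    have e1 : (fun y : ℝ => (hermiteLine 0 y : ℂ)) = fun y : ℝ =>
        (((√(√Real.pi))⁻¹ : ℝ) : ℂ) •
          Complex.exp (-Real.pi * (((2 * Real.pi)⁻¹ : ℝ) : ℂ) * y ^ 2) := by
      ext y
      simp only [hermiteLine, smul_eq_mul, Nat.factorial_zero, Nat.cast_one, one_mul,
        Polynomial.hermite_zero, map_one, mul_one]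
      push_cast
      congr 2
      field_simp
    have e2 : (1 : ℂ) / (((2 * Real.pi)⁻¹ : ℝ) : ℂ) ^ (1 / 2 : ℂ) = (√(2 * Real.pi) : ℝ) := by
      have : (1 / 2 : ℂ) = ((1 / 2 : ℝ) : ℂ) := by norm_num
      rw [this, ← Complex.ofReal_cpow (by positivity), Real.inv_rpow (by positivity),
        ← Real.sqrt_eq_rpow]
      push_cast
      simp
    rw [e1]
    have e3 := congrFun (VectorFourier.fourierIntegral_const_smul Real.fourierChar volume
      (innerₗ ℝ) (fun y : ℝ => Complex.exp (-Real.pi * (((2 * Real.pi)⁻¹ : ℝ) : ℂ) * y ^ 2))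
      (((√(√Real.pi))⁻¹ : ℝ) : ℂ)) ξ
    refine Eq.trans e3 ?_
    rw [Pi.smul_apply, smul_eq_mul]
    refine (congrArg (fun z => (((√(√Real.pi))⁻¹ : ℝ) : ℂ) * z) h).trans ?_
    rw [e2]
    simp only [hermiteLine, Nat.factorial_zero, Nat.cast_one, one_mul,
        Polynomial.hermite_zero, map_one, mul_one, pow_zero]
    push_cast
    rw [show -(Real.pi : ℂ) / (2 * (Real.pi : ℂ))⁻¹ * (ξ : ℂ) ^ 2 =
      -((2 * Real.pi * ξ) ^ 2 / 2) by rw [div_inv_eq_mul]; ring]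
    ring
  | succ k ih =>
    have h0 : (0 : ℝ) < √(2 * (k + 1)) := Real.sqrt_pos.2 (by positivity)
    have hI : Integrable fun y : ℝ => (hermiteLine k y : ℂ) := (integrable_hermiteLine k).ofReal
    have hI1 : Integrable fun y : ℝ => y • (hermiteLine k y : ℂ) := by
      refine (integrable_pow_mul_hermiteLine 1 k).ofReal.congr
        (Filter.Eventually.of_forall fun y => ?_)
      simp
    have hd : ∀ y : ℝ, HasDerivAt (fun y : ℝ => (hermiteLine k y : ℂ)) (hermiteLineDeriv k y) y :=
      fun y => (hasDerivAt_hermiteLine k y).ofReal_comp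
    have hde : deriv (fun y : ℝ => (hermiteLine k y : ℂ)) = fun y => (hermiteLineDeriv k y : ℂ) :=
      funext fun y => (hd y).deriv
    have hID : Integrable (deriv fun y : ℝ => (hermiteLine k y : ℂ)) := by
      rw [hde]; exact (integrable_hermiteLineDeriv k).ofReal
    have hF1 := congrFun (Real.fourier_deriv hI (fun y => (hd y).differentiableAt) hID) ξ
    have hF2 := Real.hasDerivAt_fourier hI hI1 ξ
    have hG : HasDerivAt (𝓕 (fun y : ℝ => (hermiteLine k y : ℂ)))
        (√(2 * Real.pi) * (-Complex.I) ^ k *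
          ((hermiteLineDeriv k (2 * Real.pi * ξ) * (2 * Real.pi) : ℝ) : ℂ)) ξ := by
      rw [show 𝓕 (fun y : ℝ => (hermiteLine k y : ℂ)) = fun ξ : ℝ =>
        (√(2 * Real.pi) : ℂ) * (-Complex.I) ^ k * hermiteLine k (2 * Real.pi * ξ) from funext ih]
      refine HasDerivAt.const_mul _ (HasDerivAt.ofReal_comp ?_)
      have h8 : HasDerivAt (fun ξ : ℝ => 2 * Real.pi * ξ) (2 * Real.pi) ξ := by
        simpa using (hasDerivAt_id ξ).const_mul (2 * Real.pi)
      exact (hasDerivAt_hermiteLine k (2 * Real.pi * ξ)).comp ξ h8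
    have hF3 := hF2.unique hG
    have e3 : (fun y : ℝ => (-2 * Real.pi * Complex.I * y) • (hermiteLine k y : ℂ)) =
        (-2 * Real.pi * Complex.I : ℂ) • fun y : ℝ => y • (hermiteLine k y : ℂ) := by
      ext y
      simp [mul_assoc]
    rw [e3] at hF3
    have e4 : 𝓕 ((-2 * Real.pi * Complex.I : ℂ) • fun y : ℝ => y • (hermiteLine k y : ℂ)) ξ =
        (-2 * Real.pi * Complex.I : ℂ) * 𝓕 (fun y : ℝ => y • (hermiteLine k y : ℂ)) ξ :=
      congrFun (VectorFourier.fourierIntegral_const_smul Real.fourierChar volume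
        (innerₗ ℝ) (fun y : ℝ => y • (hermiteLine k y : ℂ)) _) ξ
    rw [e4] at hF3
    have e5 : (fun y : ℝ => y • (hermiteLine k y : ℂ)) =
        (fun y : ℝ => (hermiteLineDeriv k y : ℂ)) + (√(2 * (k + 1)) : ℂ) • fun y : ℝ =>
          (hermiteLine (k + 1) y : ℂ) := by
      ext y
      simp only [Pi.add_apply, Pi.smul_apply, hermiteLineDeriv_eq_raise, Complex.real_smul,
        smul_eq_mul]
      push_cast
      ring
    have hI2 : Integrable fun y : ℝ => (hermiteLine (k + 1) y : ℂ) :=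
      (integrable_hermiteLine (k + 1)).ofReal
    have e6 : 𝓕 (fun y : ℝ => y • (hermiteLine k y : ℂ)) ξ =
        𝓕 (fun y : ℝ => (hermiteLineDeriv k y : ℂ)) ξ +
          √(2 * (k + 1)) * 𝓕 (fun y : ℝ => (hermiteLine (k + 1) y : ℂ)) ξ := by
      rw [e5]
      have h7 := congrFun (VectorFourier.fourierIntegral_add (e := Real.fourierChar) (μ := volume)
        (L := innerₗ ℝ) Real.continuous_fourierChar (by exact continuous_inner)
        (integrable_hermiteLineDeriv k).ofReal (hI2.smul (√(2 * (k + 1)) : ℂ))) ξ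
      refine h7.trans ?_
      rw [Pi.add_apply]
      congr 1
      exact congrFun (VectorFourier.fourierIntegral_const_smul Real.fourierChar volume
        (innerₗ ℝ) _ _) ξ
    rw [hde, smul_eq_mul, ih ξ] at hF1
    rw [e6, hF1] at hF3
    have hr := hermiteLineDeriv_eq_raise k (2 * Real.pi * ξ)
    rw [hr] at hF3
    have hpi : (Real.pi : ℂ) ≠ 0 := Complex.ofReal_ne_zero.2 Real.pi_ne_zero
    have h0' : (√(2 * ((k : ℝ) + 1)) : ℂ) ≠ 0 := Complex.ofReal_ne_zero.2 h0.ne'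
    have hII : Complex.I * Complex.I = -1 := Complex.I_mul_I
    have hc : (-2 * Real.pi * Complex.I * √(2 * (k + 1)) : ℂ) ≠ 0 := by
      simp only [ne_eq, mul_eq_zero, neg_eq_zero, OfNat.ofNat_ne_zero, hpi, Complex.I_ne_zero, h0',
        or_self, not_false_eq_true]
    refine mul_left_cancel₀ hc ?_
    push_cast at hF3 ⊢
    rw [pow_succ]
    linear_combination hF3 - (2 * Real.pi * √(2 * (k + 1)) * √(2 * Real.pi) * (-Complex.I) ^ k *
      hermiteLine (k + 1) (2 * Real.pi * ξ) - 4 * Real.pi ^ 2 * ξ * √(2 * Real.pi) *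
        (-Complex.I) ^ k * hermiteLine k (2 * Real.pi * ξ)) * hII

/-! ### Hermite functions on `ℝ^d` and the levels of the harmonic oscillator -/

lemma integral_prod_coord {d : ℕ} {𝕜 : Type*} [RCLike 𝕜] (g : Fin d → ℝ → 𝕜) :
    ∫ x : Space d, ∏ i, g i (x i) = ∏ i, ∫ y, g i y := by
  rw [← integral_fintype_prod_volume_eq_prod,
    ← (PiLp.volume_preserving_toLp (Fin d)).integral_comp
      (MeasurableEquiv.toLp 2 (Fin d → ℝ)).measurableEmbedding]

lemma integrable_prod_coord {d : ℕ} {𝕜 : Type*} [RCLike 𝕜] {g : Fin d → ℝ → 𝕜}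
    (hg : ∀ i, Integrable (g i)) : Integrable fun x : Space d => ∏ i, g i (x i) := by
  rw [← (PiLp.volume_preserving_toLp (Fin d)).integrable_comp_emb
    (MeasurableEquiv.toLp 2 (Fin d → ℝ)).measurableEmbedding]
  exact Integrable.fintype_prod hg

lemma ae_coord_ne_zero {d : ℕ} (j : Fin d) : ∀ᵐ x : Space d, x j ≠ 0 := by
  have h : ∀ᵐ y : Fin d → ℝ, y j ≠ 0 := by
    rw [ae_iff]
    simp only [ne_eq, not_not]
    exact Measure.pi_hyperplane (fun _ : Fin d => (volume : Measure ℝ)) j 0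
  have := (EuclideanSpace.volume_preserving_symm_measurableEquiv_toLp
    (Fin d)).quasiMeasurePreserving.ae h
  exact this

/-- The multi-indices of length `n`, which index the eigenfunctions with eigenvalue `2n + d`. -/
def level (d n : ℕ) : Finset (Fin d → ℕ) := Finset.univ.piAntidiag n

lemma mem_level {d n : ℕ} {α : Fin d → ℕ} : α ∈ level d n ↔ ∑ i, α i = n := by
  simp [level, Finset.mem_piAntidiag]

lemma eigenvalue_of_mem_level {d n : ℕ} {α : Fin d → ℕ} (h : α ∈ level d n) :
    eigenvalue α = 2 * n + d := by
  rw [mem_level] at h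
  unfold eigenvalue
  rw [← h]
  push_cast
  rfl

lemma one_le_two_mul_add (d n : ℕ) [NeZero d] : (1 : ℝ) ≤ 2 * n + d := by
  have h : (1 : ℝ) ≤ d := by exact_mod_cast NeZero.one_le
  have := n.cast_nonneg (α := ℝ)
  linarith

/-- Multiplication by a function of a single coordinate is diagonal in the Hermite basis of an
eigenspace: two multi-indices of the same length that agree off one coordinate are equal. -/
lemma integral_coord_mul_hermiteFun_mul {d n : ℕ} {ψ : ℝ → ℝ} (j : Fin d)
    (hψ : ∀ k l, Integrable fun y => ψ y * (hermiteLine k y * hermiteLine l y))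
    {α β : Fin d → ℕ} (hα : α ∈ level d n) (hβ : β ∈ level d n) :
    Integrable (fun x : Space d => ψ (x j) * (hermiteFun α x * hermiteFun β x)) ∧
    ∫ x : Space d, ψ (x j) * (hermiteFun α x * hermiteFun β x) =
      if α = β then ∫ y, ψ y * hermiteLine (α j) y ^ 2 else 0 := by
  classical
  set g : Fin d → ℝ → ℝ := fun i y =>
    (if i = j then ψ y else 1) * (hermiteLine (α i) y * hermiteLine (β i) y) with hg
  have e : ∀ x : Space d, ψ (x j) * (hermiteFun α x * hermiteFun β x) = ∏ i, g i (x i) := by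
    intro x
    simp only [hg, hermiteFun]
    rw [Finset.prod_mul_distrib, Finset.prod_mul_distrib]
    congr 1
    simp
  have hgi : ∀ i, Integrable (g i) := fun i => by
    by_cases hi : i = j
    · simpa [hg, hi] using hψ (α j) (β j)
    · simpa [hg, hi] using integrable_hermiteLine_mul (α i) (β i)
  simp_rw [e]
  refine ⟨integrable_prod_coord hgi, ?_⟩
  rw [integral_prod_coord]
  have hoff : ∀ i, i ≠ j → ∫ y, g i y = if α i = β i then 1 else 0 := fun i hi => by
    simpa [hg, hi] using integral_hermiteLine_mul (α i) (β i)
  by_cases hab : α = β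
  · rw [if_pos hab, ← Finset.mul_prod_erase _ _ (Finset.mem_univ j), Finset.prod_eq_one, mul_one]
    · simp [hg, ← hab, sq]
    · intro i hi
      rw [hoff i (Finset.ne_of_mem_erase hi), if_pos (by rw [hab])]
  · rw [if_neg hab]
    obtain ⟨i, hij, hi⟩ : ∃ i, i ≠ j ∧ α i ≠ β i := by
      by_contra! hcon
      refine hab (funext fun i => ?_)
      by_cases hi : i = j
      · rw [mem_level] at hα hβ
        have h1 := Finset.add_sum_erase Finset.univ α (Finset.mem_univ j)
        have h2 := Finset.add_sum_erase Finset.univ β (Finset.mem_univ j)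
        have h3 : ∑ i ∈ Finset.univ.erase j, α i = ∑ i ∈ Finset.univ.erase j, β i :=
          Finset.sum_congr rfl fun i hi => hcon i (Finset.ne_of_mem_erase hi)
        rw [hi]
        omega
      · exact hcon i hi
    exact Finset.prod_eq_zero (Finset.mem_univ i) (by rw [hoff i hij, if_neg hi])

lemma integral_hermiteFun_mul {d : ℕ} (α β : Fin d → ℕ) :
    ∫ x : Space d, hermiteFun α x * hermiteFun β x = if α = β then 1 else 0 := by
  classical
  simp only [hermiteFun, ← Finset.prod_mul_distrib]
  rw [integral_prod_coord fun (i : Fin d) y => hermiteLine (α i) y * hermiteLine (β i) y]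
  simp only [integral_hermiteLine_mul]
  rw [Finset.prod_ite_zero]
  simp [funext_iff]

lemma orthonormal_hermiteL2 (d : ℕ) : Orthonormal ℂ (hermiteL2 : (Fin d → ℕ) → L2 d) := by
  classical
  rw [orthonormal_iff_ite]
  intro α β
  rw [L2.inner_def]
  have h : ∫ x, inner ℂ ((hermiteL2 α : L2 d) x) ((hermiteL2 β : L2 d) x) =
      ∫ x : Space d, ((hermiteFun α x * hermiteFun β x : ℝ) : ℂ) := by
    refine integral_congr_ae ?_
    filter_upwards [(memLp_hermiteFun α).coeFn_toLp, (memLp_hermiteFun β).coeFn_toLp] with x h1 h2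
    rw [show (hermiteL2 α : L2 d) x = hermiteFun α x from h1,
      show (hermiteL2 β : L2 d) x = hermiteFun β x from h2, RCLike.inner_apply]
    simp [mul_comm]
  rw [h, integral_complex_ofReal, integral_hermiteFun_mul]
  split_ifs <;> simp

lemma hermiteCoeff_eq_inner {d : ℕ} (u : L2 d) (α : Fin d → ℕ) :
    hermiteCoeff u α = inner ℂ (hermiteL2 α) u := by
  rw [L2.inner_def]
  refine integral_congr_ae ?_
  filter_upwards [(memLp_hermiteFun α).coeFn_toLp] with x h1
  rw [show (hermiteL2 α : L2 d) x = hermiteFun α x from h1, RCLike.inner_apply]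
  simp [mul_comm]

lemma sq_norm_sum_mul_ofReal {ι : Type*} (A : Finset ι) (c : ι → ℂ) (r : ι → ℝ) :
    ‖∑ a ∈ A, c a * (r a : ℂ)‖ ^ 2 =
      ∑ a ∈ A, ∑ b ∈ A, (c a * (starRingEnd ℂ) (c b)).re * (r a * r b) := by
  rw [Complex.sq_norm, ← Complex.ofReal_re (Complex.normSq _), Complex.normSq_eq_conj_mul_self,
    map_sum, mul_comm, Finset.sum_mul_sum, Complex.re_sum]
  refine Finset.sum_congr rfl fun a _ => ?_
  rw [Complex.re_sum]
  refine Finset.sum_congr rfl fun b _ => ?_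
  rw [map_mul, Complex.conj_ofReal, ← Complex.re_mul_ofReal]
  congr 1
  push_cast
  ring

/-- For functions in an eigenspace, a norm with a weight in one coordinate is diagonal in the Hermite
coefficients. -/
lemma lintegral_coord_mul_sq_norm_sum {d n : ℕ} {ψ : ℝ → ℝ} (j : Fin d) (hψ0 : ∀ y, 0 ≤ ψ y)
    (hψ : ∀ k l, Integrable fun y => ψ y * (hermiteLine k y * hermiteLine l y))
    {A : Finset (Fin d → ℕ)} (hA : A ⊆ level d n) (c : (Fin d → ℕ) → ℂ) :
    ∫⁻ x : Space d, ENNReal.ofReal (ψ (x j) * ‖∑ α ∈ A, c α * hermiteFun α x‖ ^ 2) =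
      ENNReal.ofReal (∑ α ∈ A, ‖c α‖ ^ 2 * ∫ y, ψ y * hermiteLine (α j) y ^ 2) := by
  classical
  have e : ∀ x : Space d, ψ (x j) * ‖∑ α ∈ A, c α * hermiteFun α x‖ ^ 2 =
      ∑ α ∈ A, ∑ β ∈ A, (c α * (starRingEnd ℂ) (c β)).re *
        (ψ (x j) * (hermiteFun α x * hermiteFun β x)) := fun x => by
    rw [sq_norm_sum_mul_ofReal, Finset.mul_sum]
    refine Finset.sum_congr rfl fun α _ => ?_
    rw [Finset.mul_sum]
    exact Finset.sum_congr rfl fun β _ => by ring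
  have hi : ∀ α ∈ A, ∀ β ∈ A, Integrable fun x : Space d =>
      (c α * (starRingEnd ℂ) (c β)).re * (ψ (x j) * (hermiteFun α x * hermiteFun β x)) :=
    fun α hα β hβ => (integral_coord_mul_hermiteFun_mul j hψ (hA hα) (hA hβ)).1.const_mul _
  have hI : Integrable fun x : Space d => ψ (x j) * ‖∑ α ∈ A, c α * hermiteFun α x‖ ^ 2 := by
    simp_rw [e]
    exact integrable_finsetSum _ fun α hα => integrable_finsetSum _ fun β hβ => hi α hα β hβ
  rw [← ofReal_integral_eq_lintegral_ofReal hI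
    (Filter.Eventually.of_forall fun x => mul_nonneg (hψ0 _) (sq_nonneg _))]
  congr 1
  simp_rw [e]
  rw [integral_finsetSum _ fun α hα => integrable_finsetSum _ fun β hβ => hi α hα β hβ]
  refine Finset.sum_congr rfl fun α hα => ?_
  rw [integral_finsetSum _ fun β hβ => hi α hα β hβ]
  rw [Finset.sum_eq_single_of_mem α hα]
  · rw [integral_const_mul, (integral_coord_mul_hermiteFun_mul j hψ (hA hα) (hA hα)).2, if_pos rfl,
      Complex.mul_conj, Complex.ofReal_re, Complex.sq_norm]
  · intro β hβ hne
    rw [integral_const_mul, (integral_coord_mul_hermiteFun_mul j hψ (hA hα) (hA hβ)).2,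
      if_neg hne.symm, mul_zero]

/-! ### Weighted bounds on an eigenspace -/

lemma lintegral_sq_norm_level_sum {d n : ℕ} [NeZero d] (c : (Fin d → ℕ) → ℂ) :
    ∫⁻ x : Space d, ENNReal.ofReal (‖∑ α ∈ level d n, c α * hermiteFun α x‖ ^ 2) =
      ENNReal.ofReal (∑ α ∈ level d n, ‖c α‖ ^ 2) := by
  have h := lintegral_coord_mul_sq_norm_sum (d := d) (n := n) (ψ := fun _ => 1) 0
    (fun _ => zero_le_one) (fun k l => by simpa using integrable_hermiteLine_mul k l)
    (Finset.Subset.refl _) c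
  simpa [integral_hermiteLine_sq] using h

lemma norm_sq_pow_le_sum {d : ℕ} [NeZero d] (x : Space d) (K : ℕ) :
    ‖x‖ ^ (2 * K) ≤ d ^ K * ∑ j, x j ^ (2 * K) := by
  obtain ⟨j, -, hj⟩ := Finset.exists_max_image Finset.univ (fun j => x j ^ 2)
    Finset.univ_nonempty
  have h1 : ‖x‖ ^ 2 ≤ d * x j ^ 2 := by
    rw [EuclideanSpace.real_norm_sq_eq]
    simpa using Finset.sum_le_card_nsmul Finset.univ (fun i => x i ^ 2) (x j ^ 2) fun i hi => hj i hi
  have h2 : x j ^ (2 * K) ≤ ∑ j, x j ^ (2 * K) :=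
    Finset.single_le_sum (f := fun j => x j ^ (2 * K))
      (fun i _ => by rw [pow_mul]; positivity) (Finset.mem_univ j)
  calc ‖x‖ ^ (2 * K) = (‖x‖ ^ 2) ^ K := pow_mul _ _ _
    _ ≤ (d * x j ^ 2) ^ K := pow_le_pow_left₀ (by positivity) h1 K
    _ = d ^ K * x j ^ (2 * K) := by rw [mul_pow, pow_mul]
    _ ≤ _ := mul_le_mul_of_nonneg_left h2 (by positivity)

/-- Moments of an eigenfunction: `∫ |x|^{2K} |f|² ≲ λ^K ‖f‖²`. -/
lemma lintegral_norm_pow_mul_level_sum_le (d K : ℕ) [NeZero d] :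
    ∃ C : ℝ, 0 < C ∧ ∀ (n : ℕ) (c : (Fin d → ℕ) → ℂ),
      ∫⁻ x : Space d, ENNReal.ofReal
        (‖x‖ ^ (2 * K) * ‖∑ α ∈ level d n, c α * hermiteFun α x‖ ^ 2) ≤
      ENNReal.ofReal (C * (2 * n + d : ℝ) ^ K * ∑ α ∈ level d n, ‖c α‖ ^ 2) := by
  obtain ⟨C, hC0, hC⟩ := integral_pow_mul_hermiteLine_sq_le K
  have hd0 : (0 : ℝ) < d := by exact_mod_cast Nat.pos_of_ne_zero (NeZero.ne d)
  refine ⟨d ^ K * (d * C), by positivity, fun n c => ?_⟩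
  set f : Space d → ℂ := fun x => ∑ α ∈ level d n, c α * hermiteFun α x with hf
  have hfm : Measurable f := by
    refine Continuous.measurable ?_
    exact continuous_finsetSum _ fun α _ => continuous_const.mul
      (Complex.continuous_ofReal.comp (continuous_hermiteFun α))
  have hψ0 : ∀ y : ℝ, 0 ≤ y ^ (2 * K) := fun y => by rw [pow_mul]; positivity
  have h1 : ∀ j : Fin d, ∫⁻ x : Space d, ENNReal.ofReal (x j ^ (2 * K) * ‖f x‖ ^ 2) ≤
      ENNReal.ofReal (C * (2 * n + d : ℝ) ^ K * ∑ α ∈ level d n, ‖c α‖ ^ 2) := fun j => by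
    rw [hf, lintegral_coord_mul_sq_norm_sum (ψ := fun y => y ^ (2 * K)) j hψ0
      (fun k l => integrable_pow_mul_hermiteLine_mul _ k l) (Finset.Subset.refl _) c]
    refine ENNReal.ofReal_le_ofReal ?_
    rw [Finset.mul_sum]
    refine Finset.sum_le_sum fun α hα => ?_
    rw [mul_comm]
    refine mul_le_mul_of_nonneg_right ((hC (α j)).trans ?_) (by positivity)
    refine mul_le_mul_of_nonneg_left (pow_le_pow_left₀ (by positivity) ?_ K) hC0.le
    have h3 : α j ≤ n := by
      rw [← mem_level.1 hα]
      exact Finset.single_le_sum (fun i _ => Nat.zero_le _) (Finset.mem_univ j)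
    have h4 : (1 : ℝ) ≤ d := by exact_mod_cast NeZero.one_le
    have h5 : ((α j : ℕ) : ℝ) ≤ n := by exact_mod_cast h3
    linarith
  calc ∫⁻ x : Space d, ENNReal.ofReal (‖x‖ ^ (2 * K) * ‖f x‖ ^ 2)
      ≤ ∫⁻ x : Space d, ENNReal.ofReal (d ^ K) * ∑ j, ENNReal.ofReal (x j ^ (2 * K) * ‖f x‖ ^ 2) := by
        refine lintegral_mono fun x => ?_
        rw [← ENNReal.ofReal_sum_of_nonneg fun j _ => mul_nonneg (hψ0 _) (sq_nonneg _),
          ← ENNReal.ofReal_mul (by positivity)]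
        refine ENNReal.ofReal_le_ofReal ?_
        rw [← Finset.sum_mul, ← mul_assoc]
        exact mul_le_mul_of_nonneg_right (norm_sq_pow_le_sum x K) (sq_nonneg _)
    _ = ENNReal.ofReal (d ^ K) * ∑ j, ∫⁻ x : Space d, ENNReal.ofReal (x j ^ (2 * K) * ‖f x‖ ^ 2) := by
        have hm : ∀ j : Fin d, Measurable fun x : Space d =>
            ENNReal.ofReal (x j ^ (2 * K) * ‖f x‖ ^ 2) := fun j => by fun_prop
        rw [lintegral_const_mul _ (Finset.measurable_fun_sum _ fun j _ => hm j),
          lintegral_finsetSum _ fun j _ => hm j]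
    _ ≤ ENNReal.ofReal (d ^ K) * ∑ _j : Fin d,
          ENNReal.ofReal (C * (2 * n + d : ℝ) ^ K * ∑ α ∈ level d n, ‖c α‖ ^ 2) := by
        gcongr with j
        exact h1 j
    _ = _ := by
        rw [Finset.sum_const, Finset.card_univ, Fintype.card_fin, nsmul_eq_mul,
          ← ENNReal.ofReal_natCast d, ← ENNReal.ofReal_mul (by positivity),
          ← ENNReal.ofReal_mul (by positivity)]
        congr 1
        ring

lemma abs_coord_le_norm {d : ℕ} (x : Space d) (j : Fin d) : |x j| ≤ ‖x‖ := by
  simpa using PiLp.norm_apply_le x j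

/-- Decay of eigenfunctions against negative powers of `|x|`: for `-1 < p ≤ 0`,
`∫ |x|^p |f|² ≲ λ^{p/2} ‖f‖²`. The eigenfunction is split into `d` parts according to a largest entry
`α j` of the multi-index; on the `j`-th part `|x|^p ≤ |x_j|^p`, where `|x_j|^p` acts diagonally and
`h_{α j}` is a one-dimensional Hermite function with eigenvalue comparable to `λ`. -/
lemma lintegral_norm_rpow_mul_level_sum_le (d : ℕ) [NeZero d] {p : ℝ} (hp : -1 < p) (hp0 : p ≤ 0) :
    ∃ C : ℝ, 0 < C ∧ ∀ (n : ℕ) (c : (Fin d → ℕ) → ℂ),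
      ∫⁻ x : Space d, ENNReal.ofReal
        (‖x‖ ^ p * ‖∑ α ∈ level d n, c α * hermiteFun α x‖ ^ 2) ≤
      ENNReal.ofReal (C * (2 * n + d : ℝ) ^ (p / 2) * ∑ α ∈ level d n, ‖c α‖ ^ 2) := by
  classical
  obtain ⟨C, hC0, hC⟩ := integral_abs_rpow_mul_hermiteLine_sq_le hp hp0
  have hd1 : (1 : ℝ) ≤ d := by exact_mod_cast NeZero.one_le
  have hd0 : (0 : ℝ) < d := by linarith
  refine ⟨d * (C * d), by positivity, fun n c => ?_⟩
  have hmax : ∀ α : Fin d → ℕ, ∃ j, ∀ i, α i ≤ α j := fun α => by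
    obtain ⟨j, -, hj⟩ := Finset.exists_max_image Finset.univ α Finset.univ_nonempty
    exact ⟨j, fun i => hj i (Finset.mem_univ i)⟩
  choose J hJ using hmax
  set A : Fin d → Finset (Fin d → ℕ) := fun j => (level d n).filter fun α => J α = j with hA
  set f : Fin d → Space d → ℂ := fun j x => ∑ α ∈ A j, c α * hermiteFun α x with hf
  have hfm : ∀ j, Measurable (f j) := fun j => by
    refine Continuous.measurable ?_
    exact continuous_finsetSum _ fun α _ => continuous_const.mul
      (Complex.continuous_ofReal.comp (continuous_hermiteFun α))
  have hsum : ∀ x : Space d, ∑ α ∈ level d n, c α * hermiteFun α x = ∑ j, f j x := fun x =>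
    (Finset.sum_fiberwise _ _ _).symm
  have hlam : (0 : ℝ) < 2 * n + d := by positivity
  have hψ0 : ∀ y : ℝ, 0 ≤ |y| ^ p := fun y => Real.rpow_nonneg (abs_nonneg y) p
  have h1 : ∀ j : Fin d, ∫⁻ x : Space d, ENNReal.ofReal (|x j| ^ p * ‖f j x‖ ^ 2) ≤
      ENNReal.ofReal (∑ α ∈ A j, C * d * (2 * n + d : ℝ) ^ (p / 2) * ‖c α‖ ^ 2) := fun j => by
    rw [hf, lintegral_coord_mul_sq_norm_sum (ψ := fun y => |y| ^ p) j hψ0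
      (fun k l => integrable_abs_rpow_mul_hermiteLine_mul hp k l) (Finset.filter_subset _ _) c]
    refine ENNReal.ofReal_le_ofReal (Finset.sum_le_sum fun α hα => ?_)
    rw [mul_comm]
    refine mul_le_mul_of_nonneg_right ((hC (α j)).trans ?_) (by positivity)
    rw [mul_assoc]
    refine mul_le_mul_of_nonneg_left ?_ hC0.le
    obtain ⟨hα1, hα2⟩ := Finset.mem_filter.1 hα
    have h3 : (2 * n + d : ℝ) / d ≤ 2 * (α j : ℕ) + 1 := by
      rw [div_le_iff₀ hd0]
      have h4 : n ≤ d * α j := by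
        rw [← mem_level.1 hα1, ← hα2]
        simpa using Finset.sum_le_card_nsmul Finset.univ α (α (J α)) fun i _ => hJ α i
      have h5 : (n : ℝ) ≤ d * (α j : ℕ) := by exact_mod_cast h4
      linarith
    calc (2 * (α j : ℕ) + 1 : ℝ) ^ (p / 2) ≤ ((2 * n + d : ℝ) / d) ^ (p / 2) :=
          Real.rpow_le_rpow_of_nonpos (by positivity) h3 (by linarith)
      _ = (d : ℝ) ^ (-(p / 2)) * (2 * n + d : ℝ) ^ (p / 2) := by
          rw [Real.div_rpow hlam.le hd0.le, Real.rpow_neg hd0.le, div_eq_inv_mul]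
      _ ≤ (d : ℝ) ^ (1 : ℝ) * (2 * n + d : ℝ) ^ (p / 2) := by
          refine mul_le_mul_of_nonneg_right ?_ (by positivity)
          exact Real.rpow_le_rpow_of_exponent_le hd1 (by linarith)
      _ = _ := by rw [Real.rpow_one]
  have hae : ∀ᵐ x : Space d, ∀ j, x j ≠ 0 := ae_all_iff.2 ae_coord_ne_zero
  calc ∫⁻ x : Space d, ENNReal.ofReal (‖x‖ ^ p * ‖∑ α ∈ level d n, c α * hermiteFun α x‖ ^ 2)
      ≤ ∫⁻ x : Space d, ENNReal.ofReal d * ∑ j, ENNReal.ofReal (|x j| ^ p * ‖f j x‖ ^ 2) := by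
        refine lintegral_mono_ae ?_
        filter_upwards [hae] with x hx
        rw [← ENNReal.ofReal_sum_of_nonneg fun j _ => mul_nonneg (hψ0 _) (sq_nonneg _),
          ← ENNReal.ofReal_mul (by positivity), hsum]
        refine ENNReal.ofReal_le_ofReal ?_
        have h6 : ‖∑ j, f j x‖ ^ 2 ≤ d * ∑ j, ‖f j x‖ ^ 2 := by
          refine (pow_le_pow_left₀ (norm_nonneg _) (norm_sum_le _ _) 2).trans ?_
          simpa using sq_sum_le_card_mul_sum_sq (s := Finset.univ) (f := fun j => ‖f j x‖)
        calc ‖x‖ ^ p * ‖∑ j, f j x‖ ^ 2 ≤ ‖x‖ ^ p * (d * ∑ j, ‖f j x‖ ^ 2) :=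
              mul_le_mul_of_nonneg_left h6 (by positivity)
          _ = d * ∑ j, ‖x‖ ^ p * ‖f j x‖ ^ 2 := by rw [← Finset.mul_sum]; ring
          _ ≤ d * ∑ j, |x j| ^ p * ‖f j x‖ ^ 2 := by
              refine mul_le_mul_of_nonneg_left (Finset.sum_le_sum fun j _ => ?_) hd0.le
              refine mul_le_mul_of_nonneg_right ?_ (sq_nonneg _)
              exact Real.rpow_le_rpow_of_nonpos (abs_pos.2 (hx j)) (abs_coord_le_norm x j) hp0
    _ = ENNReal.ofReal d * ∑ j, ∫⁻ x : Space d, ENNReal.ofReal (|x j| ^ p * ‖f j x‖ ^ 2) := by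
        have hm : ∀ j : Fin d, Measurable fun x : Space d =>
            ENNReal.ofReal (|x j| ^ p * ‖f j x‖ ^ 2) := fun j => by
          have := hfm j
          fun_prop
        rw [lintegral_const_mul _ (Finset.measurable_fun_sum _ fun j _ => hm j),
          lintegral_finsetSum _ fun j _ => hm j]
    _ ≤ ENNReal.ofReal d * ∑ j : Fin d,
          ENNReal.ofReal (∑ α ∈ A j, C * d * (2 * n + d : ℝ) ^ (p / 2) * ‖c α‖ ^ 2) := by
        gcongr with j
        exact h1 j
    _ = _ := by
        rw [← ENNReal.ofReal_sum_of_nonneg fun j _ => by positivity,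
          ← ENNReal.ofReal_mul (by positivity), Finset.sum_fiberwise, ← Finset.mul_sum]
        congr 1
        ring

/-! ### The Fourier transform of Hermite functions on `ℝ^d` -/

lemma fourierChar_neg_inner {d : ℕ} (x ξ : Space d) :
    (Real.fourierChar (-inner ℝ x ξ) : ℂ) = ∏ i, (Real.fourierChar (-(x i * ξ i)) : ℂ) := by
  simp only [Real.fourierChar_apply]
  rw [← Complex.exp_sum, PiLp.inner_apply, ← Finset.sum_mul]
  congr 2
  push_cast
  rw [← Finset.mul_sum, ← Finset.sum_neg_distrib]
  simp [mul_comm]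

lemma fourier_hermiteFun {d : ℕ} (α : Fin d → ℕ) (ξ : Space d) :
    𝓕 (fun x : Space d => (hermiteFun α x : ℂ)) ξ =
      (√(2 * Real.pi) : ℂ) ^ d * (-Complex.I) ^ (∑ i, α i) *
        hermiteFun α ((2 * Real.pi) • ξ) := by
  rw [Real.fourier_eq]
  have e : ∀ x : Space d, Real.fourierChar (-inner ℝ x ξ) • (hermiteFun α x : ℂ) =
      ∏ i, Real.fourierChar (-(x i * ξ i)) • (hermiteLine (α i) (x i) : ℂ) := fun x => by
    simp only [Circle.smul_def, smul_eq_mul, hermiteFun, Finset.prod_mul_distrib,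
      fourierChar_neg_inner, Complex.ofReal_prod]
  simp_rw [e]
  rw [integral_prod_coord fun (i : Fin d) y =>
    Real.fourierChar (-(y * ξ i)) • (hermiteLine (α i) y : ℂ)]
  have h : ∀ i, ∫ y : ℝ, Real.fourierChar (-(y * ξ i)) • (hermiteLine (α i) y : ℂ) =
      (√(2 * Real.pi) : ℂ) * (-Complex.I) ^ (α i) * hermiteLine (α i) (2 * Real.pi * ξ i) :=
    fun i => by rw [← fourier_hermiteLine, Real.fourier_real_eq]
  simp_rw [h]
  rw [Finset.prod_mul_distrib, Finset.prod_mul_distrib, Finset.prod_const, Finset.card_univ,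
    Fintype.card_fin, Finset.prod_pow_eq_pow_sum]
  simp [hermiteFun]

lemma hermiteFun_bound {d : ℕ} (α : Fin d → ℕ) :
    ∃ C : ℝ, 0 ≤ C ∧ ∀ x : Space d, |hermiteFun α x| ≤ C * Real.exp (-(1 / 4) * ‖x‖ ^ 2) := by
  choose C hC using fun j => hermiteLine_bound (α j)
  refine ⟨∏ j, C j, Finset.prod_nonneg fun j _ => ?_, fun x => ?_⟩
  · have := (abs_nonneg _).trans (hC j 0)
    simpa using this
  · unfold hermiteFun
    rw [Finset.abs_prod]
    refine (Finset.prod_le_prod (fun _ _ => abs_nonneg _) fun j _ => hC j (x j)).trans_eq ?_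
    rw [Finset.prod_mul_distrib, ← Real.exp_sum, EuclideanSpace.real_norm_sq_eq,
      Finset.sum_neg_distrib, ← Finset.sum_div]
    ring_nf

/-! ### Plancherel's theorem on `L¹ ∩ L²` -/

/-- The multiplication formula for the Fourier integral. -/
lemma integral_fourier_mul {d : ℕ} {f g : Space d → ℂ} (hf : Integrable f) (hg : Integrable g) :
    ∫ ξ, 𝓕 f ξ * g ξ = ∫ x, f x * 𝓕 g x := by
  have h := VectorFourier.integral_fourierIntegral_smul_eq_flip (e := Real.fourierChar)
    (μ := (volume : Measure (Space d))) (ν := (volume : Measure (Space d))) (L := innerₗ (Space d))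
    Real.continuous_fourierChar (by exact continuous_inner) hf hg
  simpa [flip_innerₗ] using! h

lemma continuous_fourier {d : ℕ} {f : Space d → ℂ} (hf : Integrable f) : Continuous (𝓕 f) :=
  VectorFourier.fourierIntegral_continuous Real.continuous_fourierChar (by exact continuous_inner) hf

/-- On `L¹ ∩ L²` the `L²` Fourier transform is given by the Fourier integral. -/
lemma fourier_toLp_ae_eq {d : ℕ} {u : Space d → ℂ} (h1 : Integrable u) (h2 : MemLp u 2) :
    (𝓕 (h2.toLp u) : L2 d) =ᵐ[volume] 𝓕 u := by
  refine ae_eq_of_integral_contDiff_smul_eq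
    ((Lp.memLp (𝓕 (h2.toLp u) : L2 d)).locallyIntegrable (by norm_num))
    (continuous_fourier h1).locallyIntegrable fun g hg hgs => ?_
  have hgs' : HasCompactSupport fun x => (g x : ℂ) := hgs.comp_left Complex.ofReal_zero
  have hg' : ContDiff ℝ (⊤ : ℕ∞) fun x => (g x : ℂ) := Complex.ofRealCLM.contDiff.comp hg
  set φ : 𝓢(Space d, ℂ) := hgs'.toSchwartzMap hg' with hφ
  have hφx : ∀ x, φ x = g x := fun x => rfl
  have h3 := congrArg (fun T => T φ) (Lp.fourier_toTemperedDistribution_eq (h2.toLp u))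
  simp only [TemperedDistribution.fourier_apply, Lp.toTemperedDistribution_apply, smul_eq_mul] at h3
  have h4 : ∫ x, (𝓕 φ : 𝓢(Space d, ℂ)) x * (h2.toLp u) x = ∫ x, u x * 𝓕 (φ : Space d → ℂ) x := by
    refine integral_congr_ae ?_
    filter_upwards [h2.coeFn_toLp] with x hx
    rw [hx, mul_comm]
    rfl
  rw [h4, ← integral_fourier_mul h1 φ.integrable] at h3
  simp only [hφx] at h3
  simp only [Complex.real_smul]
  rw [← h3]
  exact integral_congr_ae (Filter.Eventually.of_forall fun x => mul_comm _ _)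

lemma eLpNorm_fourier {d : ℕ} {u : Space d → ℂ} (h1 : Integrable u) (h2 : MemLp u 2) :
    eLpNorm (𝓕 u) 2 volume = eLpNorm u 2 volume := by
  rw [← eLpNorm_congr_ae (fourier_toLp_ae_eq h1 h2), ← Lp.enorm_def, ← ofReal_norm,
    Lp.norm_fourier_eq, ofReal_norm, Lp.enorm_def, eLpNorm_congr_ae h2.coeFn_toLp]

lemma eLpNorm_fourierInv {d : ℕ} {u : Space d → ℂ} (h1 : Integrable u) (h2 : MemLp u 2) :
    eLpNorm (𝓕⁻ u) 2 volume = eLpNorm u 2 volume := by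
  have e : 𝓕⁻ u = (𝓕 u) ∘ (fun x => -x) := by
    ext x
    simp [Real.fourierInv_eq_fourier_neg]
  rw [e, eLpNorm_comp_measurePreserving
    (continuous_fourier h1).aestronglyMeasurable (Measure.measurePreserving_neg volume),
    eLpNorm_fourier h1 h2]

lemma eLpNorm_two_sq {α : Type*} [MeasurableSpace α] (μ : Measure α) (f : α → ℂ) :
    eLpNorm f 2 μ ^ 2 = ∫⁻ x, ENNReal.ofReal (‖f x‖ ^ 2) ∂μ := by
  rw [eLpNorm_eq_lintegral_rpow_enorm_toReal (by norm_num) (by norm_num)]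
  simp only [ENNReal.toReal_ofNat]
  rw [← ENNReal.rpow_natCast, ← ENNReal.rpow_mul]
  norm_num

lemma memLp_two_of_lintegral_lt_top {α : Type*} [MeasurableSpace α] {μ : Measure α} {f : α → ℂ}
    (hf : AEStronglyMeasurable f μ) (h : ∫⁻ x, ENNReal.ofReal (‖f x‖ ^ 2) ∂μ < ∞) :
    MemLp f 2 μ := by
  refine ⟨hf, ?_⟩
  rw [← eLpNorm_two_sq] at h
  exact (ENNReal.pow_lt_top_iff).1 h |>.resolve_right (by norm_num)

/-! ### The weight `⟨x⟩^{-β}` as a Fourier transform of a probability measure -/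

lemma bracket_pos {d : ℕ} (x : Space d) : 0 < bracket x := Real.sqrt_pos.2 (by positivity)

lemma continuous_bracket {d : ℕ} : Continuous (bracket : Space d → ℝ) := by
  unfold bracket
  fun_prop

lemma continuous_bracket_rpow {d : ℕ} (p : ℝ) : Continuous fun x : Space d => bracket x ^ p :=
  continuous_bracket.rpow_const fun x => Or.inl (bracket_pos x).ne'

lemma one_le_bracket {d : ℕ} (x : Space d) : 1 ≤ bracket x := by
  unfold bracket
  rw [Real.one_le_sqrt]
  have := sq_nonneg ‖x‖
  linarith

lemma bracket_rpow_neg {d : ℕ} (x : Space d) (b : ℝ) :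
    bracket x ^ (-b) = (1 / (1 + ‖x‖ ^ 2)) ^ (b / 2) := by
  unfold bracket
  rw [Real.sqrt_eq_rpow, ← Real.rpow_mul (by positivity), one_div (1 + ‖x‖ ^ 2),
    Real.inv_rpow (by positivity),
    ← Real.rpow_neg (by positivity)]
  ring_nf

lemma norm_le_bracket {d : ℕ} (x : Space d) : ‖x‖ ≤ bracket x :=
  Real.le_sqrt_of_sq_le (by linarith)

open ProbabilityTheory in
lemma integral_gammaMeasure {E : Type*} [NormedAddCommGroup E] [NormedSpace ℝ E] {a : ℝ}
    (ha : 0 < a) (f : ℝ → E) :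
    ∫ t, f t ∂(gammaMeasure a 1) =
      ∫ t in Set.Ioi 0, ((Real.Gamma a)⁻¹ * (t ^ (a - 1) * Real.exp (-t))) • f t := by
  have hm : Measurable (gammaPDF a 1) := (measurable_gammaPDFReal a 1).ennreal_ofReal
  rw [gammaMeasure, integral_withDensity_eq_integral_toReal_smul hm (Filter.Eventually.of_forall fun t => by
      simp [gammaPDF]), ← integral_indicator measurableSet_Ioi]
  refine integral_congr_ae ?_
  filter_upwards [Measure.ae_ne volume (0 : ℝ)] with t ht
  by_cases h0 : 0 < t
  · have h1 : 0 ≤ gammaPDFReal a 1 t := gammaPDFReal_nonneg ha one_pos t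
    rw [Set.indicator_of_mem (Set.mem_Ioi.2 h0), gammaPDF, ENNReal.toReal_ofReal h1, gammaPDFReal,
      if_pos h0.le]
    simp [mul_assoc]
  · rw [Set.indicator_of_notMem (by simpa using h0), gammaPDF, gammaPDFReal, if_neg]
    · simp
    · exact fun h => h0 (lt_of_le_of_ne h (Ne.symm ht))

open ProbabilityTheory in
lemma integrable_rpow_gammaMeasure {a p : ℝ} (ha : 0 < a) (hp : 0 ≤ p) :
    Integrable (fun t => t ^ p) (gammaMeasure a 1) := by
  have hm : Measurable (gammaPDF a 1) := (measurable_gammaPDFReal a 1).ennreal_ofReal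
  rw [gammaMeasure, integrable_withDensity_iff_integrable_smul₀' hm.aemeasurable
    (Filter.Eventually.of_forall fun t => by simp [gammaPDF])]
  have h := (Real.GammaIntegral_convergent (s := p + a) (by linarith)).const_mul (Real.Gamma a)⁻¹
  rw [← IntegrableOn, ← integrable_indicator_iff measurableSet_Ioi] at h
  refine h.congr ?_
  filter_upwards [Measure.ae_ne volume (0 : ℝ)] with t ht
  by_cases h0 : 0 < t
  · have h1 : 0 ≤ gammaPDFReal a 1 t := gammaPDFReal_nonneg ha one_pos t
    rw [Set.indicator_of_mem (Set.mem_Ioi.2 h0), gammaPDF, ENNReal.toReal_ofReal h1, gammaPDFReal,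
      if_pos h0.le, show p + a - 1 = (a - 1) + p by ring, Real.rpow_add h0]
    simp
    ring
  · rw [Set.indicator_of_notMem (by simpa using h0), gammaPDF, gammaPDFReal, if_neg]
    · simp
    · exact fun h => h0 (lt_of_le_of_ne h (Ne.symm ht))

open ProbabilityTheory in
/-- For `b > 0` the weight `⟨x⟩^{-b}` is a mixture of Gaussians `exp(-τ|x|²)`, hence the Fourier
transform of a probability measure, which has moments of all orders. -/
lemma exists_measure_fourier_eq_bracket (d : ℕ) {b : ℝ} (hb : 0 < b) :
    ∃ ν : Measure (Space d), IsProbabilityMeasure ν ∧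
      (∀ N : ℕ, Integrable (fun z => ‖z‖ ^ N) ν) ∧
      ∀ x : Space d, ∫ z, (Real.fourierChar (inner ℝ z x) : ℂ) ∂ν = (bracket x ^ (-b) : ℝ) := by
  have hb2 : 0 < b / 2 := by positivity
  have := isProbabilityMeasure_gammaMeasure hb2 one_pos
  -- `ν` is the law of `√(2τ) Y / 2π`, with `τ` Gamma distributed of shape `b / 2` and `Y` a standard
  -- Gaussian vector independent of `τ`: given `τ`, the Fourier transform at `x` is `exp(-τ|x|²)`
  set μ := (gammaMeasure (b / 2) 1).prod (stdGaussian (Space d)) with hμ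
  set z : ℝ × Space d → Space d := fun p => (√(2 * p.1) / (2 * Real.pi)) • p.2 with hz
  have hzm : Measurable z := by
    change Measurable fun p : ℝ × Space d => (√(2 * p.1) / (2 * Real.pi)) • p.2
    fun_prop
  refine ⟨μ.map z, Measure.isProbabilityMeasure_map hzm.aemeasurable, fun N => ?_, fun x => ?_⟩
  · rw [integrable_map_measure (by fun_prop) hzm.aemeasurable]
    have h1 : Integrable (fun t : ℝ => √(2 * t) ^ N) (gammaMeasure (b / 2) 1) := by
      refine ((integrable_rpow_gammaMeasure hb2 (p := (N : ℝ) / 2) (by positivity)).norm.const_mul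
        (√2 ^ N)).mono' (by fun_prop) (Filter.Eventually.of_forall fun t => ?_)
      rw [Real.norm_of_nonneg (by positivity)]
      rcases le_or_gt t 0 with ht | ht
      · rcases Nat.eq_zero_or_pos N with rfl | hN
        · simp
        · rw [Real.sqrt_eq_zero_of_nonpos (by linarith), zero_pow hN.ne']
          positivity
      · rw [Real.norm_of_nonneg (by positivity), Real.sqrt_mul (by norm_num), mul_pow,
          Real.sqrt_eq_rpow t, ← Real.rpow_natCast, ← Real.rpow_natCast (t ^ (1 / 2 : ℝ)),
          ← Real.rpow_mul ht.le]
        apply le_of_eq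
        ring_nf
    have h2 : Integrable (fun y : Space d => ‖y‖ ^ N) (stdGaussian (Space d)) := by
      simpa using! (IsGaussian.memLp_id (stdGaussian (Space d)) (N : ℝ≥0∞)
        (ENNReal.natCast_ne_top N)).integrable_norm_pow'
    refine ((h1.mul_prod h2).const_mul ((2 * Real.pi)⁻¹ ^ N)).congr
      (Filter.Eventually.of_forall fun p => ?_)
    simp only [Function.comp_apply, hz, norm_smul, Real.norm_eq_abs]
    rw [abs_of_nonneg (by positivity), mul_pow, div_eq_mul_inv, mul_pow]
    ring
  · rw [integral_map hzm.aemeasurable (by fun_prop)]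
    have h1 : Integrable (fun p : ℝ × Space d =>
        (Real.fourierChar (inner ℝ (z p) x) : ℂ)) μ := by
      refine (integrable_const (1 : ℝ)).mono' ?_ (Filter.Eventually.of_forall fun p =>
        (Circle.norm_coe _).le)
      have : Continuous fun w : Space d => (Real.fourierChar (inner ℝ w x) : ℂ) := by fun_prop
      exact (this.measurable.comp hzm).aestronglyMeasurable
    rw [hμ, integral_prod _ h1]
    have h2 : ∀ t : ℝ, ∫ y, (Real.fourierChar (inner ℝ (z (t, y)) x) : ℂ) ∂(stdGaussian (Space d)) =
        Complex.exp (-‖√(2 * t) • x‖ ^ 2 / 2) := fun t => by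
      rw [← charFun_stdGaussian, charFun_apply]
      refine integral_congr_ae (Filter.Eventually.of_forall fun y => ?_)
      simp only [hz, Real.fourierChar_apply, inner_smul_left, inner_smul_right]
      congr 1
      push_cast
      simp only [conj_trivial]
      have : (Real.pi : ℂ) ≠ 0 := Complex.ofReal_ne_zero.2 Real.pi_ne_zero
      field_simp
      push_cast
      field_simp
    simp_rw [h2]
    rw [integral_gammaMeasure hb2]
    have h3 : ∀ t ∈ Set.Ioi (0 : ℝ), (((Real.Gamma (b / 2))⁻¹ * (t ^ (b / 2 - 1) * Real.exp (-t))) •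
        Complex.exp (-‖√(2 * t) • x‖ ^ 2 / 2)) =
        (((Real.Gamma (b / 2))⁻¹ * (t ^ (b / 2 - 1) * Real.exp (-((1 + ‖x‖ ^ 2) * t))) : ℝ) : ℂ) := by
      intro t ht
      have ht' : (0 : ℝ) ≤ 2 * t := by linarith [Set.mem_Ioi.1 ht]
      have e1 : Complex.exp (-(‖√(2 * t) • x‖ : ℂ) ^ 2 / 2) =
          (Real.exp (-(t * ‖x‖ ^ 2)) : ℝ) := by
        rw [norm_smul, Real.norm_of_nonneg (Real.sqrt_nonneg _)]
        have : (((√(2 * t) * ‖x‖ : ℝ) : ℂ)) ^ 2 = ((2 * t * ‖x‖ ^ 2 : ℝ) : ℂ) := by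
          rw [← Complex.ofReal_pow, mul_pow, Real.sq_sqrt ht']
        rw [this]
        push_cast
        congr 1
        ring
      rw [e1, Complex.real_smul, ← Complex.ofReal_mul]
      congr 1
      rw [show -((1 + ‖x‖ ^ 2) * t) = -t + -(t * ‖x‖ ^ 2) by ring, Real.exp_add]
      ring
    rw [setIntegral_congr_fun measurableSet_Ioi h3, integral_complex_ofReal, integral_const_mul,
      Real.integral_rpow_mul_exp_neg_mul_Ioi hb2 (by positivity), bracket_rpow_neg]
    congr 1
    field_simp [(Real.Gamma_pos_of_pos hb2).ne']

/-! ### Convolution with a probability measure on the Fourier side -/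

/-- Young's inequality `‖(ρν) ∗ φ‖_{L²} ≤ ‖ρ‖_{L²(ν)} ‖φ‖_{L²}` for a probability measure `ν`. -/
lemma lintegral_sq_conv_le {d : ℕ} (ν : Measure (Space d)) [IsProbabilityMeasure ν]
    {ρ φ : Space d → ℝ≥0∞} (hρ : Measurable ρ) (hφ : Measurable φ) :
    ∫⁻ η, (∫⁻ z, ρ z * φ (η - z) ∂ν) ^ 2 ≤ (∫⁻ z, ρ z ^ 2 ∂ν) * ∫⁻ ξ, φ ξ ^ 2 := by
  have h1 : ∀ η, (∫⁻ z, ρ z * φ (η - z) ∂ν) ^ 2 ≤ ∫⁻ z, ρ z ^ 2 * φ (η - z) ^ 2 ∂ν := fun η => by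
    have hm : Measurable fun z => ρ z * φ (η - z) := by fun_prop
    have h := ENNReal.lintegral_mul_le_Lp_mul_Lq ν (p := 2) (q := 2)
      ⟨by norm_num, by norm_num, by norm_num⟩ hm.aemeasurable (g := fun _ => 1) aemeasurable_const
    simp only [Pi.mul_apply, mul_one, ENNReal.rpow_ofNat, one_pow, lintegral_const, measure_univ,
      ENNReal.one_rpow] at h
    calc (∫⁻ z, ρ z * φ (η - z) ∂ν) ^ 2
        ≤ ((∫⁻ z, (ρ z * φ (η - z)) ^ 2 ∂ν) ^ (1 / 2 : ℝ)) ^ 2 := by gcongr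
      _ = ∫⁻ z, (ρ z * φ (η - z)) ^ 2 ∂ν := by
          rw [← ENNReal.rpow_natCast, ← ENNReal.rpow_mul]; norm_num
      _ = _ := by simp_rw [mul_pow]
  calc ∫⁻ η, (∫⁻ z, ρ z * φ (η - z) ∂ν) ^ 2
      ≤ ∫⁻ η, ∫⁻ z, ρ z ^ 2 * φ (η - z) ^ 2 ∂ν := lintegral_mono h1
    _ = ∫⁻ z, (∫⁻ η, ρ z ^ 2 * φ (η - z) ^ 2) ∂ν := by
        rw [lintegral_lintegral_swap]
        exact Measurable.aemeasurable (by fun_prop)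
    _ = ∫⁻ z, ρ z ^ 2 * (∫⁻ ξ, φ ξ ^ 2) ∂ν := by
        refine lintegral_congr fun z => ?_
        rw [lintegral_const_mul _ (by fun_prop),
          lintegral_sub_right_eq_self (fun ξ => φ ξ ^ 2) z]
    _ = _ := lintegral_mul_const _ (by fun_prop)

/-- The convolution `ν ∗ g` of a measure and a function. -/
noncomputable def measureConv {d : ℕ} (ν : Measure (Space d)) (g : Space d → ℂ) (η : Space d) : ℂ :=
  ∫ z, g (η - z) ∂ν

lemma integrable_prod_comp_sub {d : ℕ} (ν : Measure (Space d)) [IsProbabilityMeasure ν]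
    {g : Space d → ℂ} (hg : Measurable g) (hi : Integrable g) :
    Integrable (fun p : Space d × Space d => g (p.1 - p.2)) ((volume : Measure (Space d)).prod ν) := by
  rw [integrable_prod_iff' (Measurable.aestronglyMeasurable (by fun_prop))]
  refine ⟨Filter.Eventually.of_forall fun z => hi.comp_sub_right z, ?_⟩
  have : ∀ z : Space d, ∫ x, ‖g (x - z)‖ = ∫ x, ‖g x‖ := fun z =>
    integral_sub_right_eq_self (fun x => ‖g x‖) z
  simp_rw [this]
  exact integrable_const _

lemma integrable_measureConv {d : ℕ} (ν : Measure (Space d)) [IsProbabilityMeasure ν]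
    {g : Space d → ℂ} (hg : Measurable g) (hi : Integrable g) : Integrable (measureConv ν g) :=
  (integrable_prod_comp_sub ν hg hi).integral_prod_left

lemma lintegral_sq_measureConv_le {d : ℕ} (ν : Measure (Space d)) [IsProbabilityMeasure ν]
    {g : Space d → ℂ} (hg : Measurable g) :
    ∫⁻ η, ‖measureConv ν g η‖ₑ ^ 2 ≤ ∫⁻ ξ, ‖g ξ‖ₑ ^ 2 := by
  have h := lintegral_sq_conv_le ν (ρ := fun _ => 1) (φ := fun ξ => ‖g ξ‖ₑ) (by fun_prop)
    (by fun_prop)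
  simp only [one_mul, one_pow, lintegral_const, measure_univ] at h
  refine (lintegral_mono fun η => ?_).trans h
  gcongr
  exact enorm_integral_le_lintegral_enorm _

lemma eLpNorm_two_sq_enorm {α : Type*} [MeasurableSpace α] (μ : Measure α) (f : α → ℂ) :
    eLpNorm f 2 μ ^ 2 = ∫⁻ x, ‖f x‖ₑ ^ 2 ∂μ := by
  rw [eLpNorm_two_sq]
  refine lintegral_congr fun x => ?_
  rw [ENNReal.ofReal_pow (norm_nonneg _), ofReal_norm]

lemma memLp_measureConv {d : ℕ} (ν : Measure (Space d)) [IsProbabilityMeasure ν]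
    {g : Space d → ℂ} (hg : Measurable g) (hi : Integrable g) (h2 : MemLp g 2) :
    MemLp (measureConv ν g) 2 := by
  refine ⟨(integrable_measureConv ν hg hi).aestronglyMeasurable, ?_⟩
  have h : eLpNorm (measureConv ν g) 2 volume ^ 2 ≤ eLpNorm g 2 volume ^ 2 := by
    rw [eLpNorm_two_sq_enorm, eLpNorm_two_sq_enorm]
    exact lintegral_sq_measureConv_le ν hg
  exact ((ENNReal.pow_right_strictMono two_ne_zero).le_iff_le.1 h).trans_lt h2.2

/-- The inverse Fourier transform of `ν ∗ g` is the product of the Fourier transform of `ν` with the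
inverse Fourier transform of `g`. -/
lemma fourierInv_measureConv {d : ℕ} (ν : Measure (Space d)) [IsProbabilityMeasure ν]
    {g : Space d → ℂ} (hg : Measurable g) (hi : Integrable g) (x : Space d) :
    𝓕⁻ (measureConv ν g) x = (∫ z, (Real.fourierChar (inner ℝ z x) : ℂ) ∂ν) * 𝓕⁻ g x := by
  have e1 : 𝓕⁻ (measureConv ν g) x =
      ∫ η, ∫ z, (Real.fourierChar (inner ℝ η x) : ℂ) * g (η - z) ∂ν := by
    rw [Real.fourierInv_eq]
    refine integral_congr_ae (Filter.Eventually.of_forall fun η => ?_)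
    simp only [measureConv, Circle.smul_def, smul_eq_mul]
    rw [integral_const_mul]
  have hint : Integrable (Function.uncurry fun (η z : Space d) =>
      (Real.fourierChar (inner ℝ η x) : ℂ) * g (η - z)) ((volume : Measure (Space d)).prod ν) := by
    refine (integrable_prod_comp_sub ν hg hi).bdd_mul (c := 1)
      (Continuous.aestronglyMeasurable (by fun_prop)) (Filter.Eventually.of_forall fun p =>
        (Circle.norm_coe _).le)
  rw [e1, integral_integral_swap hint, ← integral_mul_const]
  refine integral_congr_ae (Filter.Eventually.of_forall fun z => ?_)
  beta_reduce
  rw [Real.fourierInv_eq, ← integral_const_mul, ← integral_sub_right_eq_self (fun a =>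
    (Real.fourierChar (inner ℝ z x) : ℂ) * Real.fourierChar (inner ℝ a x) • g a) z]
  refine integral_congr_ae (Filter.Eventually.of_forall fun η => ?_)
  have key : (Real.fourierChar (inner ℝ η x) : ℂ) =
      Real.fourierChar (inner ℝ z x) * Real.fourierChar (inner ℝ (η - z) x) := by
    rw [← Circle.coe_mul, ← AddChar.map_add_eq_mul, ← inner_add_left, add_sub_cancel]
  change (Real.fourierChar (inner ℝ η x) : ℂ) * g (η - z) = Real.fourierChar (inner ℝ z x) *
    (Real.fourierChar (inner ℝ (η - z) x) * g (η - z))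
  rw [key, mul_assoc]

/-- Multiplication by the weight `⟨x⟩^{-b}`, the Fourier transform of `ν`, is convolution with `ν` on
the Fourier side; the norms agree by Plancherel's theorem. -/
lemma eLpNorm_bracket_mul_fourierInv {d : ℕ} {b : ℝ} {ν : Measure (Space d)}
    [IsProbabilityMeasure ν]
    (hν : ∀ x : Space d, ∫ z, (Real.fourierChar (inner ℝ z x) : ℂ) ∂ν = (bracket x ^ (-b) : ℝ))
    {g : Space d → ℂ} (hg : Measurable g) (hi : Integrable g) (h2 : MemLp g 2) :
    eLpNorm (fun x => ((bracket x ^ (-b) : ℝ) : ℂ) * 𝓕⁻ g x) 2 volume =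
      eLpNorm (measureConv ν g) 2 volume := by
  rw [← eLpNorm_fourierInv (integrable_measureConv ν hg hi) (memLp_measureConv ν hg hi h2)]
  congr 1
  ext x
  rw [fourierInv_measureConv ν hg hi, hν]

/-! ### Elementary inequalities for powers -/

/-- The difference of two `s`-th powers is one order smaller than the powers themselves; the factor
`(1 + ζ)^s` absorbs the case in which the distance `ζ` of the bases is not small. -/
lemma abs_rpow_sub_rpow_le {s a b ζ : ℝ} (hs : 0 < s) (ha : 0 ≤ a) (hb : 0 ≤ b)
    (hζ : |b - a| ≤ ζ) :
    |b ^ s - a ^ s| ≤ max 1 s * (1 + ζ) ^ s * (1 + a) ^ max (s - 1) 0 := by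
  have hζ0 : 0 ≤ ζ := (abs_nonneg _).trans hζ
  rcases le_total s 1 with hs1 | hs1
  · rw [max_eq_left hs1, max_eq_right (by linarith), Real.rpow_zero, mul_one, one_mul]
    have key : ∀ u v : ℝ, 0 ≤ u → u ≤ v → v - u ≤ ζ → |v ^ s - u ^ s| ≤ (1 + ζ) ^ s := by
      intro u v hu huv h
      have h1 : u ^ s ≤ v ^ s := Real.rpow_le_rpow hu huv hs.le
      have h2 : v ^ s ≤ u ^ s + (v - u) ^ s := by
        have := Real.rpow_add_le_add_rpow hu (sub_nonneg.2 huv) hs.le hs1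
        rwa [add_sub_cancel] at this
      have h3 : (v - u) ^ s ≤ (1 + ζ) ^ s :=
        Real.rpow_le_rpow (sub_nonneg.2 huv) (by linarith) hs.le
      rw [abs_of_nonneg (sub_nonneg.2 h1)]
      linarith
    rcases le_total a b with hab | hab
    · exact key a b ha hab ((le_abs_self _).trans hζ)
    · rw [abs_sub_comm]
      exact key b a hb hab (by rw [abs_sub_comm] at hζ; exact (le_abs_self _).trans hζ)
  · rw [max_eq_right hs1, max_eq_left (by linarith)]
    have key : ∀ u v : ℝ, 0 ≤ u → u ≤ v → |v ^ s - u ^ s| ≤ s * v ^ (s - 1) * (v - u) := by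
      intro u v hu huv
      have h1 : u ^ s ≤ v ^ s := Real.rpow_le_rpow hu huv hs.le
      rw [abs_of_nonneg (sub_nonneg.2 h1)]
      rcases eq_or_lt_of_le (hu.trans huv) with hv | hv
      · have hu0 : u = 0 := le_antisymm (huv.trans hv.symm.le) hu
        rw [← hv, hu0]
        simp
      · have hvs : 0 < v ^ s := Real.rpow_pos_of_pos hv s
        have h2 := one_add_mul_self_le_rpow_one_add (s := u / v - 1) (p := s)
          (by have := div_nonneg hu hv.le; linarith) hs1
        rw [add_sub_cancel, Real.div_rpow hu hv.le, le_div_iff₀ hvs] at h2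
        have h3 : v ^ (s - 1) * v = v ^ s := by
          rw [← Real.rpow_add_one hv.ne']; ring_nf
        have h4 : (1 + s * (u / v - 1)) * v ^ s = v ^ s - s * v ^ (s - 1) * (v - u) := by
          rw [← h3]; field_simp; ring
        linarith
    have hfin : ∀ v : ℝ, 0 ≤ v → v ≤ a + ζ →
        s * v ^ (s - 1) * ζ ≤ s * (1 + ζ) ^ s * (1 + a) ^ (s - 1) := by
      intro v hv hva
      have h1 : v ^ (s - 1) ≤ ((1 + ζ) * (1 + a)) ^ (s - 1) :=
        Real.rpow_le_rpow hv (by nlinarith [mul_nonneg hζ0 ha]) (by linarith)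
      rw [Real.mul_rpow (by linarith) (by linarith)] at h1
      have h2 : (1 + ζ) ^ s = (1 + ζ) ^ (s - 1) * (1 + ζ) := by
        rw [← Real.rpow_add_one (by linarith)]; ring_nf
      rw [h2]
      have h3 : 0 ≤ (1 + ζ) ^ (s - 1) := Real.rpow_nonneg (by linarith) _
      have h4 : 0 ≤ (1 + a) ^ (s - 1) := Real.rpow_nonneg (by linarith) _
      calc s * v ^ (s - 1) * ζ ≤ s * ((1 + ζ) ^ (s - 1) * (1 + a) ^ (s - 1)) * (1 + ζ) :=
            mul_le_mul (mul_le_mul_of_nonneg_left h1 hs.le) (by linarith) hζ0 (by positivity)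
        _ = _ := by ring
    rcases le_total a b with hab | hab
    · have hb' : b - a ≤ ζ := (le_abs_self _).trans hζ
      refine (key a b ha hab).trans ((mul_le_mul_of_nonneg_left hb' ?_).trans (hfin b hb (by linarith)))
      exact mul_nonneg hs.le (Real.rpow_nonneg hb _)
    · have hb' : a - b ≤ ζ := by rw [abs_sub_comm] at hζ; exact (le_abs_self _).trans hζ
      rw [abs_sub_comm]
      refine (key b a hb hab).trans ((mul_le_mul_of_nonneg_left hb' ?_).trans (hfin a ha (by linarith)))
      exact mul_nonneg hs.le (Real.rpow_nonneg ha _)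

/-- Splitting at `r² = Λ`: below the threshold `r^{2s} ≤ Λ^s`, above it a higher power takes over. -/
lemma rpow_two_mul_le_add {r Λ s : ℝ} {K : ℕ} (hr : 0 ≤ r) (hΛ : 0 < Λ) (hs : 0 ≤ s) (hK : s ≤ K) :
    r ^ (2 * s) ≤ Λ ^ s + Λ ^ (s - K) * r ^ (2 * K) := by
  rw [Real.rpow_mul hr, pow_mul, Real.rpow_two]
  set q := r ^ 2 with hq
  have hq0 : 0 ≤ q := sq_nonneg r
  rcases le_total q Λ with h | h
  · have h1 := Real.rpow_le_rpow hq0 h hs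
    have : 0 ≤ Λ ^ (s - K) * q ^ K := by positivity
    linarith
  · have hqp : 0 < q := hΛ.trans_le h
    have h1 : q ^ (s - K) ≤ Λ ^ (s - K) := Real.rpow_le_rpow_of_nonpos hΛ h (by linarith)
    have h2 : q ^ s = q ^ (s - K) * q ^ K := by
      rw [← Real.rpow_natCast, ← Real.rpow_add hqp, sub_add_cancel]
    have h3 : q ^ (s - K) * q ^ K ≤ Λ ^ (s - K) * q ^ K := by gcongr
    have h4 : 0 ≤ Λ ^ s := by positivity
    linarith

/-! ### Fractional derivatives of eigenfunctions -/

/-- The eigenfunction `∑_{|α| = n} c_α h_α`. -/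
noncomputable def levelSum {d : ℕ} (n : ℕ) (c : (Fin d → ℕ) → ℂ) (x : Space d) : ℂ :=
  ∑ α ∈ level d n, c α * hermiteFun α x

/-- The function `√(-Δ)^s h_α`, as the inverse Fourier integral of `|2πξ|^s` times the Fourier
transform of `h_α`. -/
noncomputable def fracHermite {d : ℕ} (s : ℝ) (α : Fin d → ℕ) : Space d → ℂ :=
  𝓕⁻ fun ξ => (((2 * Real.pi * ‖ξ‖) ^ s : ℝ) : ℂ) * 𝓕 (fun x => (hermiteFun α x : ℂ)) ξ

lemma continuous_hermiteFun_ofReal {d : ℕ} (α : Fin d → ℕ) :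
    Continuous fun x : Space d => (hermiteFun α x : ℂ) :=
  Complex.continuous_ofReal.comp (continuous_hermiteFun α)

lemma continuous_levelSum {d : ℕ} (n : ℕ) (c : (Fin d → ℕ) → ℂ) : Continuous (levelSum n c) :=
  continuous_finsetSum _ fun α _ => continuous_const.mul (continuous_hermiteFun_ofReal α)

lemma fourier_hermiteFun_bound {d : ℕ} (α : Fin d → ℕ) (s : ℝ) : ∃ C : ℝ, ∀ ξ : Space d,
    ‖(((2 * Real.pi * ‖ξ‖) ^ s : ℝ) : ℂ) * 𝓕 (fun x => (hermiteFun α x : ℂ)) ξ‖ ≤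
      C * (‖ξ‖ ^ s * Real.exp (-Real.pi ^ 2 * ‖ξ‖ ^ 2)) := by
  obtain ⟨C, hC0, hC⟩ := hermiteFun_bound α
  refine ⟨(2 * Real.pi) ^ s * ‖(√(2 * Real.pi) : ℂ) ^ d * (-Complex.I) ^ (∑ i, α i)‖ * C,
    fun ξ => ?_⟩
  have h2 := hC ((2 * Real.pi) • ξ)
  have e : Real.exp (-(1 / 4) * ‖(2 * Real.pi) • ξ‖ ^ 2) =
      Real.exp (-Real.pi ^ 2 * ‖ξ‖ ^ 2) := by
    rw [norm_smul, Real.norm_of_nonneg (by positivity)]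
    ring_nf
  rw [e] at h2
  rw [fourier_hermiteFun, norm_mul, norm_mul, Complex.norm_real, Complex.norm_real,
    Real.norm_of_nonneg (by positivity), Real.mul_rpow (by positivity) (norm_nonneg _),
    Real.norm_eq_abs]
  calc _ ≤ (2 * Real.pi) ^ s * ‖ξ‖ ^ s * (‖(√(2 * Real.pi) : ℂ) ^ d *
        (-Complex.I) ^ (∑ i, α i)‖ * (C * Real.exp (-Real.pi ^ 2 * ‖ξ‖ ^ 2))) := by gcongr
    _ = _ := by ring

lemma measurable_rpow_mul_fourier {d : ℕ} {f : Space d → ℂ} (hf : Integrable f) (s : ℝ) :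
    Measurable fun ξ : Space d => (((2 * Real.pi * ‖ξ‖) ^ s : ℝ) : ℂ) * 𝓕 f ξ := by
  have := (continuous_fourier hf).measurable
  fun_prop

lemma lintegral_comp_two_pi_smul {d : ℕ} (G : Space d → ℝ≥0∞) (hG : Measurable G) :
    ENNReal.ofReal ((2 * Real.pi) ^ d) * ∫⁻ ξ, G ((2 * Real.pi) • ξ) = ∫⁻ x, G x := by
  have hr : (2 * Real.pi : ℝ) ≠ 0 := by positivity
  have h1 : ∫⁻ ξ, G ((2 * Real.pi) • ξ) =
      ∫⁻ x, G x ∂(Measure.map ((2 * Real.pi) • · : Space d → Space d) volume) :=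
    (lintegral_map hG (measurable_const_smul _)).symm
  rw [h1, Measure.map_addHaar_smul volume hr, lintegral_smul_measure, smul_eq_mul, ← mul_assoc,
    ← ENNReal.ofReal_mul (by positivity), abs_of_nonneg (by positivity)]
  simp [hr]

section Decay

variable {d : ℕ} [NeZero d]

lemma integrable_of_norm_rpow_gauss_bound {f : Space d → ℂ} (hf : AEStronglyMeasurable f)
    {s b C : ℝ} (hs : -(d : ℝ) < s) (hb : 0 < b)
    (h : ∀ x, ‖f x‖ ≤ C * (‖x‖ ^ s * Real.exp (-b * ‖x‖ ^ 2))) : Integrable f :=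
  ((integrable_norm_rpow_mul_gauss (E := Space d) (by simpa using hs) hb).const_mul C).mono' hf
    (Filter.Eventually.of_forall h)

lemma memLp_two_of_norm_rpow_gauss_bound {f : Space d → ℂ} (hf : AEStronglyMeasurable f)
    {s b C : ℝ} (hs : -(d : ℝ) / 2 < s) (hb : 0 < b)
    (h : ∀ x, ‖f x‖ ≤ C * (‖x‖ ^ s * Real.exp (-b * ‖x‖ ^ 2))) : MemLp f 2 := by
  rw [memLp_two_iff_integrable_sq_norm hf]
  have hi := (integrable_norm_rpow_mul_gauss (E := Space d) (p := s * 2) (b := b * 2)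
    (by simp; linarith) (by positivity)).const_mul (C ^ 2)
  refine hi.mono' (hf.norm.pow 2) (Filter.Eventually.of_forall fun x => ?_)
  rw [Real.norm_of_nonneg (sq_nonneg _)]
  refine (pow_le_pow_left₀ (norm_nonneg _) (h x) 2).trans_eq ?_
  rw [mul_pow, mul_pow, Real.rpow_mul (norm_nonneg x), Real.rpow_two, ← Real.exp_nat_mul]
  congr 3
  push_cast
  ring

lemma integrable_hermiteFun (α : Fin d → ℕ) :
    Integrable fun x : Space d => (hermiteFun α x : ℂ) := by
  obtain ⟨C, hC0, hC⟩ := hermiteFun_bound α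
  refine integrable_of_norm_rpow_gauss_bound (s := 0)
    (continuous_hermiteFun_ofReal α).aestronglyMeasurable (b := 1 / 4) (C := C) ?_ (by norm_num)
    fun x => ?_
  · have : (0 : ℝ) < d := by exact_mod_cast Nat.pos_of_ne_zero (NeZero.ne d)
    linarith
  · simpa using hC x

lemma integrable_rpow_mul_fourier_hermiteFun (α : Fin d → ℕ) {s : ℝ} (hs : -(d : ℝ) / 2 < s) :
    Integrable fun ξ : Space d =>
      (((2 * Real.pi * ‖ξ‖) ^ s : ℝ) : ℂ) * 𝓕 (fun x => (hermiteFun α x : ℂ)) ξ := by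
  obtain ⟨C, hC⟩ := fourier_hermiteFun_bound α s
  have hd : (0 : ℝ) < d := by exact_mod_cast Nat.pos_of_ne_zero (NeZero.ne d)
  exact integrable_of_norm_rpow_gauss_bound
    (measurable_rpow_mul_fourier (integrable_hermiteFun α) s).aestronglyMeasurable
    (by linarith) (by positivity) hC

lemma memLp_rpow_mul_fourier_hermiteFun (α : Fin d → ℕ) {s : ℝ} (hs : -(d : ℝ) / 2 < s) :
    MemLp (fun ξ : Space d =>
      (((2 * Real.pi * ‖ξ‖) ^ s : ℝ) : ℂ) * 𝓕 (fun x => (hermiteFun α x : ℂ)) ξ) 2 := by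
  obtain ⟨C, hC⟩ := fourier_hermiteFun_bound α s
  exact memLp_two_of_norm_rpow_gauss_bound
    (measurable_rpow_mul_fourier (integrable_hermiteFun α) s).aestronglyMeasurable
    hs (by positivity) hC

lemma integrable_levelSum (n : ℕ) (c : (Fin d → ℕ) → ℂ) : Integrable (levelSum n c) :=
  integrable_finsetSum _ fun α _ => (integrable_hermiteFun α).const_mul _

lemma fourier_levelSum_eq_sum (n : ℕ) (c : (Fin d → ℕ) → ℂ) (ξ : Space d) :
    𝓕 (levelSum n c) ξ = ∑ α ∈ level d n, c α * 𝓕 (fun x => (hermiteFun α x : ℂ)) ξ := by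
  simp only [Real.fourier_eq, levelSum, Finset.smul_sum]
  rw [integral_finsetSum]
  · refine Finset.sum_congr rfl fun α _ => ?_
    rw [← integral_const_mul]
    refine integral_congr_ae (Filter.Eventually.of_forall fun x => ?_)
    simp only [Circle.smul_def, smul_eq_mul]
    ring
  · intro α _
    exact (Real.fourierIntegral_convergent_iff ξ).2 ((integrable_hermiteFun α).const_mul _)

lemma fourier_levelSum (n : ℕ) (c : (Fin d → ℕ) → ℂ) (ξ : Space d) :
    𝓕 (levelSum n c) ξ =
      (√(2 * Real.pi) : ℂ) ^ d * (-Complex.I) ^ n * levelSum n c ((2 * Real.pi) • ξ) := by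
  rw [fourier_levelSum_eq_sum, levelSum, Finset.mul_sum]
  refine Finset.sum_congr rfl fun α hα => ?_
  rw [fourier_hermiteFun, mem_level.1 hα]
  ring

lemma rpow_mul_fourier_levelSum (n : ℕ) (c : (Fin d → ℕ) → ℂ) (s : ℝ) :
    (fun ξ : Space d => (((2 * Real.pi * ‖ξ‖) ^ s : ℝ) : ℂ) * 𝓕 (levelSum n c) ξ) =
    fun ξ => ∑ α ∈ level d n, c α *
      ((((2 * Real.pi * ‖ξ‖) ^ s : ℝ) : ℂ) * 𝓕 (fun x => (hermiteFun α x : ℂ)) ξ) := by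
  ext ξ
  rw [fourier_levelSum_eq_sum, Finset.mul_sum]
  exact Finset.sum_congr rfl fun α _ => by ring

lemma integrable_rpow_mul_fourier_levelSum (n : ℕ) (c : (Fin d → ℕ) → ℂ) {s : ℝ}
    (hs : -(d : ℝ) / 2 < s) :
    Integrable fun ξ : Space d => (((2 * Real.pi * ‖ξ‖) ^ s : ℝ) : ℂ) * 𝓕 (levelSum n c) ξ := by
  rw [rpow_mul_fourier_levelSum]
  exact integrable_finsetSum _ fun α _ => (integrable_rpow_mul_fourier_hermiteFun α hs).const_mul _

lemma memLp_rpow_mul_fourier_levelSum (n : ℕ) (c : (Fin d → ℕ) → ℂ) {s : ℝ}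
    (hs : -(d : ℝ) / 2 < s) :
    MemLp (fun ξ : Space d => (((2 * Real.pi * ‖ξ‖) ^ s : ℝ) : ℂ) * 𝓕 (levelSum n c) ξ) 2 := by
  rw [rpow_mul_fourier_levelSum]
  exact memLp_finsetSum _ fun α _ => (memLp_rpow_mul_fourier_hermiteFun α hs).const_mul _

lemma integrable_fourier_levelSum (n : ℕ) (c : (Fin d → ℕ) → ℂ) :
    Integrable (𝓕 (levelSum (d := d) n c)) := by
  have hd : (0 : ℝ) < d := by exact_mod_cast Nat.pos_of_ne_zero (NeZero.ne d)
  simpa using integrable_rpow_mul_fourier_levelSum (d := d) n c (s := 0) (by linarith)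

lemma memLp_fourier_levelSum (n : ℕ) (c : (Fin d → ℕ) → ℂ) :
    MemLp (𝓕 (levelSum (d := d) n c)) 2 := by
  have hd : (0 : ℝ) < d := by exact_mod_cast Nat.pos_of_ne_zero (NeZero.ne d)
  simpa using memLp_rpow_mul_fourier_levelSum (d := d) n c (s := 0) (by linarith)

lemma fourierInv_fourier_levelSum (n : ℕ) (c : (Fin d → ℕ) → ℂ) :
    𝓕⁻ (𝓕 (levelSum (d := d) n c)) = levelSum n c :=
  (continuous_levelSum n c).fourierInv_fourier_eq (integrable_levelSum n c)
    (integrable_fourier_levelSum n c)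

lemma sum_mul_fracHermite (n : ℕ) (c : (Fin d → ℕ) → ℂ) {s : ℝ} (hs : -(d : ℝ) / 2 < s)
    (x : Space d) : ∑ α ∈ level d n, c α * fracHermite s α x =
      𝓕⁻ (fun ξ : Space d => (((2 * Real.pi * ‖ξ‖) ^ s : ℝ) : ℂ) * 𝓕 (levelSum n c) ξ) x := by
  rw [rpow_mul_fourier_levelSum]
  simp only [Real.fourierInv_eq_fourier_neg, fracHermite]
  rw [Real.fourier_eq]
  simp only [Finset.smul_sum]
  rw [integral_finsetSum]
  · refine Finset.sum_congr rfl fun α _ => ?_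
    rw [Real.fourier_eq, ← integral_const_mul]
    refine integral_congr_ae (Filter.Eventually.of_forall fun x => ?_)
    simp only [Circle.smul_def, smul_eq_mul]
    ring
  · intro α _
    exact (Real.fourierIntegral_convergent_iff _).2
      ((integrable_rpow_mul_fourier_hermiteFun α hs).const_mul _)

/-- The Fourier transform maps an eigenfunction to a multiple of its dilate, so that weighted norms
agree on both sides. -/
lemma lintegral_weight_mul_fourier_levelSum (n : ℕ) (c : (Fin d → ℕ) → ℂ) {w : ℝ → ℝ}
    (hw : Measurable w) :
    ∫⁻ ξ : Space d, ENNReal.ofReal (w (2 * Real.pi * ‖ξ‖) * ‖𝓕 (levelSum n c) ξ‖ ^ 2) =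
      ∫⁻ x : Space d, ENNReal.ofReal (w ‖x‖ * ‖levelSum n c x‖ ^ 2) := by
  have hm := (continuous_levelSum (d := d) n c).measurable
  have hk : ‖(√(2 * Real.pi) : ℂ) ^ d * (-Complex.I) ^ n‖ ^ 2 = (2 * Real.pi) ^ d := by
    rw [norm_mul, norm_pow, norm_pow, norm_neg, Complex.norm_I, one_pow, mul_one,
      Complex.norm_real, Real.norm_of_nonneg (Real.sqrt_nonneg _), ← pow_mul, mul_comm d 2, pow_mul,
      Real.sq_sqrt (by positivity)]
  rw [← lintegral_comp_two_pi_smul (fun x => ENNReal.ofReal (w ‖x‖ * ‖levelSum n c x‖ ^ 2))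
    (by fun_prop), ← lintegral_const_mul _ (by fun_prop)]
  refine lintegral_congr fun ξ => ?_
  rw [fourier_levelSum, norm_mul, mul_pow, hk, ← ENNReal.ofReal_mul (by positivity), norm_smul,
    Real.norm_of_nonneg (by positivity)]
  congr 1
  ring

lemma lintegral_sq_norm_levelSum (n : ℕ) (c : (Fin d → ℕ) → ℂ) :
    ∫⁻ x : Space d, ENNReal.ofReal (‖levelSum n c x‖ ^ 2) =
      ENNReal.ofReal (∑ α ∈ level d n, ‖c α‖ ^ 2) :=
  lintegral_sq_norm_level_sum c

/-- Moments of real order on the Fourier side: `‖(1 + |D|)^q f‖² ≲ λ^q ‖f‖²` for eigenfunctions. -/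
lemma lintegral_rpow_mul_fourier_levelSum_le (d : ℕ) [NeZero d] {q : ℝ} (hq : 0 ≤ q) :
    ∃ C : ℝ, 0 < C ∧ ∀ (n : ℕ) (c : (Fin d → ℕ) → ℂ),
      ∫⁻ ξ : Space d, ENNReal.ofReal
        ((1 + 2 * Real.pi * ‖ξ‖) ^ (2 * q) * ‖𝓕 (levelSum n c) ξ‖ ^ 2) ≤
      ENNReal.ofReal (C * (2 * n + d : ℝ) ^ q * ∑ α ∈ level d n, ‖c α‖ ^ 2) := by
  obtain ⟨K, hK⟩ := exists_nat_ge q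
  obtain ⟨C, hC0, hC⟩ := lintegral_norm_pow_mul_level_sum_le d K
  refine ⟨2 ^ (2 * q) * (2 + C), by positivity, fun n c => ?_⟩
  have hlam := one_le_two_mul_add d n
  set lam : ℝ := 2 * n + d with hlamdef
  have hlam0 : 0 < lam := by linarith
  set S := ∑ α ∈ level d n, ‖c α‖ ^ 2 with hS
  have hS0 : 0 ≤ S := Finset.sum_nonneg fun _ _ => by positivity
  have hm := (continuous_levelSum (d := d) n c).measurable
  have hpt : ∀ r : ℝ, 0 ≤ r →
      (1 + r) ^ (2 * q) ≤ 2 ^ (2 * q) * (2 * lam ^ q + lam ^ (q - K) * r ^ (2 * K)) := by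
    intro r hr
    have h1 : (1 + r) ^ (2 * q) ≤ (2 * max 1 r) ^ (2 * q) :=
      Real.rpow_le_rpow (by positivity)
        (by linarith [le_max_left 1 r, le_max_right 1 r]) (by positivity)
    rw [Real.mul_rpow (by norm_num) (by positivity)] at h1
    refine h1.trans (mul_le_mul_of_nonneg_left ?_ (by positivity))
    have h2 : 1 ≤ lam ^ q := Real.one_le_rpow hlam hq
    have h3 := rpow_two_mul_le_add hr hlam0 hq hK
    have h4 : 0 ≤ lam ^ (q - K) * r ^ (2 * K) := by positivity
    rcases le_total 1 r with h | h
    · rw [max_eq_right h]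
      linarith
    · rw [max_eq_left h, Real.one_rpow]
      linarith
  rw [lintegral_weight_mul_fourier_levelSum (w := fun r => (1 + r) ^ (2 * q)) n c (by fun_prop)]
  calc ∫⁻ x : Space d, ENNReal.ofReal ((1 + ‖x‖) ^ (2 * q) * ‖levelSum n c x‖ ^ 2)
      ≤ ∫⁻ x : Space d, (ENNReal.ofReal (2 ^ (2 * q) * (2 * lam ^ q)) *
            ENNReal.ofReal (‖levelSum n c x‖ ^ 2) +
          ENNReal.ofReal (2 ^ (2 * q) * lam ^ (q - K)) *
            ENNReal.ofReal (‖x‖ ^ (2 * K) * ‖levelSum n c x‖ ^ 2)) := by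
        refine lintegral_mono fun x => ?_
        rw [← ENNReal.ofReal_mul (by positivity), ← ENNReal.ofReal_mul (by positivity),
          ← ENNReal.ofReal_add (by positivity) (by positivity)]
        refine ENNReal.ofReal_le_ofReal ?_
        refine (mul_le_mul_of_nonneg_right (hpt ‖x‖ (norm_nonneg x)) (sq_nonneg _)).trans_eq ?_
        ring
    _ ≤ ENNReal.ofReal (2 ^ (2 * q) * (2 * lam ^ q)) * ENNReal.ofReal S +
          ENNReal.ofReal (2 ^ (2 * q) * lam ^ (q - K)) * ENNReal.ofReal (C * lam ^ K * S) := by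
        rw [lintegral_add_left (by fun_prop), lintegral_const_mul _ (by fun_prop),
          lintegral_const_mul _ (by fun_prop), lintegral_sq_norm_levelSum]
        gcongr
        exact hC n c
    _ = _ := by
        rw [← ENNReal.ofReal_mul (by positivity), ← ENNReal.ofReal_mul (by positivity),
          ← ENNReal.ofReal_add (by positivity) (by positivity)]
        have e : lam ^ q = lam ^ (q - K) * lam ^ K := by
          rw [← Real.rpow_natCast, ← Real.rpow_add hlam0, sub_add_cancel]
        congr 1
        rw [e]
        ring

/-- The decay estimate `‖⟨x⟩^{-β} f‖² ≲ λ^{-β} ‖f‖²` for eigenfunctions, `0 ≤ β < 1/2`. -/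
lemma lintegral_bracket_mul_levelSum_le (d : ℕ) [NeZero d] {β : ℝ} (hβ0 : 0 ≤ β) (hβ : β < 1 / 2) :
    ∃ C : ℝ, 0 < C ∧ ∀ (n : ℕ) (c : (Fin d → ℕ) → ℂ),
      ∫⁻ x : Space d, ENNReal.ofReal (‖((bracket x ^ (-β) : ℝ) : ℂ) * levelSum n c x‖ ^ 2) ≤
      ENNReal.ofReal (C * (2 * n + d : ℝ) ^ (-β) * ∑ α ∈ level d n, ‖c α‖ ^ 2) := by
  obtain ⟨C, hC0, hC⟩ := lintegral_norm_rpow_mul_level_sum_le d (p := -(2 * β))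
    (by linarith) (by linarith)
  refine ⟨C, hC0, fun n c => ?_⟩
  have h := hC n c
  rw [show -(2 * β) / 2 = -β by ring] at h
  refine le_trans (lintegral_mono_ae ?_) h
  filter_upwards [Measure.ae_ne volume (0 : Space d)] with x hx
  refine ENNReal.ofReal_le_ofReal ?_
  have hx0 : 0 < ‖x‖ := norm_pos_iff.2 hx
  rw [norm_mul, mul_pow, Complex.norm_real, Real.norm_of_nonneg
    (Real.rpow_nonneg (bracket_pos x).le _), ← Real.rpow_two, ← Real.rpow_mul (bracket_pos x).le,
    show -β * 2 = -(2 * β) by ring]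
  exact mul_le_mul_of_nonneg_right
    (Real.rpow_le_rpow_of_nonpos hx0 (norm_le_bracket x) (by linarith)) (sq_nonneg _)

end Decay

/-! ### The level estimate for fractional derivatives -/

lemma lintegral_one_add_rpow_lt_top {d : ℕ} {ν : Measure (Space d)} [IsProbabilityMeasure ν]
    (hν : ∀ N : ℕ, Integrable (fun z => ‖z‖ ^ N) ν) (m : ℝ) :
    ∫⁻ z, ENNReal.ofReal ((1 + 2 * Real.pi * ‖z‖) ^ m) ^ 2 ∂ν < ∞ := by
  obtain ⟨N, hN⟩ := exists_nat_ge m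
  have hi : Integrable (fun z : Space d => 2 ^ (2 * N) * (1 + (2 * Real.pi) ^ (2 * N) *
      ‖z‖ ^ (2 * N))) ν :=
    ((integrable_const 1).add ((hν (2 * N)).const_mul _)).const_mul _
  refine lt_of_le_of_lt (lintegral_mono fun z => ?_) hi.lintegral_lt_top
  have hz : 0 ≤ 2 * Real.pi * ‖z‖ := by positivity
  rw [← ENNReal.ofReal_pow (by positivity)]
  refine ENNReal.ofReal_le_ofReal ?_
  calc ((1 + 2 * Real.pi * ‖z‖) ^ m) ^ 2 ≤ ((1 + 2 * Real.pi * ‖z‖) ^ N) ^ 2 := by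
        gcongr
        rw [← Real.rpow_natCast]
        exact Real.rpow_le_rpow_of_exponent_le (by linarith) hN
    _ = (1 + 2 * Real.pi * ‖z‖) ^ (2 * N) := by rw [← pow_mul, mul_comm N 2]
    _ ≤ (2 * max 1 (2 * Real.pi * ‖z‖)) ^ (2 * N) := by
        gcongr
        linarith [le_max_left 1 (2 * Real.pi * ‖z‖), le_max_right 1 (2 * Real.pi * ‖z‖)]
    _ ≤ 2 ^ (2 * N) * (1 + (2 * Real.pi) ^ (2 * N) * ‖z‖ ^ (2 * N)) := by
        rw [mul_pow, ← mul_pow (2 * Real.pi)]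
        refine mul_le_mul_of_nonneg_left ?_ (by positivity)
        have : 0 ≤ (2 * Real.pi * ‖z‖) ^ (2 * N) := by positivity
        rcases le_total 1 (2 * Real.pi * ‖z‖) with h | h
        · rw [max_eq_right h]
          linarith
        · rw [max_eq_left h, one_pow]
          linarith

/-- The moment estimates on the Fourier side survive convolution with a measure all of whose moments
are finite. -/
lemma lintegral_sq_conv_fourier_levelSum_le {d : ℕ} [NeZero d] {ν : Measure (Space d)}
    [IsProbabilityMeasure ν] (hν : ∀ N : ℕ, Integrable (fun z => ‖z‖ ^ N) ν) (m : ℝ) {q : ℝ}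
    (hq : 0 ≤ q) : ∃ C : ℝ, 0 < C ∧ ∀ (n : ℕ) (c : (Fin d → ℕ) → ℂ),
      ∫⁻ η, (∫⁻ z, ENNReal.ofReal ((1 + 2 * Real.pi * ‖z‖) ^ m) *
        (ENNReal.ofReal ((1 + 2 * Real.pi * ‖η - z‖) ^ q) * ‖𝓕 (levelSum n c) (η - z)‖ₑ) ∂ν) ^ 2 ≤
      ENNReal.ofReal (C * (2 * n + d : ℝ) ^ q * ∑ α ∈ level d n, ‖c α‖ ^ 2) := by
  obtain ⟨C, hC0, hC⟩ := lintegral_rpow_mul_fourier_levelSum_le d hq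
  set M := ∫⁻ z, ENNReal.ofReal ((1 + 2 * Real.pi * ‖z‖) ^ m) ^ 2 ∂ν with hM
  have hMtop : M < ∞ := lintegral_one_add_rpow_lt_top hν m
  refine ⟨(M.toReal + 1) * C, by positivity, fun n c => ?_⟩
  have hm : Measurable (𝓕 (levelSum (d := d) n c)) :=
    (continuous_fourier (integrable_levelSum n c)).measurable
  have h := lintegral_sq_conv_le ν (ρ := fun z => ENNReal.ofReal ((1 + 2 * Real.pi * ‖z‖) ^ m))
    (φ := fun ξ => ENNReal.ofReal ((1 + 2 * Real.pi * ‖ξ‖) ^ q) * ‖𝓕 (levelSum n c) ξ‖ₑ)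
    (by fun_prop) (by fun_prop)
  refine h.trans ?_
  have e : ∫⁻ ξ : Space d, (ENNReal.ofReal ((1 + 2 * Real.pi * ‖ξ‖) ^ q) *
      ‖𝓕 (levelSum n c) ξ‖ₑ) ^ 2 = ∫⁻ ξ : Space d, ENNReal.ofReal
        ((1 + 2 * Real.pi * ‖ξ‖) ^ (2 * q) * ‖𝓕 (levelSum n c) ξ‖ ^ 2) := by
    refine lintegral_congr fun ξ => ?_
    have hz : 0 ≤ 1 + 2 * Real.pi * ‖ξ‖ := by positivity
    rw [← ofReal_norm, ← ENNReal.ofReal_mul (by positivity), ← ENNReal.ofReal_pow (by positivity),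
      mul_pow, mul_comm 2 q, Real.rpow_mul hz, Real.rpow_two]
  rw [e]
  have hM' : M ≤ ENNReal.ofReal (M.toReal + 1) := by
    rw [← ENNReal.ofReal_toReal hMtop.ne]
    exact ENNReal.ofReal_le_ofReal (by simp)
  refine (mul_le_mul' hM' (hC n c)).trans_eq ?_
  rw [← ENNReal.ofReal_mul (by positivity)]
  congr 1
  ring

/-- The commutator of convolution with `ν` and multiplication by `|2πξ|^s`, bounded pointwise. -/
lemma enorm_measureConv_rpow_mul_le {d : ℕ} (ν : Measure (Space d)) [IsProbabilityMeasure ν]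
    {f : Space d → ℂ} (hf : Integrable f) {s : ℝ} (hs : 0 < s) (η : Space d) :
    ‖measureConv ν (fun ξ => (((2 * Real.pi * ‖ξ‖) ^ s : ℝ) : ℂ) * 𝓕 f ξ) η‖ₑ ≤
      ENNReal.ofReal ((2 * Real.pi * ‖η‖) ^ s) * ‖measureConv ν (𝓕 f) η‖ₑ +
      ENNReal.ofReal (max 1 s) * ∫⁻ z, ENNReal.ofReal ((1 + 2 * Real.pi * ‖z‖) ^ s) *
        (ENNReal.ofReal ((1 + 2 * Real.pi * ‖η - z‖) ^ max (s - 1) 0) * ‖𝓕 f (η - z)‖ₑ) ∂ν := by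
  have hc := continuous_fourier hf
  have hi : Integrable (fun z => 𝓕 f (η - z)) ν := by
    refine Integrable.of_bound (C := ∫ x, ‖f x‖)
      (Continuous.aestronglyMeasurable (by fun_prop)) (Filter.Eventually.of_forall fun z => ?_)
    exact VectorFourier.norm_fourierIntegral_le_integral_norm _ _ _ _ _
  -- if the integrand is not integrable, the integral on the left is zero by convention
  by_cases h : Integrable (fun z => (((2 * Real.pi * ‖η - z‖) ^ s : ℝ) : ℂ) * 𝓕 f (η - z)) ν
  swap
  · rw [measureConv, integral_undef h]
    simp
  have e : measureConv ν (fun ξ => (((2 * Real.pi * ‖ξ‖) ^ s : ℝ) : ℂ) * 𝓕 f ξ) η =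
      (((2 * Real.pi * ‖η‖) ^ s : ℝ) : ℂ) * measureConv ν (𝓕 f) η -
      ∫ z, (((2 * Real.pi * ‖η‖) ^ s - (2 * Real.pi * ‖η - z‖) ^ s : ℝ) : ℂ) * 𝓕 f (η - z) ∂ν := by
    rw [measureConv, measureConv, ← integral_const_mul]
    have : ∀ z, (((2 * Real.pi * ‖η‖) ^ s - (2 * Real.pi * ‖η - z‖) ^ s : ℝ) : ℂ) * 𝓕 f (η - z) =
        (((2 * Real.pi * ‖η‖) ^ s : ℝ) : ℂ) * 𝓕 f (η - z) -
        (((2 * Real.pi * ‖η - z‖) ^ s : ℝ) : ℂ) * 𝓕 f (η - z) := fun z => by push_cast; ring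
    simp_rw [this]
    rw [integral_sub (hi.const_mul _) h, sub_sub_cancel]
  rw [e]
  refine enorm_sub_le.trans (add_le_add ?_ ?_)
  · rw [enorm_mul, ← ofReal_norm (((2 * Real.pi * ‖η‖) ^ s : ℝ) : ℂ), Complex.norm_real,
      Real.norm_of_nonneg (by positivity)]
  · refine (enorm_integral_le_lintegral_enorm _).trans ?_
    rw [← lintegral_const_mul' _ _ ENNReal.ofReal_ne_top]
    refine lintegral_mono fun z => ?_
    rw [enorm_mul, ← mul_assoc, ← mul_assoc]
    refine mul_le_mul_left ?_ _
    rw [← ofReal_norm (((2 * Real.pi * ‖η‖) ^ s - (2 * Real.pi * ‖η - z‖) ^ s : ℝ) : ℂ),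
      Complex.norm_real, Real.norm_eq_abs, ← ENNReal.ofReal_mul (by positivity),
      ← ENNReal.ofReal_mul (by positivity)]
    refine ENNReal.ofReal_le_ofReal (abs_rpow_sub_rpow_le hs (by positivity) (by positivity) ?_)
    rw [← mul_sub, abs_mul, abs_of_pos (by positivity)]
    refine mul_le_mul_of_nonneg_left ?_ (by positivity)
    simpa using abs_norm_sub_norm_le η (η - z)

/-- Powers of `|2πη|` are distributed over a convolution by `|η| ≤ |z| + |η - z|`. -/
lemma enorm_pow_mul_measureConv_le {d : ℕ} (ν : Measure (Space d)) (g : Space d → ℂ) (K : ℕ)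
    (η : Space d) :
    ENNReal.ofReal ((2 * Real.pi * ‖η‖) ^ K) * ‖measureConv ν g η‖ₑ ≤
      ∫⁻ z, ENNReal.ofReal ((1 + 2 * Real.pi * ‖z‖) ^ (K : ℝ)) *
        (ENNReal.ofReal ((1 + 2 * Real.pi * ‖η - z‖) ^ (K : ℝ)) * ‖g (η - z)‖ₑ) ∂ν := by
  refine (mul_le_mul_right (enorm_integral_le_lintegral_enorm _) _).trans ?_
  rw [← lintegral_const_mul' _ _ ENNReal.ofReal_ne_top]
  refine lintegral_mono fun z => ?_
  rw [← mul_assoc]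
  refine mul_le_mul_left ?_ _
  rw [← ENNReal.ofReal_mul (by positivity)]
  refine ENNReal.ofReal_le_ofReal ?_
  rw [Real.rpow_natCast, Real.rpow_natCast, ← mul_pow]
  refine pow_le_pow_left₀ (by positivity) ?_ K
  have h : ‖η‖ ≤ ‖z‖ + ‖η - z‖ := by simpa using norm_add_le z (η - z)
  have h2 : 0 ≤ 2 * Real.pi * ‖z‖ * (2 * Real.pi * ‖η - z‖) := by positivity
  have h3 := mul_le_mul_of_nonneg_left h (show 0 ≤ 2 * Real.pi by positivity)
  linarith

/-- The estimate `‖⟨x⟩^{-(1/2-ε)} √(-Δ)^{d/2-2ε} f‖² ≲ λ^{(d-1)/2} ‖f‖²` for eigenfunctions, when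
the order is positive. The weight acts on the Fourier side as convolution with a probability measure
with finite moments; its commutator with `|2πξ|^s` costs one derivative less, and frequencies
`|ξ|² ≤ λ^{1+ε/s}` carry all but a negligible part of `f`. -/
lemma lintegral_bracket_mul_fracHermite_le_of_pos (d : ℕ) [NeZero d] {ε : ℝ} (hε0 : 0 < ε)
    (hε : ε < 1 / 2) (hs : 0 < (d : ℝ) / 2 - 2 * ε) :
    ∃ C : ℝ, 0 < C ∧ ∀ (n : ℕ) (c : (Fin d → ℕ) → ℂ),
      ∫⁻ x : Space d, ENNReal.ofReal (‖((bracket x ^ (-(1 / 2 - ε)) : ℝ) : ℂ) *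
        ∑ α ∈ level d n, c α * fracHermite ((d : ℝ) / 2 - 2 * ε) α x‖ ^ 2) ≤
      ENNReal.ofReal (C * (2 * n + d : ℝ) ^ (((d : ℝ) - 1) / 2) *
        ∑ α ∈ level d n, ‖c α‖ ^ 2) := by
  have hd : (1 : ℝ) ≤ d := by exact_mod_cast Nat.pos_of_ne_zero (NeZero.ne d)
  set s : ℝ := (d : ℝ) / 2 - 2 * ε with hsdef
  set β : ℝ := 1 / 2 - ε with hβdef
  have hβ0 : 0 < β := by linarith
  have hs' : -(d : ℝ) / 2 < s := by linarith
  obtain ⟨ν, hνp, hνm, hν⟩ := exists_measure_fourier_eq_bracket d hβ0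
  -- `K` is so large that the factor `Λ^{s-K}` beats the moment bound `λ^K`
  obtain ⟨K, hK⟩ := exists_nat_ge (max s (s * (s + ε) / ε))
  have hKs : s ≤ K := (le_max_left _ _).trans hK
  have hKε : s * (s + ε) / ε ≤ K := (le_max_right _ _).trans hK
  obtain ⟨C1, hC10, hC1⟩ := lintegral_bracket_mul_levelSum_le d hβ0.le (by linarith : β < 1 / 2)
  obtain ⟨C2, hC20, hC2⟩ := lintegral_sq_conv_fourier_levelSum_le (d := d) hνm K
    (q := (K : ℝ)) (by positivity)
  obtain ⟨C3, hC30, hC3⟩ := lintegral_sq_conv_fourier_levelSum_le (d := d) hνm s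
    (q := max (s - 1) 0) (le_max_right _ _)
  refine ⟨2 * C1 + 2 * C2 + 2 * max 1 s ^ 2 * C3, by positivity, fun n c => ?_⟩
  have hlam := one_le_two_mul_add d n
  set lam : ℝ := 2 * n + d with hlamdef
  have hlam0 : 0 < lam := by linarith
  set S := ∑ α ∈ level d n, ‖c α‖ ^ 2 with hS
  have hS0 : 0 ≤ S := Finset.sum_nonneg fun _ _ => by positivity
  set σ : ℝ := ((d : ℝ) - 1) / 2 with hσ
  have hσ0 : 0 ≤ σ := by linarith
  -- the threshold for `|2πξ|²`, chosen so that `Λ^s λ^{-β} = λ^{s + ε - β} = λ^{(d-1)/2}`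
  set Λ : ℝ := lam ^ (1 + ε / s) with hΛ
  have hΛ0 : 0 < Λ := by positivity
  have hi := integrable_levelSum (d := d) n c
  have hfm : Measurable (𝓕 (levelSum (d := d) n c)) := (continuous_fourier hi).measurable
  set k : Space d → ℂ := measureConv ν (𝓕 (levelSum n c)) with hk
  have hkm : Measurable k := by
    have h := hfm
    have : StronglyMeasurable (fun p : Space d × Space d => 𝓕 (levelSum n c) (p.1 - p.2)) :=
      Measurable.stronglyMeasurable (by fun_prop)
    exact this.integral_prod_right.measurable
  set A : Space d → ℝ≥0∞ := fun η => ∫⁻ z, ENNReal.ofReal ((1 + 2 * Real.pi * ‖z‖) ^ s) *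
        (ENNReal.ofReal ((1 + 2 * Real.pi * ‖η - z‖) ^ max (s - 1) 0) *
          ‖𝓕 (levelSum n c) (η - z)‖ₑ) ∂ν with hA
  have hkint : ∫⁻ η, ‖k η‖ₑ ^ 2 ≤ ENNReal.ofReal (C1 * lam ^ (-β) * S) := by
    have h := eLpNorm_bracket_mul_fourierInv hν hfm (integrable_fourier_levelSum n c)
      (memLp_fourier_levelSum n c)
    rw [fourierInv_fourier_levelSum] at h
    rw [← eLpNorm_two_sq_enorm, hk, ← h, eLpNorm_two_sq]
    exact hC1 n c
  have hkK : ∫⁻ η, (ENNReal.ofReal ((2 * Real.pi * ‖η‖) ^ K) * ‖k η‖ₑ) ^ 2 ≤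
      ENNReal.ofReal (C2 * lam ^ (K : ℝ) * S) := by
    refine (lintegral_mono fun η => ?_).trans (hC2 n c)
    exact pow_le_pow_left' (enorm_pow_mul_measureConv_le ν _ K η) 2
  have hmain : ∫⁻ x : Space d, ENNReal.ofReal (‖((bracket x ^ (-β) : ℝ) : ℂ) *
        ∑ α ∈ level d n, c α * fracHermite s α x‖ ^ 2) =
      ∫⁻ η, ‖measureConv ν
        (fun ξ => (((2 * Real.pi * ‖ξ‖) ^ s : ℝ) : ℂ) * 𝓕 (levelSum n c) ξ) η‖ₑ ^ 2 := by
    rw [← eLpNorm_two_sq_enorm, ← eLpNorm_bracket_mul_fourierInv hν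
      (measurable_rpow_mul_fourier hi s) (integrable_rpow_mul_fourier_levelSum n c hs')
      (memLp_rpow_mul_fourier_levelSum n c hs'), eLpNorm_two_sq]
    refine lintegral_congr fun x => ?_
    rw [sum_mul_fracHermite n c hs']
  rw [hmain]
  have hpt : ∀ η, ‖measureConv ν
        (fun ξ => (((2 * Real.pi * ‖ξ‖) ^ s : ℝ) : ℂ) * 𝓕 (levelSum n c) ξ) η‖ₑ ^ 2 ≤
      ENNReal.ofReal (2 * Λ ^ s) * ‖k η‖ₑ ^ 2 + ENNReal.ofReal (2 * Λ ^ (s - K)) *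
        (ENNReal.ofReal ((2 * Real.pi * ‖η‖) ^ K) * ‖k η‖ₑ) ^ 2 +
      ENNReal.ofReal (2 * max 1 s ^ 2) * A η ^ 2 := fun η => by
    have hτ : 0 ≤ 2 * Real.pi * ‖η‖ := by positivity
    have h1 := enorm_measureConv_rpow_mul_le ν hi hs η
    have hsq : ∀ a b : ℝ≥0∞, (a + b) ^ 2 ≤ 2 * a ^ 2 + 2 * b ^ 2 := fun a b => by
      have := ENNReal.rpow_add_le_mul_rpow_add_rpow a b (p := 2) (by norm_num)
      norm_num at this
      rwa [mul_add] at this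
    refine (pow_le_pow_left' h1 2).trans ((hsq _ _).trans (add_le_add ?_ (le_of_eq ?_)))
    · have h2 : ENNReal.ofReal ((2 * Real.pi * ‖η‖) ^ s) ^ 2 ≤ ENNReal.ofReal (Λ ^ s) +
          ENNReal.ofReal (Λ ^ (s - K)) * ENNReal.ofReal ((2 * Real.pi * ‖η‖) ^ K) ^ 2 := by
        rw [← ENNReal.ofReal_pow (by positivity), ← ENNReal.ofReal_pow (by positivity),
          ← ENNReal.ofReal_mul (by positivity), ← ENNReal.ofReal_add (by positivity) (by positivity)]
        refine ENNReal.ofReal_le_ofReal ?_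
        have := rpow_two_mul_le_add hτ hΛ0 hs.le hKs
        rwa [mul_comm 2 s, Real.rpow_mul hτ, Real.rpow_two, mul_comm 2 K, pow_mul] at this
      rw [mul_pow, mul_pow, ENNReal.ofReal_mul (by norm_num), ENNReal.ofReal_mul (by norm_num),
        ENNReal.ofReal_ofNat]
      calc 2 * (ENNReal.ofReal ((2 * Real.pi * ‖η‖) ^ s) ^ 2 * ‖k η‖ₑ ^ 2)
          ≤ 2 * ((ENNReal.ofReal (Λ ^ s) + ENNReal.ofReal (Λ ^ (s - K)) *
            ENNReal.ofReal ((2 * Real.pi * ‖η‖) ^ K) ^ 2) * ‖k η‖ₑ ^ 2) := by gcongr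
        _ = _ := by ring
    · rw [mul_pow, ENNReal.ofReal_mul (by norm_num), ENNReal.ofReal_ofNat, mul_assoc,
        ENNReal.ofReal_pow (by positivity)]
  refine (lintegral_mono hpt).trans ?_
  have hA2 : AEMeasurable (fun η => ENNReal.ofReal (2 * max 1 s ^ 2) * A η ^ 2) := by
    have : Measurable A := by
      refine Measurable.lintegral_prod_right' (f := fun p : Space d × Space d =>
        ENNReal.ofReal ((1 + 2 * Real.pi * ‖p.2‖) ^ s) *
        (ENNReal.ofReal ((1 + 2 * Real.pi * ‖p.1 - p.2‖) ^ max (s - 1) 0) *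
          ‖𝓕 (levelSum n c) (p.1 - p.2)‖ₑ)) ?_
      fun_prop
    fun_prop
  rw [lintegral_add_right' _ hA2, lintegral_add_left (by fun_prop),
    lintegral_const_mul' _ _ ENNReal.ofReal_ne_top, lintegral_const_mul' _ _ ENNReal.ofReal_ne_top,
    lintegral_const_mul' _ _ ENNReal.ofReal_ne_top]
  have e1 : Λ ^ s * lam ^ (-β) ≤ lam ^ σ := by
    rw [hΛ, ← Real.rpow_mul hlam0.le, ← Real.rpow_add hlam0]
    refine Real.rpow_le_rpow_of_exponent_le hlam (le_of_eq ?_)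
    field_simp
    rw [hσ, hβdef, hsdef]
    ring
  have e2 : Λ ^ (s - K) * lam ^ (K : ℝ) ≤ lam ^ σ := by
    rw [hΛ, ← Real.rpow_mul hlam0.le, ← Real.rpow_add hlam0]
    refine Real.rpow_le_rpow_of_exponent_le hlam ?_
    have h1 : (1 + ε / s) * (s - K) + K = s + ε - K * ε / s := by
      field_simp
      ring
    have h2 : s + ε ≤ K * ε / s := by
      rw [div_le_iff₀ hε0] at hKε
      rw [le_div_iff₀ hs]
      linarith
    linarith
  have e3 : lam ^ max (s - 1) 0 ≤ lam ^ σ :=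
    Real.rpow_le_rpow_of_exponent_le hlam (max_le (by linarith) hσ0)
  calc _ ≤ ENNReal.ofReal (2 * Λ ^ s) * ENNReal.ofReal (C1 * lam ^ (-β) * S) +
        ENNReal.ofReal (2 * Λ ^ (s - K)) * ENNReal.ofReal (C2 * lam ^ (K : ℝ) * S) +
        ENNReal.ofReal (2 * max 1 s ^ 2) *
          ENNReal.ofReal (C3 * lam ^ max (s - 1) 0 * S) := by
        gcongr
        exact hC3 n c
    _ ≤ _ := by
        rw [← ENNReal.ofReal_mul (by positivity), ← ENNReal.ofReal_mul (by positivity),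
          ← ENNReal.ofReal_mul (by positivity), ← ENNReal.ofReal_add (by positivity) (by positivity),
          ← ENNReal.ofReal_add (by positivity) (by positivity)]
        refine ENNReal.ofReal_le_ofReal ?_
        calc _ = 2 * C1 * S * (Λ ^ s * lam ^ (-β)) + 2 * C2 * S * (Λ ^ (s - K) * lam ^ (K : ℝ)) +
              2 * max 1 s ^ 2 * C3 * S * lam ^ max (s - 1) 0 := by ring
          _ ≤ 2 * C1 * S * lam ^ σ + 2 * C2 * S * lam ^ σ +
              2 * max 1 s ^ 2 * C3 * S * lam ^ σ := by gcongr
          _ = _ := by ring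

/-- The same estimate when the order is not positive; then the weight is not needed, as
`‖|2πξ|^s 𝓕 f‖² ≲ λ^s ‖f‖²`. -/
lemma lintegral_bracket_mul_fracHermite_le_of_nonpos (d : ℕ) [NeZero d] {ε : ℝ}
    (hε : ε < 1 / 2) (hs : (d : ℝ) / 2 - 2 * ε ≤ 0) :
    ∃ C : ℝ, 0 < C ∧ ∀ (n : ℕ) (c : (Fin d → ℕ) → ℂ),
      ∫⁻ x : Space d, ENNReal.ofReal (‖((bracket x ^ (-(1 / 2 - ε)) : ℝ) : ℂ) *
        ∑ α ∈ level d n, c α * fracHermite ((d : ℝ) / 2 - 2 * ε) α x‖ ^ 2) ≤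
      ENNReal.ofReal (C * (2 * n + d : ℝ) ^ (((d : ℝ) - 1) / 2) *
        ∑ α ∈ level d n, ‖c α‖ ^ 2) := by
  have hd : (1 : ℝ) ≤ d := by exact_mod_cast Nat.pos_of_ne_zero (NeZero.ne d)
  set s : ℝ := (d : ℝ) / 2 - 2 * ε with hsdef
  have hs' : -(d : ℝ) / 2 < s := by linarith
  obtain ⟨C, hC0, hC⟩ := lintegral_norm_rpow_mul_level_sum_le d (p := s * 2)
    (by linarith) (by linarith)
  refine ⟨C, hC0, fun n c => ?_⟩
  have hlam := one_le_two_mul_add d n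
  have hS0 : 0 ≤ ∑ α ∈ level d n, ‖c α‖ ^ 2 := Finset.sum_nonneg fun _ _ => by positivity
  have h1 : ∫⁻ x : Space d, ENNReal.ofReal (‖((bracket x ^ (-(1 / 2 - ε)) : ℝ) : ℂ) *
        ∑ α ∈ level d n, c α * fracHermite s α x‖ ^ 2) ≤
      ∫⁻ x : Space d, ENNReal.ofReal (‖𝓕⁻ (fun ξ : Space d =>
        (((2 * Real.pi * ‖ξ‖) ^ s : ℝ) : ℂ) * 𝓕 (levelSum n c) ξ) x‖ ^ 2) := by
    refine lintegral_mono fun x => ENNReal.ofReal_le_ofReal ?_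
    rw [sum_mul_fracHermite n c hs', norm_mul, Complex.norm_real,
      Real.norm_of_nonneg (Real.rpow_nonneg (bracket_pos x).le _)]
    refine pow_le_pow_left₀ (mul_nonneg (Real.rpow_nonneg (bracket_pos x).le _) (norm_nonneg _)) ?_ 2
    exact mul_le_of_le_one_left (norm_nonneg _)
      (Real.rpow_le_one_of_one_le_of_nonpos (one_le_bracket x) (by linarith))
  refine h1.trans ?_
  rw [← eLpNorm_two_sq, eLpNorm_fourierInv (integrable_rpow_mul_fourier_levelSum n c hs')
    (memLp_rpow_mul_fourier_levelSum n c hs'), eLpNorm_two_sq]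
  have h2 := lintegral_weight_mul_fourier_levelSum (d := d) (w := fun r => r ^ (s * 2)) n c
    (by fun_prop)
  have h3 : ∫⁻ ξ : Space d, ENNReal.ofReal
        (‖(((2 * Real.pi * ‖ξ‖) ^ s : ℝ) : ℂ) * 𝓕 (levelSum n c) ξ‖ ^ 2) =
      ∫⁻ x : Space d, ENNReal.ofReal (‖x‖ ^ (s * 2) * ‖levelSum n c x‖ ^ 2) := by
    rw [← h2]
    refine lintegral_congr fun ξ => ?_
    have hτ : 0 ≤ 2 * Real.pi * ‖ξ‖ := by positivity
    rw [norm_mul, mul_pow, Complex.norm_real, Real.norm_of_nonneg (by positivity),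
      Real.rpow_mul hτ, Real.rpow_two]
  rw [h3]
  refine (hC n c).trans (ENNReal.ofReal_le_ofReal ?_)
  refine mul_le_mul_of_nonneg_right (mul_le_mul_of_nonneg_left ?_ hC0.le) hS0
  exact Real.rpow_le_rpow_of_exponent_le hlam (by linarith)

/-- The estimate `‖⟨x⟩^{-(1/2-ε)} √(-Δ)^{d/2-2ε} f‖² ≲ λ^{(d-1)/2} ‖f‖²` for eigenfunctions. -/
lemma lintegral_bracket_mul_fracHermite_le (d : ℕ) [NeZero d] {ε : ℝ} (hε0 : 0 < ε)
    (hε : ε < 1 / 2) :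
    ∃ C : ℝ, 0 < C ∧ ∀ (n : ℕ) (c : (Fin d → ℕ) → ℂ),
      ∫⁻ x : Space d, ENNReal.ofReal (‖((bracket x ^ (-(1 / 2 - ε)) : ℝ) : ℂ) *
        ∑ α ∈ level d n, c α * fracHermite ((d : ℝ) / 2 - 2 * ε) α x‖ ^ 2) ≤
      ENNReal.ofReal (C * (2 * n + d : ℝ) ^ (((d : ℝ) - 1) / 2) *
        ∑ α ∈ level d n, ‖c α‖ ^ 2) := by
  rcases lt_or_ge 0 ((d : ℝ) / 2 - 2 * ε) with h | h
  · exact lintegral_bracket_mul_fracHermite_le_of_pos d hε0 hε h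
  · exact lintegral_bracket_mul_fracHermite_le_of_nonpos d hε h

/-! ### Orthogonality in time -/

/-- The oscillation `e^{it(2n+d)}` of the `n`-th level. -/
noncomputable def levelPhase (d n : ℕ) (t : ℝ) : ℂ :=
  Complex.exp (Complex.I * t * ((2 * n + d : ℝ) : ℂ))

lemma continuous_levelPhase (d n : ℕ) : Continuous (levelPhase d n) := by
  unfold levelPhase
  fun_prop

lemma integral_levelPhase_mul_conj (d n m : ℕ) :
    ∫ t in Set.Icc (-Real.pi) Real.pi,
      levelPhase d n t * (starRingEnd ℂ) (levelPhase d m t) =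
      if n = m then (2 * Real.pi : ℂ) else 0 := by
  have e : ∀ t : ℝ, levelPhase d n t * (starRingEnd ℂ) (levelPhase d m t) =
      Complex.exp ((2 * ((n : ℂ) - m) * Complex.I) * t) := fun t => by
    rw [levelPhase, levelPhase, ← Complex.exp_conj, ← Complex.exp_add]
    congr 1
    simp [map_ofNat]
    ring
  simp_rw [e]
  rw [integral_Icc_eq_integral_Ioc, ← intervalIntegral.integral_of_le (by linarith [Real.pi_pos])]
  split_ifs with h
  · subst h
    simp
    ring
  · have h0 : (n : ℂ) - m ≠ 0 := sub_ne_zero.2 (by exact_mod_cast h)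
    rw [integral_exp_mul_complex (by simp [h0])]
    have h1 : Complex.exp (2 * ((n : ℂ) - m) * Complex.I * (Real.pi : ℝ)) = 1 := by
      have := Complex.exp_int_mul_two_pi_mul_I ((n : ℤ) - m)
      rw [← this]
      congr 1
      push_cast
      ring
    have h2 : Complex.exp (2 * ((n : ℂ) - m) * Complex.I * ((-Real.pi : ℝ) : ℂ)) = 1 := by
      have := Complex.exp_int_mul_two_pi_mul_I ((m : ℤ) - n)
      rw [← this]
      congr 1
      push_cast
      ring
    rw [h1, h2]
    simp

/-- Parseval's identity in time. -/
lemma integral_sq_norm_sum_levelPhase_mul (d : ℕ) (J : Finset ℕ) (a : ℕ → ℂ) :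
    ∫ t in Set.Icc (-Real.pi) Real.pi, ‖∑ n ∈ J, levelPhase d n t * a n‖ ^ 2 =
      2 * Real.pi * ∑ n ∈ J, ‖a n‖ ^ 2 := by
  have hc := continuous_levelPhase d
  have key : ((∫ t in Set.Icc (-Real.pi) Real.pi, ‖∑ n ∈ J, levelPhase d n t * a n‖ ^ 2 : ℝ) : ℂ) =
      ((2 * Real.pi * ∑ n ∈ J, ‖a n‖ ^ 2 : ℝ) : ℂ) := by
    rw [← integral_complex_ofReal]
    have e : ∀ t : ℝ, ((‖∑ n ∈ J, levelPhase d n t * a n‖ ^ 2 : ℝ) : ℂ) =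
        ∑ n ∈ J, ∑ m ∈ J, (levelPhase d n t * (starRingEnd ℂ) (levelPhase d m t)) *
          (a n * (starRingEnd ℂ) (a m)) := fun t => by
      push_cast
      rw [← Complex.mul_conj', map_sum, Finset.sum_mul_sum]
      refine Finset.sum_congr rfl fun n _ => Finset.sum_congr rfl fun m _ => ?_
      rw [map_mul]
      ring
    simp_rw [e]
    have hi : ∀ n m, IntegrableOn (fun t : ℝ =>
        (levelPhase d n t * (starRingEnd ℂ) (levelPhase d m t)) * (a n * (starRingEnd ℂ) (a m)))
        (Set.Icc (-Real.pi) Real.pi) := fun n m => by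
      have h1 := hc n
      have h2 := hc m
      exact Continuous.integrableOn_Icc (by fun_prop)
    rw [integral_finsetSum _ fun n _ => integrable_finsetSum _ fun m _ => hi n m]
    simp_rw [integral_finsetSum _ fun m _ => hi _ m, integral_mul_const,
      integral_levelPhase_mul_conj]
    push_cast
    rw [Finset.mul_sum]
    refine Finset.sum_congr rfl fun n hn => ?_
    simp [hn, Complex.mul_conj']
  exact_mod_cast key

lemma lintegral_spacetime_sum_levelPhase {d : ℕ} (J : Finset ℕ) {a : ℕ → Space d → ℂ}
    (ha : ∀ n, Continuous (a n)) :
    ∫⁻ p, ENNReal.ofReal (‖∑ n ∈ J, levelPhase d n p.1 * a n p.2‖ ^ 2) ∂(spacetime d) =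
      ENNReal.ofReal (2 * Real.pi) *
        ∑ n ∈ J, ∫⁻ x, ENNReal.ofReal (‖a n x‖ ^ 2) := by
  have hc := continuous_levelPhase d
  have hm : Continuous fun p : ℝ × Space d =>
      ‖∑ n ∈ J, levelPhase d n p.1 * a n p.2‖ ^ 2 := by fun_prop
  rw [spacetime, lintegral_prod_symm _ (by fun_prop), ← lintegral_finsetSum _ (fun n _ => by
    have := (ha n).measurable
    fun_prop), ← lintegral_const_mul _ (by
    have := fun n => (ha n).measurable
    fun_prop)]
  refine lintegral_congr fun x => ?_
  have hc' : Continuous fun t : ℝ => ‖∑ n ∈ J, levelPhase d n t * a n x‖ ^ 2 := by fun_prop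
  have h := ofReal_integral_eq_lintegral_ofReal
    (μ := volume.restrict (Set.Icc (-Real.pi) Real.pi)) hc'.integrableOn_Icc
    (Filter.Eventually.of_forall fun t => sq_nonneg _)
  rw [← h, integral_sq_norm_sum_levelPhase_mul d J fun n => a n x,
    ENNReal.ofReal_mul (by positivity), ENNReal.ofReal_sum_of_nonneg fun n _ => sq_nonneg _]

/-! ### From level estimates to space-time estimates -/

/-- The multi-indices of length less than `N`. -/
def levelsBelow (d N : ℕ) : Finset (Fin d → ℕ) := (Finset.range N).biUnion (level d)

lemma sum_levelsBelow {M : Type*} [AddCommMonoid M] (d N : ℕ) (f : (Fin d → ℕ) → M) :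
    ∑ α ∈ levelsBelow d N, f α = ∑ n ∈ Finset.range N, ∑ α ∈ level d n, f α := by
  refine Finset.sum_biUnion fun n _ m _ hnm => ?_
  rw [Function.onFun, Finset.disjoint_left]
  intro α h1 h2
  exact hnm ((mem_level.1 h1).symm.trans (mem_level.1 h2))

lemma tendsto_levelsBelow (d : ℕ) : Filter.Tendsto (levelsBelow d) Filter.atTop Filter.atTop := by
  refine Filter.tendsto_atTop_finset_of_monotone (fun N M h => ?_) fun α => ?_
  · exact Finset.biUnion_subset_biUnion_of_subset_left _ (Finset.range_mono h)
  · exact ⟨∑ i, α i + 1, Finset.mem_biUnion.2 ⟨∑ i, α i, by simp, mem_level.2 rfl⟩⟩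

lemma memLp_bracket_rpow_mul_schwartz {d : ℕ} {β : ℝ} (hβ : β ≤ 1) (φ : 𝓢(Space d, ℂ)) :
    MemLp (fun x => ((bracket x ^ β : ℝ) : ℂ) * φ x) 2 := by
  have hc : Continuous fun x : Space d => ((bracket x ^ β : ℝ) : ℂ) * φ x :=
    (Complex.continuous_ofReal.comp (continuous_bracket_rpow β)).mul φ.continuous
  rw [memLp_two_iff_integrable_sq_norm hc.aestronglyMeasurable]
  set C := ‖φ.toBoundedContinuousFunction‖ with hC
  have hi : Integrable fun x : Space d => C * (‖x‖ ^ 0 * ‖φ x‖ + ‖x‖ ^ 2 * ‖φ x‖) :=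
    ((φ.integrable_pow_mul volume 0).add (φ.integrable_pow_mul volume 2)).const_mul C
  refine hi.mono' (hc.norm.pow 2).aestronglyMeasurable (Filter.Eventually.of_forall fun x => ?_)
  have hb : bracket x ^ β ≤ bracket x := by
    simpa using Real.rpow_le_rpow_of_exponent_le (one_le_bracket x) hβ
  have hb2 : (bracket x ^ β) ^ 2 ≤ 1 + ‖x‖ ^ 2 := by
    refine (pow_le_pow_left₀ (Real.rpow_nonneg (bracket_pos x).le _) hb 2).trans_eq ?_
    rw [bracket, Real.sq_sqrt (by positivity)]
  have hCx : ‖φ x‖ ≤ C := φ.toBoundedContinuousFunction.norm_coe_le_norm x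
  rw [Real.norm_of_nonneg (sq_nonneg _), norm_mul, mul_pow, Complex.norm_real,
    Real.norm_of_nonneg (Real.rpow_nonneg (bracket_pos x).le _)]
  calc (bracket x ^ β) ^ 2 * ‖φ x‖ ^ 2 ≤ (1 + ‖x‖ ^ 2) * (C * ‖φ x‖) := by
        rw [sq ‖φ x‖]
        gcongr
    _ = _ := by ring

lemma tendsto_integral_mul_of_tendsto_lintegral_sq {α : Type*} [MeasurableSpace α] {μ : Measure α}
    {f : ℕ → α → ℂ} {g ψ : α → ℂ} (hf : ∀ n, MemLp (f n) 2 μ) (hg : MemLp g 2 μ)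
    (hψ : MemLp ψ 2 μ)
    (h : Filter.Tendsto (fun n => ∫⁻ x, ENNReal.ofReal (‖f n x - g x‖ ^ 2) ∂μ) Filter.atTop
      (nhds 0)) :
    Filter.Tendsto (fun n => ∫ x, f n x * ψ x ∂μ) Filter.atTop (nhds (∫ x, g x * ψ x ∂μ)) := by
  refine tendsto_integral_of_L1' _ (hg.integrable_mul hψ).aestronglyMeasurable
    (Filter.Eventually.of_forall fun n => (hf n).integrable_mul hψ) ?_
  have h1 : Filter.Tendsto (fun n => eLpNorm (fun x => f n x - g x) 2 μ) Filter.atTop (nhds 0) := by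
    have h2 := ((ENNReal.continuous_rpow_const (y := 1 / 2)).tendsto 0).comp h
    rw [ENNReal.zero_rpow_of_pos (by norm_num)] at h2
    refine h2.congr fun n => ?_
    rw [Function.comp_apply, ← eLpNorm_two_sq μ fun x => f n x - g x, ← ENNReal.rpow_natCast,
      ← ENNReal.rpow_mul]
    norm_num
  have h3 := ENNReal.Tendsto.mul_const h1 (Or.inr hψ.2.ne)
  rw [zero_mul] at h3
  refine tendsto_of_tendsto_of_tendsto_of_le_of_le tendsto_const_nhds h3 (fun _ => zero_le) fun n => ?_
  have h4 := eLpNorm_smul_le_mul_eLpNorm (p := 2) (q := 2) (r := 1) hψ.1 ((hf n).sub hg).1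
  refine le_trans (le_of_eq ?_) h4
  congr 1
  ext x
  simp [sub_mul]

/-- A sequence converging in `L²` of a product has a subsequence converging in `L²` on almost every
slice. -/
lemma exists_subseq_ae_slice_tendsto {d : ℕ} {g : ℕ → ℝ × Space d → ℝ≥0∞}
    (hg : ∀ n, AEMeasurable (g n) (spacetime d))
    (h : Filter.Tendsto (fun n => ∫⁻ p, g n p ∂(spacetime d)) Filter.atTop (nhds 0)) :
    ∃ N : ℕ → ℕ, StrictMono N ∧ ∀ᵐ t ∂(volume.restrict (Set.Icc (-Real.pi) Real.pi)),
      Filter.Tendsto (fun k => ∫⁻ x, g (N k) (t, x)) Filter.atTop (nhds 0) := by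
  have hex : ∀ k : ℕ, ∀ᶠ n in Filter.atTop, ∫⁻ p, g n p ∂(spacetime d) < 2⁻¹ ^ k := fun k =>
    h.eventually_lt_const (ENNReal.pow_pos (by simp) k)
  obtain ⟨N, hN, hN2⟩ := Filter.extraction_forall_of_eventually hex
  refine ⟨N, hN, ?_⟩
  have e : ∀ n, ∫⁻ p, g n p ∂(spacetime d) =
      ∫⁻ t in Set.Icc (-Real.pi) Real.pi, ∫⁻ x, g n (t, x) := fun n =>
    lintegral_prod _ (hg n)
  have hm : ∀ n, AEMeasurable (fun t => ∫⁻ x, g n (t, x))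
      (volume.restrict (Set.Icc (-Real.pi) Real.pi)) := fun n => (hg n).lintegral_prod_right'
  have hsum : ∫⁻ t in Set.Icc (-Real.pi) Real.pi, ∑' k, ∫⁻ x, g (N k) (t, x) ≠ ∞ := by
    rw [lintegral_tsum fun k => hm (N k)]
    simp_rw [← e]
    refine ne_top_of_le_ne_top ?_ (ENNReal.tsum_le_tsum fun k => (hN2 k).le)
    rw [ENNReal.tsum_geometric]
    simp
  filter_upwards [ae_lt_top' (AEMeasurable.tsum fun k => hm (N k)) hsum] with t ht
  exact ENNReal.tendsto_atTop_zero_of_tsum_ne_top ht.ne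

lemma norm_toLp_le_sqrt {α : Type*} [MeasurableSpace α] {μ : Measure α} {f : α → ℂ}
    (hf : MemLp f 2 μ) {r : ℝ} (hr : 0 ≤ r)
    (h : ∫⁻ x, ENNReal.ofReal (‖f x‖ ^ 2) ∂μ ≤ ENNReal.ofReal r) : ‖hf.toLp f‖ ≤ √r := by
  rw [← eLpNorm_two_sq] at h
  refine Real.le_sqrt_of_sq_le ?_
  rw [Lp.norm_toLp, ← ENNReal.toReal_pow]
  exact ENNReal.toReal_le_of_le_ofReal hr h

lemma bracket_rpow_neg_mul_rpow {d : ℕ} (x : Space d) (β : ℝ) :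
    ((bracket x ^ (-β) : ℝ) : ℂ) * ((bracket x ^ β : ℝ) : ℂ) = 1 := by
  rw [← Complex.ofReal_mul, ← Real.rpow_add (bracket_pos x)]
  simp

/-- If the functions `F_α` satisfy a weighted `L²` estimate on each level `|α| = n`, then the family
of distributions `∑_α e^{itλ_α} c_α F_α` satisfies a weighted space-time estimate: over a period in
time the contributions of different levels are orthogonal. -/
theorem weightedNorm_le_of_level_estimate {d : ℕ} {β σ B : ℝ} (hβ : β ≤ 1) (hB : 0 ≤ B)
    {F : (Fin d → ℕ) → Space d → ℂ} (hFc : ∀ α, Continuous (F α))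
    (hF : ∀ (n : ℕ) (c : (Fin d → ℕ) → ℂ),
      ∫⁻ x : Space d, ENNReal.ofReal (‖((bracket x ^ (-β) : ℝ) : ℂ) *
        ∑ α ∈ level d n, c α * F α x‖ ^ 2) ≤
      ENNReal.ofReal (B * (2 * n + d : ℝ) ^ σ * ∑ α ∈ level d n, ‖c α‖ ^ 2))
    {c : (Fin d → ℕ) → ℂ} (hc : Summable fun α => eigenvalue α ^ σ * ‖c α‖ ^ 2)
    {T : ℝ → 𝓢(Space d, ℂ) → ℂ}
    (hT : ∀ (t : ℝ) φ, HasSum (fun α => Complex.exp (Complex.I * t * eigenvalue α) * c α *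
      ∫ x, F α x * φ x) (T t φ)) :
    weightedNorm β T ≤
      ENNReal.ofReal (√(2 * Real.pi * B * ∑' α, eigenvalue α ^ σ * ‖c α‖ ^ 2)) := by
  have hterm : ∀ α : Fin d → ℕ, 0 ≤ eigenvalue α ^ σ * ‖c α‖ ^ 2 := fun α => by
    have : 0 ≤ eigenvalue α := by unfold eigenvalue; positivity
    positivity
  set a : ℕ → Space d → ℂ := fun n x =>
    ((bracket x ^ (-β) : ℝ) : ℂ) * ∑ α ∈ level d n, c α * F α x with ha
  set b : ℕ → ℝ := fun n => 2 * Real.pi * B *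
    ∑ α ∈ level d n, eigenvalue α ^ σ * ‖c α‖ ^ 2 with hb
  have hb0 : ∀ n, 0 ≤ b n := fun n =>
    mul_nonneg (by positivity) (Finset.sum_nonneg fun α _ => hterm α)
  have hwc : ∀ γ : ℝ, Continuous fun x : Space d => ((bracket x ^ γ : ℝ) : ℂ) := fun γ =>
    Complex.continuous_ofReal.comp (continuous_bracket_rpow γ)
  have hac : ∀ n, Continuous (a n) := fun n =>
    (hwc _).mul (continuous_finsetSum _ fun α _ => continuous_const.mul (hFc α))
  have hbJ : ∀ J : Finset ℕ, ENNReal.ofReal (2 * Real.pi) *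
      ∑ n ∈ J, ∫⁻ x, ENNReal.ofReal (‖a n x‖ ^ 2) ≤ ENNReal.ofReal (∑ n ∈ J, b n) := fun J => by
    rw [Finset.mul_sum, ENNReal.ofReal_sum_of_nonneg fun n _ => hb0 n]
    refine Finset.sum_le_sum fun n _ => ?_
    refine (mul_le_mul_right (hF n c) _).trans_eq ?_
    rw [← ENNReal.ofReal_mul (by positivity), hb]
    congr 1
    beta_reduce
    rw [mul_assoc (2 * Real.pi), mul_assoc B, Finset.mul_sum]
    congr 2
    refine Finset.sum_congr rfl fun α hα => ?_
    rw [eigenvalue_of_mem_level hα]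
  have hbsum : ∀ N, ∑ n ∈ Finset.range N, b n ≤
      2 * Real.pi * B * ∑' α, eigenvalue α ^ σ * ‖c α‖ ^ 2 := fun N => by
    rw [hb, ← Finset.mul_sum, ← sum_levelsBelow]
    exact mul_le_mul_of_nonneg_left (hc.sum_le_tsum _ fun α _ => hterm α) (by positivity)
  have hbs : Summable b := summable_of_sum_range_le hb0 hbsum
  -- the partial sums, and their convergence in `L²` of space-time
  have hJ : ∀ J : Finset ℕ, ∫⁻ p, ENNReal.ofReal
      (‖∑ n ∈ J, levelPhase d n p.1 * a n p.2‖ ^ 2) ∂(spacetime d) ≤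
      ENNReal.ofReal (∑ n ∈ J, b n) := fun J => by
    rw [lintegral_spacetime_sum_levelPhase J hac]
    exact hbJ J
  have hJc : ∀ J : Finset ℕ, Continuous fun p : ℝ × Space d =>
      ∑ n ∈ J, levelPhase d n p.1 * a n p.2 := fun J => by
    have := continuous_levelPhase d
    fun_prop
  have hJL : ∀ J : Finset ℕ, MemLp (fun p : ℝ × Space d =>
      ∑ n ∈ J, levelPhase d n p.1 * a n p.2) 2 (spacetime d) := fun J =>
    memLp_two_of_lintegral_lt_top (hJc J).aestronglyMeasurable
      ((hJ J).trans_lt ENNReal.ofReal_lt_top)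
  set V : ℕ → ℝ × Space d → ℂ := fun N p =>
    ∑ n ∈ Finset.range N, levelPhase d n p.1 * a n p.2 with hV
  set v : ℕ → Lp ℂ 2 (spacetime d) := fun N => (hJL (Finset.range N)).toLp (V N) with hv
  have hdist : ∀ M N, M ≤ N → dist (v M) (v N) ≤ √(∑' k, b (k + M)) := fun M N h => by
    have e : v N - v M = (hJL (Finset.Ico M N)).toLp _ := by
      rw [hv, ← MemLp.toLp_sub]
      refine MemLp.toLp_congr _ _ (Filter.Eventually.of_forall fun p => ?_)
      exact (Finset.sum_Ico_eq_sub (fun n => levelPhase d n p.1 * a n p.2) h).symm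
    rw [dist_comm, dist_eq_norm, e]
    refine (norm_toLp_le_sqrt _ (Finset.sum_nonneg fun n _ => hb0 n) (hJ _)).trans ?_
    refine Real.sqrt_le_sqrt ?_
    rw [Finset.sum_Ico_eq_sum_range]
    simp_rw [add_comm M]
    exact ((summable_nat_add_iff M).2 hbs).sum_le_tsum _ fun k _ => hb0 _
  have htail : Filter.Tendsto (fun M => √(∑' k, b (k + M))) Filter.atTop (nhds 0) := by
    have := (Real.continuous_sqrt.tendsto 0).comp (tendsto_sum_nat_add b)
    rwa [Real.sqrt_zero] at this
  obtain ⟨X, hX⟩ := cauchySeq_tendsto_of_complete (cauchySeq_of_le_tendsto_0' _ hdist htail)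
  have hXn : ‖X‖ ≤ √(2 * Real.pi * B * ∑' α, eigenvalue α ^ σ * ‖c α‖ ^ 2) := by
    refine le_of_tendsto hX.norm (Filter.Eventually.of_forall fun N => ?_)
    exact (norm_toLp_le_sqrt _ (Finset.sum_nonneg fun n _ => hb0 n) (hJ _)).trans
      (Real.sqrt_le_sqrt (hbsum N))
  have hXm : StronglyMeasurable (X : ℝ × Space d → ℂ) := Lp.stronglyMeasurable X
  have hconv : Filter.Tendsto (fun N => ∫⁻ p, ENNReal.ofReal (‖V N p - X p‖ ^ 2) ∂(spacetime d))
      Filter.atTop (nhds 0) := by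
    have h1 : Filter.Tendsto (fun N => ENNReal.ofReal ‖v N - X‖ ^ 2) Filter.atTop (nhds 0) := by
      have h2 := (ENNReal.continuous_ofReal.tendsto 0).comp
        (tendsto_iff_norm_sub_tendsto_zero.1 hX)
      have h3 := ((ENNReal.continuous_pow 2).tendsto _).comp h2
      simpa [Function.comp_def] using h3
    refine h1.congr fun N => ?_
    rw [ofReal_norm, Lp.enorm_def, ← eLpNorm_two_sq (spacetime d) fun p => V N p - X p]
    congr 1
    refine eLpNorm_congr_ae ?_
    filter_upwards [Lp.coeFn_sub (v N) X, (hJL (Finset.range N)).coeFn_toLp] with p h1 h2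
    rw [h1, Pi.sub_apply, h2]
  -- convergence on almost every time slice
  obtain ⟨N, hNmono, hN⟩ := exists_subseq_ae_slice_tendsto
    (g := fun n p => ENNReal.ofReal (‖V n p - X p‖ ^ 2)) (fun n => by
      have h1 := (hJc (Finset.range n)).measurable
      have h2 := hXm.measurable
      exact Measurable.aemeasurable (by fun_prop)) hconv
  have hXslice : ∀ᵐ t ∂(volume.restrict (Set.Icc (-Real.pi) Real.pi)),
      MemLp (fun x => X (t, x)) 2 := by
    have h1 : ∫⁻ p, ENNReal.ofReal (‖X p‖ ^ 2) ∂(spacetime d) ≠ ∞ := by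
      rw [← eLpNorm_two_sq]
      exact ENNReal.pow_ne_top (Lp.eLpNorm_ne_top X)
    have hXme := hXm.measurable
    have hm : Measurable fun p => ENNReal.ofReal (‖X p‖ ^ 2) := by fun_prop
    have h2 : ∫⁻ t in Set.Icc (-Real.pi) Real.pi,
        ∫⁻ x, ENNReal.ofReal (‖X (t, x)‖ ^ 2) ≠ ∞ := by
      rw [← lintegral_prod _ hm.aemeasurable]
      exact h1
    filter_upwards [ae_lt_top hm.lintegral_prod_right' h2] with t ht
    exact memLp_two_of_lintegral_lt_top
      (hXm.comp_measurable measurable_prodMk_left).aestronglyMeasurable ht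
  have hFL : ∀ α, MemLp (fun x => ((bracket x ^ (-β) : ℝ) : ℂ) * F α x) 2 := fun α => by
    refine memLp_two_of_lintegral_lt_top ((hwc _).mul (hFc α)).aestronglyMeasurable
      (lt_of_le_of_lt ?_ (lt_of_le_of_lt (hF (∑ i, α i) (Pi.single α 1)) ENNReal.ofReal_lt_top))
    refine le_of_eq (lintegral_congr fun x => ?_)
    rw [Finset.sum_eq_single_of_mem α (mem_level.2 rfl)
      (fun α' _ h => by rw [Pi.single_eq_of_ne h, zero_mul]), Pi.single_eq_same, one_mul]
  have haL : ∀ n, MemLp (a n) 2 := fun n =>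
    memLp_two_of_lintegral_lt_top (hac n).aestronglyMeasurable
      ((hF n c).trans_lt ENNReal.ofReal_lt_top)
  refine iInf_le_of_le (fun p => ((bracket p.2 ^ β : ℝ) : ℂ) * X p) (iInf_le_of_le ?_
    (iInf_le_of_le ?_ ?_))
  · exact (((hwc β).comp continuous_snd).aestronglyMeasurable).mul hXm.aestronglyMeasurable
  · filter_upwards [hN, hXslice] with t ht hXt φ
    have hφ := memLp_bracket_rpow_mul_schwartz hβ φ
    have hcomm : ∀ x, ((bracket x ^ β : ℝ) : ℂ) * X (t, x) * φ x =
        X (t, x) * (((bracket x ^ β : ℝ) : ℂ) * φ x) := fun x => by ring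
    simp_rw [hcomm]
    refine ⟨hXt.integrable_mul hφ, ?_⟩
    have hVL : ∀ k, MemLp (fun x => V (N k) (t, x)) 2 := fun k =>
      memLp_finsetSum _ fun n _ => (haL n).const_mul (levelPhase d n t)
    have hlim := tendsto_integral_mul_of_tendsto_lintegral_sq hVL hXt hφ ht
    have hFφ : ∀ α, Integrable fun x => F α x * φ x := fun α => by
      refine ((hFL α).integrable_mul hφ).congr (Filter.Eventually.of_forall fun x => ?_)
      rw [Pi.mul_apply]
      linear_combination (F α x * φ x) * bracket_rpow_neg_mul_rpow x β
    have hsumV : ∀ M, ∫ x, V M (t, x) * (((bracket x ^ β : ℝ) : ℂ) * φ x) =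
        ∑ α ∈ levelsBelow d M, Complex.exp (Complex.I * t * eigenvalue α) * c α *
          ∫ x, F α x * φ x := fun M => by
      rw [sum_levelsBelow]
      have e : ∀ x, V M (t, x) * (((bracket x ^ β : ℝ) : ℂ) * φ x) =
          ∑ n ∈ Finset.range M, ∑ α ∈ level d n,
            Complex.exp (Complex.I * t * eigenvalue α) * c α * (F α x * φ x) := fun x => by
        rw [hV, Finset.sum_mul]
        refine Finset.sum_congr rfl fun n _ => ?_
        rw [ha]
        beta_reduce
        rw [show levelPhase d n t * (((bracket x ^ (-β) : ℝ) : ℂ) *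
            ∑ α ∈ level d n, c α * F α x) * (((bracket x ^ β : ℝ) : ℂ) * φ x) =
          levelPhase d n t * (((bracket x ^ (-β) : ℝ) : ℂ) * ((bracket x ^ β : ℝ) : ℂ)) *
            φ x * ∑ α ∈ level d n, c α * F α x by ring, bracket_rpow_neg_mul_rpow, Finset.mul_sum]
        refine Finset.sum_congr rfl fun α hα => ?_
        rw [levelPhase, eigenvalue_of_mem_level hα]
        ring
      simp_rw [e]
      rw [integral_finsetSum _ fun n _ => integrable_finsetSum _ fun α _ => (hFφ α).const_mul _]
      refine Finset.sum_congr rfl fun n _ => ?_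
      rw [integral_finsetSum _ fun α _ => (hFφ α).const_mul _]
      exact Finset.sum_congr rfl fun α _ => integral_const_mul _ _
    simp_rw [hsumV] at hlim
    exact tendsto_nhds_unique
      ((((hT t φ).comp (tendsto_levelsBelow d)).comp hNmono.tendsto_atTop)) hlim
  · have e : (fun p : ℝ × Space d => ((bracket p.2 ^ (-β) : ℝ) : ℂ) *
        (((bracket p.2 ^ β : ℝ) : ℂ) * X p)) = X := by
      ext p
      rw [← mul_assoc, bracket_rpow_neg_mul_rpow, one_mul]
    rw [e, ← Lp.enorm_def, ← ofReal_norm]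
    exact ENNReal.ofReal_le_ofReal hXn

/-! ### Hermite coefficients -/

lemma eigenvalue_nonneg {d : ℕ} (α : Fin d → ℕ) : 0 ≤ eigenvalue α := by
  unfold eigenvalue
  positivity

lemma one_le_eigenvalue {d : ℕ} [NeZero d] (α : Fin d → ℕ) : 1 ≤ eigenvalue α := by
  rw [eigenvalue_of_mem_level (mem_level.2 rfl)]
  exact one_le_two_mul_add d _

lemma hermiteCoeff_toLp {d : ℕ} {f : Space d → ℂ} (hf : MemLp f 2) (α : Fin d → ℕ) :
    hermiteCoeff (hf.toLp f) α = hermiteCoeff f α := by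
  refine integral_congr_ae ?_
  filter_upwards [hf.coeFn_toLp] with x hx
  rw [hx]

lemma summable_sq_hermiteCoeff {d : ℕ} (u : L2 d) :
    Summable fun α : Fin d → ℕ => ‖hermiteCoeff u α‖ ^ 2 := by
  simp_rw [hermiteCoeff_eq_inner]
  exact (orthonormal_hermiteL2 d).inner_products_summable (x := u)

lemma tsum_sq_hermiteCoeff_le {d : ℕ} (u : L2 d) :
    ∑' α : Fin d → ℕ, ‖hermiteCoeff u α‖ ^ 2 ≤ ‖u‖ ^ 2 := by
  simp_rw [hermiteCoeff_eq_inner]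
  exact (orthonormal_hermiteL2 d).tsum_inner_products_le (x := u)

lemma hasSum_schrodingerGroup {d : ℕ} (t : ℝ) (u : L2 d) :
    HasSum (fun α : Fin d → ℕ =>
      (Complex.exp (Complex.I * t * eigenvalue α) * hermiteCoeff u α) • hermiteL2 α)
      (schrodingerGroup t u) := by
  have h := ((orthonormal_hermiteL2 d).orthogonalFamily.summable_iff_norm_sq_summable
    (fun α => Complex.exp (Complex.I * t * eigenvalue α) * hermiteCoeff u α)).2 (by
      refine (summable_sq_hermiteCoeff u).congr fun α => ?_
      rw [norm_mul, mul_assoc, mul_comm Complex.I, ← Complex.ofReal_mul,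
        Complex.norm_exp_ofReal_mul_I, one_mul])
  exact h.hasSum

lemma hermiteCoeff_schrodingerGroup {d : ℕ} (t : ℝ) (u : L2 d) (α : Fin d → ℕ) :
    hermiteCoeff (schrodingerGroup t u) α =
      Complex.exp (Complex.I * t * eigenvalue α) * hermiteCoeff u α := by
  classical
  rw [hermiteCoeff_eq_inner]
  have h := (hasSum_schrodingerGroup t u).mapL (innerSL ℂ (hermiteL2 α))
  refine h.unique ?_
  have e : ∀ α', (innerSL ℂ (hermiteL2 α)) ((Complex.exp (Complex.I * t * eigenvalue α') *
      hermiteCoeff u α') • (hermiteL2 α' : L2 d)) = if α' = α then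
      Complex.exp (Complex.I * t * eigenvalue α) * hermiteCoeff u α else 0 := fun α' => by
    rw [map_smul, innerSL_apply_apply, orthonormal_iff_ite.1 (orthonormal_hermiteL2 d)]
    by_cases h : α' = α
    · subst h; simp
    · simp [h, Ne.symm h]
  simp_rw [e]
  exact hasSum_ite_eq α _

lemma hasLineDerivAt_hermiteFun {d : ℕ} (α : Fin d → ℕ) (j : Fin d) (x : Space d) :
    HasLineDerivAt ℝ (hermiteFun (α + Pi.single j 1))
      (√(2 * (α j + 1)) * hermiteFun α x - x j * hermiteFun (α + Pi.single j 1) x)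
      x (EuclideanSpace.single j 1) := by
  have hs : HasDerivAt (fun t : ℝ => x j + t) 1 0 := by
    simpa using (hasDerivAt_id (0 : ℝ)).const_add (x j)
  have h0 := hasDerivAt_hermiteLine (α j + 1) (x j + 0)
  have h := (h0.comp 0 hs).mul_const (∏ i ∈ Finset.univ.erase j, hermiteLine (α i) (x i))
  have e : ∀ β : Fin d → ℕ, (∀ i ≠ j, β i = α i) → ∀ y : Space d, (∀ i ≠ j, y i = x i) →
      hermiteFun β y = hermiteLine (β j) (y j) *
        ∏ i ∈ Finset.univ.erase j, hermiteLine (α i) (x i) := fun β hβ y hy => by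
    rw [hermiteFun, ← Finset.mul_prod_erase _ _ (Finset.mem_univ j)]
    congr 1
    refine Finset.prod_congr rfl fun i hi => ?_
    rw [hβ i (Finset.ne_of_mem_erase hi), hy i (Finset.ne_of_mem_erase hi)]
  have hα : ∀ i ≠ j, (α + Pi.single j 1 : Fin d → ℕ) i = α i := fun i hi => by simp [hi]
  have hα' : (α + Pi.single j 1 : Fin d → ℕ) j = α j + 1 := by simp
  unfold HasLineDerivAt
  have e1 : (fun t : ℝ => hermiteFun (α + Pi.single j 1) (x + t • EuclideanSpace.single j 1)) =
      fun t => hermiteLine (α j + 1) (x j + t) *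
        ∏ i ∈ Finset.univ.erase j, hermiteLine (α i) (x i) := by
    ext t
    rw [e _ hα _ fun i hi => by simp [hi], hα']
    simp
  rw [e1]
  refine h.congr_deriv ?_
  rw [e α (fun _ _ => rfl) x fun _ _ => rfl, e _ hα x fun _ _ => rfl, hα', add_zero, mul_one,
    hermiteLineDeriv_succ]
  ring

lemma memLp_coord_mul_schwartz {d : ℕ} (j : Fin d) (φ : 𝓢(Space d, ℂ)) :
    MemLp (fun x => ((x j : ℝ) : ℂ) * φ x) 2 := by
  refine (memLp_bracket_rpow_mul_schwartz le_rfl φ).mono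
    (Continuous.aestronglyMeasurable (by fun_prop)) (Filter.Eventually.of_forall fun x => ?_)
  rw [norm_mul, norm_mul, Complex.norm_real, Complex.norm_real, Real.rpow_one,
    Real.norm_of_nonneg (bracket_pos x).le]
  gcongr
  exact (abs_coord_le_norm x j).trans (norm_le_bracket x)

lemma memLp_lineDeriv_schwartz {d : ℕ} (v : Space d) (φ : 𝓢(Space d, ℂ)) :
    MemLp (fun x => lineDeriv ℝ φ x v) 2 :=
  ((LineDeriv.lineDerivOp v φ).memLp 2 volume).ae_eq
    (Filter.Eventually.of_forall fun x => SchwartzMap.lineDerivOp_apply v φ x)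

/-- The creation operator `x_j - ∂_j` shifts Hermite coefficients:
`c_{α + e_j}((x_j - ∂_j) φ) = √(2(α_j + 1)) c_α(φ)`. -/
lemma hermiteCoeff_creation {d : ℕ} (φ : 𝓢(Space d, ℂ)) (α : Fin d → ℕ) (j : Fin d) :
    hermiteCoeff (fun x => ((x j : ℝ) : ℂ) * φ x - lineDeriv ℝ φ x (EuclideanSpace.single j 1))
      (α + Pi.single j 1) = √(2 * (α j + 1)) * hermiteCoeff φ α := by
  have hX := memLp_coord_mul_schwartz j φ
  have hD := memLp_lineDeriv_schwartz (EuclideanSpace.single j 1) φ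
  have h2 := φ.memLp 2 volume
  have i1 : Integrable fun x : Space d => (hermiteFun (α + Pi.single j 1) x : ℂ) *
      (((x j : ℝ) : ℂ) * φ x) :=
    (memLp_hermiteFun (α + Pi.single j 1)).integrable_mul hX
  have i2 : Integrable fun x : Space d => (hermiteFun (α + Pi.single j 1) x : ℂ) *
      lineDeriv ℝ φ x (EuclideanSpace.single j 1) :=
    (memLp_hermiteFun (α + Pi.single j 1)).integrable_mul hD
  have i3 : Integrable fun x : Space d => (hermiteFun (α + Pi.single j 1) x : ℂ) * φ x :=
    (memLp_hermiteFun (α + Pi.single j 1)).integrable_mul h2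
  have i4 : Integrable fun x : Space d => (hermiteFun α x : ℂ) * φ x :=
    (memLp_hermiteFun α).integrable_mul h2
  have i5 : Integrable fun x : Space d =>
      ((√(2 * (α j + 1)) * hermiteFun α x - x j * hermiteFun (α + Pi.single j 1) x : ℝ) : ℂ) *
        φ x := by
    refine ((i4.const_mul (√(2 * (α j + 1)) : ℂ)).sub i1).congr
      (Filter.Eventually.of_forall fun x => ?_)
    simp only [Pi.sub_apply]
    push_cast
    ring
  have hp := integral_bilinear_hasLineDerivAt_right_eq_neg_left_of_integrable
    (B := ContinuousLinearMap.mul ℝ ℂ) (μ := (volume : Measure (Space d)))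
    (f := fun x => (hermiteFun (α + Pi.single j 1) x : ℂ)) (g := φ)
    (v := EuclideanSpace.single j 1)
    (f' := fun x => ((√(2 * (α j + 1)) * hermiteFun α x -
      x j * hermiteFun (α + Pi.single j 1) x : ℝ) : ℂ))
    (g' := fun x => lineDeriv ℝ φ x (EuclideanSpace.single j 1))
    i5 i2 i3 (fun x _ => (hasLineDerivAt_hermiteFun α j x).ofReal_comp)
    (fun x _ => (φ.differentiableAt.lineDifferentiableAt).hasLineDerivAt)
  simp only [ContinuousLinearMap.mul_apply'] at hp
  have e : ∫ x : Space d, ((√(2 * (α j + 1)) * hermiteFun α x -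
      x j * hermiteFun (α + Pi.single j 1) x : ℝ) : ℂ) * φ x =
      √(2 * (α j + 1)) * hermiteCoeff φ α -
        ∫ x : Space d, (hermiteFun (α + Pi.single j 1) x : ℂ) * (((x j : ℝ) : ℂ) * φ x) := by
    rw [hermiteCoeff, ← integral_const_mul, ← integral_sub (i4.const_mul _) i1]
    refine integral_congr_ae (Filter.Eventually.of_forall fun x => ?_)
    push_cast
    ring
  rw [e] at hp
  rw [hermiteCoeff]
  simp_rw [mul_sub]
  rw [integral_sub i1 i2, hp]
  ring

/-- Hermite coefficients of a Schwartz function decay: Bessel's inequality for `(x_j - ∂_j) φ` gives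
`∑_α 2(α_j + 1) |c_α(φ)|² < ∞` for every `j`. -/
lemma summable_eigenvalue_mul_sq_hermiteCoeff_schwartz {d : ℕ} (φ : 𝓢(Space d, ℂ)) :
    Summable fun α : Fin d → ℕ => eigenvalue α * ‖hermiteCoeff φ α‖ ^ 2 := by
  have h : ∀ j : Fin d, Summable fun α : Fin d → ℕ =>
      (2 * ((α j : ℝ) + 1)) * ‖hermiteCoeff φ α‖ ^ 2 := fun j => by
    have hm := (memLp_coord_mul_schwartz j φ).sub
      (memLp_lineDeriv_schwartz (EuclideanSpace.single j 1) φ)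
    have h1 := (summable_sq_hermiteCoeff (hm.toLp _)).comp_injective
      (add_left_injective (Pi.single j 1 : Fin d → ℕ))
    refine h1.congr fun α => ?_
    rw [Function.comp_apply, hermiteCoeff_toLp]
    have h2 := hermiteCoeff_creation φ α j
    refine (congrArg (fun z : ℂ => ‖z‖ ^ 2) h2).trans ?_
    rw [norm_mul, mul_pow, Complex.norm_real, Real.norm_of_nonneg (Real.sqrt_nonneg _),
      Real.sq_sqrt (by positivity)]
  refine (summable_sum fun j (_ : j ∈ Finset.univ) => h j).of_nonneg_of_le
    (fun α => mul_nonneg (eigenvalue_nonneg α) (sq_nonneg _)) fun α => ?_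
  rw [← Finset.sum_mul]
  refine mul_le_mul_of_nonneg_right ?_ (sq_nonneg _)
  rw [← Finset.mul_sum, Finset.sum_add_distrib, eigenvalue]
  simp
  have : (0 : ℝ) ≤ d := by positivity
  linarith

/-! ### The estimate for `√H` -/

lemma summable_sqrtHPow {d : ℕ} [NeZero d] {s : ℝ} (hs : s ≤ 1) (u : L2 d) (φ : 𝓢(Space d, ℂ)) :
    Summable fun α : Fin d → ℕ =>
      ((eigenvalue α ^ (s / 2) : ℝ) : ℂ) * hermiteCoeff u α * hermiteCoeff φ α := by
  refine Summable.of_norm_bounded ((summable_sq_hermiteCoeff u).add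
    (summable_eigenvalue_mul_sq_hermiteCoeff_schwartz φ)) fun α => ?_
  have h1 := one_le_eigenvalue α
  rw [norm_mul, norm_mul, Complex.norm_real,
    Real.norm_of_nonneg (Real.rpow_nonneg (by linarith) _)]
  have h2 : eigenvalue α ^ (s / 2) ≤ √(eigenvalue α) := by
    rw [Real.sqrt_eq_rpow]
    exact Real.rpow_le_rpow_of_exponent_le h1 (by linarith)
  have h3 := Real.sq_sqrt (eigenvalue_nonneg α)
  set r := √(eigenvalue α)
  have h4 : eigenvalue α ^ (s / 2) * ‖hermiteCoeff u α‖ * ‖hermiteCoeff φ α‖ ≤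
      r * ‖hermiteCoeff u α‖ * ‖hermiteCoeff φ α‖ := by gcongr
  have h5 : eigenvalue α * ‖hermiteCoeff φ α‖ ^ 2 = (r * ‖hermiteCoeff φ α‖) ^ 2 := by
    rw [mul_pow, h3]
  rw [h5]
  nlinarith [sq_nonneg (‖hermiteCoeff u α‖ - r * ‖hermiteCoeff φ α‖),
    sq_nonneg ‖hermiteCoeff u α‖, sq_nonneg (r * ‖hermiteCoeff φ α‖)]

/-- On the level `λ` the operator `√H^{1/2-2ε}` contributes `λ^{1/2-2ε}` to the square of the norm,
which is compensated by the gain `λ^{-(1/2-ε)}` from the weight. -/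
theorem weightedNorm_sqrtHPow_le (d : ℕ) [NeZero d] {ε : ℝ} (hε0 : 0 < ε) (hε : ε < 1 / 2) :
    ∃ C : ℝ, 0 < C ∧ ∀ u : L2 d,
      weightedNorm (1 / 2 - ε) (fun t => sqrtHPow (1 / 2 - 2 * ε) (schrodingerGroup t u)) ≤
        ENNReal.ofReal (C * ‖u‖) := by
  obtain ⟨B, hB0, hB⟩ := lintegral_bracket_mul_levelSum_le d (β := 1 / 2 - ε)
    (by linarith) (by linarith)
  set s : ℝ := 1 / 2 - 2 * ε with hs
  refine ⟨√(2 * Real.pi * B), by positivity, fun u => ?_⟩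
  have h := weightedNorm_le_of_level_estimate (d := d) (β := 1 / 2 - ε) (σ := 0) (B := B)
    (by linarith) hB0.le
    (F := fun α x => ((eigenvalue α ^ (s / 2) : ℝ) : ℂ) * hermiteFun α x)
    (fun α => continuous_const.mul (continuous_hermiteFun_ofReal α)) (fun n c => ?_)
    (c := hermiteCoeff u) (by simpa using summable_sq_hermiteCoeff u)
    (T := fun t => sqrtHPow s (schrodingerGroup t u)) (fun t φ => ?_)
  · refine h.trans (ENNReal.ofReal_le_ofReal ?_)
    simp only [Real.rpow_zero, one_mul]
    rw [Real.sqrt_mul (by positivity)]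
    refine mul_le_mul_of_nonneg_left ?_ (Real.sqrt_nonneg _)
    rw [Real.sqrt_le_left (norm_nonneg u)]
    exact tsum_sq_hermiteCoeff_le u
  · have hlam := one_le_two_mul_add d n
    set lam : ℝ := 2 * n + d with hlamdef
    have hlam0 : 0 < lam := by linarith
    have hS0 : 0 ≤ ∑ α ∈ level d n, ‖c α‖ ^ 2 := Finset.sum_nonneg fun _ _ => by positivity
    have e : ∀ x : Space d, ENNReal.ofReal (‖((bracket x ^ (-(1 / 2 - ε)) : ℝ) : ℂ) *
        ∑ α ∈ level d n, c α * (((eigenvalue α ^ (s / 2) : ℝ) : ℂ) * hermiteFun α x)‖ ^ 2) =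
        ENNReal.ofReal (lam ^ s) *
        ENNReal.ofReal (‖((bracket x ^ (-(1 / 2 - ε)) : ℝ) : ℂ) * levelSum n c x‖ ^ 2) := by
      intro x
      have e1 : ∑ α ∈ level d n, c α * (((eigenvalue α ^ (s / 2) : ℝ) : ℂ) * hermiteFun α x) =
          ((lam ^ (s / 2) : ℝ) : ℂ) * levelSum n c x := by
        rw [levelSum, Finset.mul_sum]
        refine Finset.sum_congr rfl fun α hα => ?_
        rw [eigenvalue_of_mem_level hα]
        ring
      rw [e1, ← ENNReal.ofReal_mul (by positivity), mul_left_comm, norm_mul, mul_pow,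
        Complex.norm_real, Real.norm_of_nonneg (by positivity), ← Real.rpow_two (lam ^ (s / 2)),
        ← Real.rpow_mul hlam0.le, div_mul_cancel₀ _ two_ne_zero]
    simp_rw [e]
    rw [lintegral_const_mul' _ _ ENNReal.ofReal_ne_top]
    refine (mul_le_mul_right (hB n c) _).trans ?_
    rw [← ENNReal.ofReal_mul (by positivity)]
    refine ENNReal.ofReal_le_ofReal ?_
    have h1 : lam ^ s * lam ^ (-(1 / 2 - ε)) ≤ 1 := by
      rw [← Real.rpow_add hlam0]
      exact Real.rpow_le_one_of_one_le_of_nonpos hlam (by linarith)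
    calc _ = B * (∑ α ∈ level d n, ‖c α‖ ^ 2) * (lam ^ s * lam ^ (-(1 / 2 - ε))) := by ring
      _ ≤ B * (∑ α ∈ level d n, ‖c α‖ ^ 2) * 1 := by gcongr
      _ = _ := by rw [Real.rpow_zero]; ring
  · have h1 := (summable_sqrtHPow (s := s) (by linarith) (schrodingerGroup t u) φ).hasSum
    refine HasSum.congr_fun h1 fun α => ?_
    rw [hermiteCoeff_schrodingerGroup]
    have e1 : ∫ x, ((eigenvalue α ^ (s / 2) : ℝ) : ℂ) * hermiteFun α x * φ x =
        ((eigenvalue α ^ (s / 2) : ℝ) : ℂ) * hermiteCoeff φ α := by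
      rw [hermiteCoeff, ← integral_const_mul]
      refine integral_congr_ae (Filter.Eventually.of_forall fun x => ?_)
      ring
    rw [e1]
    ring

/-! ### The estimate for `√(-Δ)` -/

/-- The condition `s > -d/2` makes `|ξ|^{2s}` integrable near the origin, where the Gaussian serves as a
cutoff; away from the origin a Schwartz function absorbs any power of `|ξ|`. -/
lemma memLp_rpow_mul_schwartz {d : ℕ} [NeZero d] (θ : 𝓢(Space d, ℂ)) {s : ℝ}
    (hs : -(d : ℝ) / 2 < s) :
    MemLp (fun ξ => (((2 * Real.pi * ‖ξ‖) ^ s : ℝ) : ℂ) * θ ξ) 2 := by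
  have hθ := θ.continuous.measurable
  have hm : Measurable fun ξ => (((2 * Real.pi * ‖ξ‖) ^ s : ℝ) : ℂ) * θ ξ := by fun_prop
  rw [memLp_two_iff_integrable_sq_norm hm.aestronglyMeasurable]
  obtain ⟨K, hK⟩ := exists_nat_ge s
  set C := ‖θ.toBoundedContinuousFunction‖ with hC
  have i1 := integrable_norm_rpow_mul_gauss (E := Space d) (p := s * 2) (b := 1)
    (by simp; linarith) one_pos
  have i2 := θ.integrable_pow_mul volume (2 * K)
  refine (((i1.const_mul (C ^ 2 * Real.exp 1)).add (i2.const_mul C)).const_mul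
    ((2 * Real.pi) ^ (s * 2))).mono' (hm.norm.pow_const 2).aestronglyMeasurable
    (Filter.Eventually.of_forall fun ξ => ?_)
  have hCξ : ‖θ ξ‖ ≤ C := θ.toBoundedContinuousFunction.norm_coe_le_norm ξ
  have hτ : 0 ≤ 2 * Real.pi * ‖ξ‖ := by positivity
  have hC0 : 0 ≤ C := norm_nonneg _
  rw [Real.norm_of_nonneg (sq_nonneg _), norm_mul, mul_pow, Complex.norm_real,
    Real.norm_of_nonneg (by positivity), ← Real.rpow_two, ← Real.rpow_mul hτ,
    Real.mul_rpow (by positivity) (norm_nonneg _), mul_assoc]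
  refine mul_le_mul_of_nonneg_left ?_ (by positivity)
  have p1 : 0 ≤ C ^ 2 * Real.exp 1 * (‖ξ‖ ^ (s * 2) * Real.exp (-1 * ‖ξ‖ ^ 2)) := by positivity
  have p2 : 0 ≤ C * (‖ξ‖ ^ (2 * K) * ‖θ ξ‖) := by positivity
  change _ ≤ C ^ 2 * Real.exp 1 * (‖ξ‖ ^ (s * 2) * Real.exp (-1 * ‖ξ‖ ^ 2)) +
    C * (‖ξ‖ ^ (2 * K) * ‖θ ξ‖)
  rcases le_total ‖ξ‖ 1 with h | h
  · have h1 : 1 ≤ Real.exp 1 * Real.exp (-1 * ‖ξ‖ ^ 2) := by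
      rw [← Real.exp_add]
      exact Real.one_le_exp (by nlinarith [norm_nonneg ξ])
    calc ‖ξ‖ ^ (s * 2) * ‖θ ξ‖ ^ 2 ≤ ‖ξ‖ ^ (s * 2) * C ^ 2 * 1 := by rw [mul_one]; gcongr
      _ ≤ ‖ξ‖ ^ (s * 2) * C ^ 2 * (Real.exp 1 * Real.exp (-1 * ‖ξ‖ ^ 2)) := by gcongr
      _ = C ^ 2 * Real.exp 1 * (‖ξ‖ ^ (s * 2) * Real.exp (-1 * ‖ξ‖ ^ 2)) := by ring
      _ ≤ _ := le_add_of_nonneg_right p2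
  · have h1 : ‖ξ‖ ^ (s * 2) ≤ ‖ξ‖ ^ (2 * K) := by
      rw [← Real.rpow_natCast]
      refine Real.rpow_le_rpow_of_exponent_le h ?_
      push_cast
      linarith
    calc ‖ξ‖ ^ (s * 2) * ‖θ ξ‖ ^ 2 ≤ ‖ξ‖ ^ (2 * K) * (C * ‖θ ξ‖) := by rw [sq]; gcongr
      _ = C * (‖ξ‖ ^ (2 * K) * ‖θ ξ‖) := by ring
      _ ≤ _ := le_add_of_nonneg_left p1

lemma continuous_fourierInv {d : ℕ} {f : Space d → ℂ} (hf : Integrable f) :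
    Continuous (𝓕⁻ f) := by
  have e : 𝓕⁻ f = fun x => 𝓕 f (-x) := by
    ext x
    rw [Real.fourierInv_eq_fourier_neg]
  rw [e]
  exact (continuous_fourier hf).comp continuous_neg

lemma integral_fourierInv_mul {d : ℕ} {f g : Space d → ℂ} (hf : Integrable f) (hg : Integrable g) :
    ∫ x, 𝓕⁻ f x * g x = ∫ ξ, f ξ * 𝓕⁻ g ξ := by
  have h := integral_fourier_mul hf hg.comp_neg
  have e : ∀ ξ, 𝓕⁻ g ξ = 𝓕 (fun x => g (-x)) ξ := fun ξ => by
    rw [Real.fourierInv_eq_fourier_comp_neg]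
  simp_rw [e]
  rw [← h, ← integral_neg_eq_self]
  refine integral_congr_ae (Filter.Eventually.of_forall fun x => ?_)
  simp only [Real.fourierInv_eq_fourier_neg, neg_neg]

/-- For fixed `φ` the functional `u ↦ ⟨√(-Δ)^s u, φ⟩` is continuous on `L²`. -/
lemma exists_clm_sqrtNegLaplacianPow {d : ℕ} [NeZero d] {s : ℝ} (hs : -(d : ℝ) / 2 < s)
    (φ : 𝓢(Space d, ℂ)) :
    ∃ L : L2 d →L[ℂ] ℂ, ∀ u, L u = sqrtNegLaplacianPow s u φ := by
  have hm := (memLp_rpow_mul_schwartz (𝓕⁻ φ : 𝓢(Space d, ℂ)) hs).star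
  refine ⟨(innerSL ℂ (hm.toLp _)).comp
    (Lp.fourierTransformₗᵢ (Space d) ℂ).toContinuousLinearEquiv.toContinuousLinearMap, fun u => ?_⟩
  change inner ℂ (hm.toLp _) (𝓕 u : L2 d) = _
  rw [L2.inner_def, sqrtNegLaplacianPow]
  refine integral_congr_ae ?_
  filter_upwards [hm.coeFn_toLp] with ξ hξ
  rw [hξ, RCLike.inner_apply]
  simp
  ring

/-- The distribution `√(-Δ)^s h_α` is the function `fracHermite s α`. -/
lemma sqrtNegLaplacianPow_hermiteL2 {d : ℕ} [NeZero d] {s : ℝ} (hs : -(d : ℝ) / 2 < s)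
    (α : Fin d → ℕ) (φ : 𝓢(Space d, ℂ)) :
    sqrtNegLaplacianPow s (hermiteL2 α) φ = ∫ x, fracHermite s α x * φ x := by
  rw [fracHermite, integral_fourierInv_mul (integrable_rpow_mul_fourier_hermiteFun α hs)
    φ.integrable, sqrtNegLaplacianPow]
  refine integral_congr_ae ?_
  filter_upwards [fourier_toLp_ae_eq (integrable_hermiteFun α) (memLp_hermiteFun α)] with ξ hξ
  rw [hermiteL2, hξ, SchwartzMap.fourierInv_coe]

/-- The multiplier is continuous on `L²` into the tempered distributions, so it acts term by term on
the Hermite expansion of `e^{itH} u`. -/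
theorem weightedNorm_sqrtNegLaplacianPow_le (d : ℕ) [NeZero d] {ε : ℝ} (hε0 : 0 < ε)
    (hε : ε < 1 / 2) :
    ∃ C : ℝ, 0 < C ∧ ∀ u : L2 d, MemHarmonicSobolev (((d : ℝ) - 1) / 2) u →
      weightedNorm (1 / 2 - ε)
          (fun t => sqrtNegLaplacianPow ((d : ℝ) / 2 - 2 * ε) (schrodingerGroup t u)) ≤
        ENNReal.ofReal (C * harmonicSobolevNorm (((d : ℝ) - 1) / 2) u) := by
  obtain ⟨B, hB0, hB⟩ := lintegral_bracket_mul_fracHermite_le d hε0 hε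
  have hd : (1 : ℝ) ≤ d := by exact_mod_cast Nat.pos_of_ne_zero (NeZero.ne d)
  set s : ℝ := (d : ℝ) / 2 - 2 * ε with hsdef
  have hs : -(d : ℝ) / 2 < s := by linarith
  refine ⟨√(2 * Real.pi * B), by positivity, fun u hu => ?_⟩
  have h := weightedNorm_le_of_level_estimate (β := 1 / 2 - ε) (by linarith) hB0.le
    (fun α => continuous_fourierInv (integrable_rpow_mul_fourier_hermiteFun α hs)) hB
    (c := hermiteCoeff u) hu (T := fun t => sqrtNegLaplacianPow s (schrodingerGroup t u))
    (fun t φ => ?_)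
  · rwa [Real.sqrt_mul (by positivity)] at h
  · obtain ⟨L, hL⟩ := exists_clm_sqrtNegLaplacianPow hs φ
    rw [← hL]
    refine HasSum.congr_fun ((hasSum_schrodingerGroup t u).mapL L) fun α => ?_
    rw [map_smul, hL, sqrtNegLaplacianPow_hermiteL2 hs]
    rfl

end HarmonicSmoothing

theorem theorem1p5 (d : ℕ) (hd : 1 ≤ d) (ε : ℝ) (hε₀ : 0 < ε) (hε₁ : ε < 1 / 2) :
    ∃ C : ℝ, 0 < C ∧
      (∀ u₀ : HarmonicSmoothing.L2 d,
        HarmonicSmoothing.weightedNorm (1 / 2 - ε)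
            (fun t => HarmonicSmoothing.sqrtHPow (1 / 2 - 2 * ε)
              (HarmonicSmoothing.schrodingerGroup t u₀))
          ≤ ENNReal.ofReal (C * ‖u₀‖)) ∧
      (∀ u₀ : HarmonicSmoothing.L2 d,
        HarmonicSmoothing.MemHarmonicSobolev (((d : ℝ) - 1) / 2) u₀ →
        HarmonicSmoothing.weightedNorm (1 / 2 - ε)
            (fun t => HarmonicSmoothing.sqrtNegLaplacianPow ((d : ℝ) / 2 - 2 * ε)
              (HarmonicSmoothing.schrodingerGroup t u₀))
          ≤ ENNReal.ofReal (C * HarmonicSmoothing.harmonicSobolevNorm (((d : ℝ) - 1) / 2) u₀)) := by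
  have : NeZero d := ⟨by omega⟩
  obtain ⟨C₁, hC₁, h₁⟩ := HarmonicSmoothing.weightedNorm_sqrtHPow_le d hε₀ hε₁
  obtain ⟨C₂, hC₂, h₂⟩ := HarmonicSmoothing.weightedNorm_sqrtNegLaplacianPow_le d hε₀ hε₁
  refine ⟨max C₁ C₂, lt_max_of_lt_left hC₁, fun u => (h₁ u).trans ?_,
    fun u hu => (h₂ u hu).trans ?_⟩
  · exact ENNReal.ofReal_le_ofReal
      (mul_le_mul_of_nonneg_right (le_max_left _ _) (norm_nonneg _))
  · exact ENNReal.ofReal_le_ofReal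
      (mul_le_mul_of_nonneg_right (le_max_right _ _) (Real.sqrt_nonneg _))
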